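/- **Setting.** Let $M\subset\mathbb R^2$ be a compact region bounded by a smooth Jordan curve, with Riemannian metric $g=c^{-2}\,\mathrm{id}$, where $c$ is smooth and positive on $M$. Assume that $(M,g)$ is strictly convex ($\partial M$ has positive definite second fundamental form) and non-trapping (every geodesic has a finite exit time). Points of the unit tangent bundle $SM$ are written $(x,\theta)$, for the unit vector $v=c(x)(\cos\theta,\sin\theta)$. The geodesic vector field is $$X=c(\cos\theta\,\partial_x+\sin\theta\,\partial_y)+(-\partial_y c\cos\theta+\partial_x c\sin\theta)\,\partial_\theta .$$ Let $\nu$ be the unit outward normal, $\mu(x,v)=g_x(\nu_x,v)$ and $\Gamma_\pm=\{(x,v)\in SM: x\in\partial M,\ \pm\mu(x,v)>0\}$. The exit time $\tau(x,v)$ is the supremum of the times up to which the geodesic starting at $(x,v)$ stays in $M$. The spaces $L^2(SM)$ and $L^2(\Gamma_+)$ of complex-valued functions are taken with respect to $c^{-2}\,dx\,d\theta$ and $ds\,d\theta$, where $ds$ is the $g$-arclength on $\partial M$. Let $(a,k)$ be real-valued and admissible: $0\le a\in L^\infty(M)$; $k$ is measurable on $SM$; and $0\le k(x,\cdot)\in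 L^1(S_xM)$ for a.e. $x$. Put $$Su(x,\theta)=\frac1{2\pi}\int_0^{2\pi}k(x,\theta-\theta')\,u(x,\theta')\,d\theta'$$ and assume subcriticality: for some constant $\delta>0$, $$\sigma_a(x):=a(x)-\frac1{2\pi}\int_0^{2\pi}k(x,\theta)\,d\theta\ \ge\ \delta\quad\text{for a.e. }x\in M.$$ Let $Q_\infty=\operatorname{ess\,sup}_{x\in M}a(x)+\operatorname{ess\,sup}_{x\in M}\int_0^{2\pi}k(x,\alpha)\,d\alpha$. Let $W^{1,2}_X(SM)=\{u\in L^2(SM): Xu\in L^2(SM)\}$, with $Xu$ understood in the sense of distributions on the interior of $SM$. For compact $K\subset\Gamma_\pm$, the trace $u|_K\in L^2(K,ds\,d\theta)$ is the extension by continuity of $u\mapsto u|_K$ from functions smooth up to the boundary to $W^{1,2}_X(SM)$ with norm $(\|u\|^2+\|Xu\|^2)^{1/2}$. The condition $u|_{\Gamma_-}=0$ means $u|_K=0$ for every compact $K\subset\Gamma_-$, and $u|_{\Gamma_+}=h$ means $u|_K=h|_K$ for every compact $K\subset\Gamma_+$. **Theorem.** There is a constant $C_0>0$ such that $\tau\le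 C_0|\mu|$ on $\Gamma_-$. For every $f\in L^2(SM)$ there is a unique $u\in W^{1,2}_X(SM)$ with $$Xu+au=Su+f \ \text{ in } SM,\qquad u|_{\Gamma_-}=0 .$$ This $u$ has a unique trace $u|_{\Gamma_+}$ in $L^2(\Gamma_+)$. The map $f\mapsto u|_{\Gamma_+}$ is linear and bounded from $L^2(SM)$ to $L^2(\Gamma_+)$, and for every constant $C_0$ such that $\tau\le C_0|\mu|$ on $\Gamma_-$ its norm is at most $\sqrt{C_0}\left(\frac{Q_\infty}{\delta}+1\right)$. -/

import Mathlib

open MeasureTheory Set Filter Topology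
open scoped ContDiff ENNReal NNReal

noncomputable section

/-- The plane `ℝ²` with its Euclidean structure. -/
abbrev Plane : Type := EuclideanSpace ℝ (Fin 2)

/-- A point `(x, θ)` of phase space in the global isothermal chart: it stands for the unit tangent
vector `c(x) (cos θ, sin θ)` at `x`. The angle is a real number; functions on phase space are
`2π`-periodic in it, and integrals run over one period. -/
abbrev Phase : Type := Plane × ℝ

/-- The Euclidean unit vector `(cos θ, sin θ)`. -/
def dir (θ : ℝ) : Plane := !₂[Real.cos θ, Real.sin θ]

/-- A compact planar region bounded by a smooth Jordan curve, with a smooth metric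
`g = c⁻² (dx² + dy²)`. The region is `{ρ ≤ 0}` for a smooth defining function `ρ`, and `bdry` is a
regular `1`-periodic parametrization of its boundary. -/
structure ConformalDomain where
  /-- the speed -/
  c : Plane → ℝ
  /-- the defining function -/
  ρ : Plane → ℝ
  /-- the boundary curve -/
  bdry : ℝ → Plane
  c_smooth : ContDiff ℝ ∞ c
  c_pos : ∀ x, ρ x ≤ 0 → 0 < c x
  ρ_smooth : ContDiff ℝ ∞ ρ
  ρ_regular : ∀ x, ρ x = 0 → gradient ρ x ≠ 0
  compact : IsCompact {x | ρ x ≤ 0}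
  bdry_smooth : ContDiff ℝ ∞ bdry
  bdry_periodic : Function.Periodic bdry 1
  bdry_regular : ∀ s, deriv bdry s ≠ 0
  bdry_injOn : InjOn bdry (Ico 0 1)
  bdry_range : range bdry = {x | ρ x = 0}

namespace ConformalDomain

variable (D : ConformalDomain)

/-- The closed region `M`. -/
def M : Set Plane := {x | D.ρ x ≤ 0}

/-- The boundary `∂M`. -/
def bd : Set Plane := {x | D.ρ x = 0}

/-- The Riemannian metric `g_x(v, w) = c(x)⁻² ⟨v, w⟩`. -/
def g (x v w : Plane) : ℝ := (D.c x ^ 2)⁻¹ * inner ℝ v w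

/-- The `g`-unit tangent vector at `x` with angle `θ`. -/
def unitVec (p : Phase) : Plane := D.c p.1 • dir p.2

/-- The `g`-unit outward normal at a boundary point. -/
def normal (x : Plane) : Plane :=
  (√(D.g x (gradient D.ρ x) (gradient D.ρ x)))⁻¹ • gradient D.ρ x

/-- `μ(x, v) = g_x(ν_x, v)`. -/
def mu (p : Phase) : ℝ := D.g p.1 (D.normal p.1) (D.unitVec p)

/-- `Γ₊`: boundary points with outgoing direction. -/
def outflow : Set Phase := {p | p.1 ∈ D.bd ∧ 0 < D.mu p}

/-- `Γ₋`: boundary points with incoming direction. -/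
def inflow : Set Phase := {p | p.1 ∈ D.bd ∧ D.mu p < 0}

/-- The Christoffel symbols of `g`, as a symmetric bilinear map:
`∇_v W = dW(v) + Γ_x(v, W)`. -/
def christoffel (x v w : Plane) : Plane :=
  (D.c x)⁻¹ • (inner ℝ v w • gradient D.c x - fderiv ℝ D.c x v • w - fderiv ℝ D.c x w • v)

/-- The second covariant derivative (Hessian) of `ρ` with respect to `g`. -/
def hess (x v w : Plane) : ℝ :=
  fderiv ℝ (fderiv ℝ D.ρ) x v w - fderiv ℝ D.ρ x (D.christoffel x v w)

/-- The second fundamental form `g(∇_v ν, w)` of `∂M` for `v, w` tangent to `∂M`. As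
`ν = grad ρ / |grad ρ|_g` it is the Hessian of `ρ` divided by `|grad ρ|_g = c ‖∇ρ‖`. -/
def secondFundForm (x v w : Plane) : ℝ :=
  D.hess x v w / (D.c x * ‖gradient D.ρ x‖)

/-- Strict convexity: `∂M` has positive definite second fundamental form. -/
def StrictlyConvex : Prop :=
  ∀ x ∈ D.bd, ∀ v : Plane, v ≠ 0 → D.g x (D.normal x) v = 0 → 0 < D.secondFundForm x v v

/-- The geodesic vector field
`X = c (cos θ ∂_x + sin θ ∂_y) + (-∂_y c cos θ + ∂_x c sin θ) ∂_θ`. -/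
def field (p : Phase) : Phase :=
  (D.c p.1 • dir p.2,
    -(fderiv ℝ D.c p.1 !₂[0, 1]) * Real.cos p.2 + fderiv ℝ D.c p.1 !₂[1, 0] * Real.sin p.2)

/-- `γ` restricted to `[0, t]` is the orbit of the geodesic flow that starts at `p`, and its
projection stays in `M`. -/
def IsOrbit (p : Phase) (t : ℝ) (γ : ℝ → Phase) : Prop :=
  γ 0 = p ∧ ∀ s ∈ Icc 0 t, HasDerivWithinAt γ (D.field (γ s)) (Icc 0 t) s ∧ (γ s).1 ∈ D.M

/-- The exit time `τ(x, v)`: the supremum of the times up to which the geodesic stays in `M`. -/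
def exitTime (p : Phase) : ℝ≥0∞ :=
  ⨆ t : {t : ℝ≥0 // ∃ γ, D.IsOrbit p t γ}, ((t : ℝ≥0) : ℝ≥0∞)

/-- No geodesic is trapped. -/
def NonTrapping : Prop := ∀ p : Phase, p.1 ∈ D.M → D.exitTime p < ⊤

/-- `τ ≤ C₀ |μ|` on `Γ₋`. -/
def IsConvexityConstant (C₀ : ℝ) : Prop :=
  ∀ p ∈ D.inflow, D.exitTime p ≤ ENNReal.ofReal (C₀ * |D.mu p|)

/-- Lebesgue measure on `M` (same null sets as the area of `g`). -/
def areaM : Measure Plane := volume.restrict D.M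

/-- The Liouville measure `dΣ³ = c⁻² dx dθ` on `SM`. -/
def liouville : Measure Phase :=
  (D.areaM.withDensity fun x => ENNReal.ofReal (D.c x ^ 2)⁻¹).prod
    (volume.restrict (Ioc 0 (2 * Real.pi)))

/-- The `g`-arclength measure `ds` on `∂M`. -/
def arclength : Measure Plane :=
  ((volume.restrict (Ioc (0 : ℝ) 1)).withDensity fun s =>
    ENNReal.ofReal √(D.g (D.bdry s) (deriv D.bdry s) (deriv D.bdry s))).map D.bdry

/-- The measure `dΣ² = ds dθ` on `∂SM`. -/
def bdMeasure : Measure Phase :=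
  D.arclength.prod (volume.restrict (Ioc 0 (2 * Real.pi)))

/-- `L²(SM)`. -/
abbrev L2SM : Type := Lp ℂ 2 D.liouville

/-- `L²(Γ₊) = L²(Γ₊, dΣ²)`. -/
abbrev L2Out : Type := Lp ℂ 2 (D.bdMeasure.restrict D.outflow)

/-- Smooth functions on phase space. Their restrictions to `SM` are the functions that are smooth
up to the boundary. -/
def IsSmooth (φ : Phase → ℂ) : Prop :=
  ContDiff ℝ ∞ φ ∧ ∀ x θ, φ (x, θ + 2 * Real.pi) = φ (x, θ)

/-- `X φ` for a differentiable function `φ`. -/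
def X (φ : Phase → ℂ) (p : Phase) : ℂ := fderiv ℝ φ p (D.field p)

/-- `w = X u` in the sense of distributions on the interior of `SM`. (`X` preserves `dΣ³`, so its
formal adjoint is `-X`.) -/
def IsWeakX (u w : D.L2SM) : Prop :=
  ∀ φ : Phase → ℂ, IsSmooth φ →
    (∃ K : Set Plane, IsCompact K ∧ K ⊆ interior D.M ∧ ∀ p : Phase, p.1 ∉ K → φ p = 0) →
    ∫ p, u p * D.X φ p ∂D.liouville = -∫ p, w p * φ p ∂D.liouville

/-- For `u` in `W_X^{1,2}(SM)` with `X u = w`, the trace of `u` on the subset `K` of the boundary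
is `h`: this is the extension by continuity of the restriction map `φ ↦ φ|_K`, from smooth `φ` with
the norm `(‖φ‖² + ‖X φ‖²)^{1/2}` to `L²(K, dΣ²)`. -/
def IsTraceOn (u w : D.L2SM) (K : Set Phase) (h : Phase → ℂ) : Prop :=
  ∃ φ : ℕ → Phase → ℂ, (∀ n, IsSmooth (φ n)) ∧
    Tendsto (fun n => eLpNorm (fun p => φ n p - u p) 2 D.liouville) atTop (𝓝 0) ∧
    Tendsto (fun n => eLpNorm (fun p => D.X (φ n) p - w p) 2 D.liouville) atTop (𝓝 0) ∧
    Tendsto (fun n => eLpNorm (fun p => φ n p - h p) 2 (D.bdMeasure.restrict K)) atTop (𝓝 0)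

/-- `u ∈ W_X^{1,2}(SM)` and `u|_{Γ₊} = h`, that is, `u|_K = h|_K` for every compact `K ⊆ Γ₊`. -/
def IsOutTrace (u : D.L2SM) (h : D.L2Out) : Prop :=
  ∃ w : D.L2SM, D.IsWeakX u w ∧ ∀ K, IsCompact K → K ⊆ D.outflow → D.IsTraceOn u w K h

/-- The scattering term `S u(x, θ) = (2π)⁻¹ ∫ k(x, θ - θ') u(x, θ') dθ'`. -/
def scatter (k : Plane → ℝ → ℝ) (u : Phase → ℂ) (p : Phase) : ℂ :=
  (2 * Real.pi : ℂ)⁻¹ * ∫ θ' in (0 : ℝ)..(2 * Real.pi), (k p.1 (p.2 - θ') : ℂ) * u (p.1, θ')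

/-- `σ_p = k₀`, the mean of `k(x, ·)` over the circle. -/
def meanScatter (k : Plane → ℝ → ℝ) (x : Plane) : ℝ :=
  (2 * Real.pi)⁻¹ * ∫ θ in (0 : ℝ)..(2 * Real.pi), k x θ

/-- Admissible optical parameters: `0 ≤ a ∈ L^∞(M)` and `0 ≤ k(x, ·) ∈ L¹(S_x M)` for a.e. `x`,
where `k` is a measurable function on `SM`. -/
structure Admissible (a : Plane → ℝ) (k : Plane → ℝ → ℝ) : Prop where
  a_memLp : MemLp a ⊤ D.areaM
  a_nonneg : ∀ᵐ x ∂D.areaM, 0 ≤ a x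
  k_periodic : ∀ x ∈ D.M, Function.Periodic (k x) (2 * Real.pi)
  k_measurable : AEStronglyMeasurable (fun p : Phase => k p.1 p.2) D.liouville
  k_nonneg : ∀ᵐ x ∂D.areaM, ∀ᵐ θ ∂volume.restrict (Ioc 0 (2 * Real.pi)), 0 ≤ k x θ
  k_integrable : ∀ᵐ x ∂D.areaM, IntegrableOn (k x) (Ioc 0 (2 * Real.pi))

/-- `σ_a = a - σ_p ≥ δ` almost everywhere on `M`. -/
def Subcritical (a : Plane → ℝ) (k : Plane → ℝ → ℝ) (δ : ℝ) : Prop :=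
  ∀ᵐ x ∂D.areaM, δ ≤ a x - meanScatter k x

/-- `Q_∞ = sup_x a(x) + sup_x ∫ k(x, α) dα` (essential suprema over `M`). -/
def Qinf (a : Plane → ℝ) (k : Plane → ℝ → ℝ) : ℝ :=
  essSup a D.areaM + essSup (fun x => ∫ α in (0 : ℝ)..(2 * Real.pi), k x α) D.areaM

/-- `u ∈ W_X^{1,2}(SM)` solves `X u + a u = S u + f` with `u|_{Γ₋} = 0`; the boundary condition
means that the trace of `u` vanishes on every compact subset of `Γ₋`. -/
def IsSolution (a : Plane → ℝ) (k : Plane → ℝ → ℝ) (f u : D.L2SM) : Prop :=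
  ∃ w : D.L2SM, D.IsWeakX u w ∧
    (∀ᵐ p ∂D.liouville, w p + (a p.1 : ℂ) * u p = scatter k u p + f p) ∧
    ∀ K, IsCompact K → K ⊆ D.inflow → D.IsTraceOn u w K 0

end ConformalDomain

end

/-! Energy estimate. For smooth `φ` vanishing at the boundary points whose direction is not
outgoing, Green's formula (`integral_X`) gives `2 Re ∫ Xφ φ̄ = ∫ μ |φ|² ≥ 0` over `Γ₊`, so the
transport operator is accretive. The collision operator `B = a - S` has norm at most `Q_∞` and, by
Schur's test and subcriticality, is coercive with constant `δ` (`exists_collision`). Hence `X u + B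
u = f` forces `δ ‖u‖ ≤ ‖f‖` and `‖X u‖ = ‖f - B u‖ ≤ (Q_∞ / δ + 1) ‖f‖`.

Trace estimate (`VanishesOnInflow.integral_outflow_le`). From `p ∈ Γ₊` the orbit is followed back to
its entry point, where `φ = 0`. Its length is at most `C₀ μ(p)`, so Cauchy–Schwarz gives `|φ(p)|² ≤
C₀ μ(p) ∫ |Xφ|²` along the orbit, and a one-sided Santaló formula bounds the integral over `Γ₊` by
`C₀ ‖Xφ‖²`. The two estimates together give the norm bound.

Solvability. The operator is realised as `graph`, the closure of the triples (function, derivative,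
outgoing trace) of such smooth `φ`. `X + l` has dense range because the integrals `∫ e^{-ls}
f(Φ_{-s} p) ds` solve the damped equation. A Hilbert space argument (`bijective_of_accretive`) then
passes from `l` to the coercive `B`. Uniqueness in the stated weak sense is a weak-equals-strong
statement (`exists_mem_graph`): pairing with solutions of the adjoint equation, whose boundary
values live on a compact part of `Γ₋`, shows that every solution lies in `graph`.

Geometry. The exit time is never differentiated. The geodesic field is cut off outside `M` so that
it has a complete Lipschitz flow, and strict convexity ensures that orbits which left `M` do not
return (`ρ_nonneg_of_slope_nonneg`). Integrals over a fixed time span of functions supported inside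
`M` therefore satisfy the boundary condition automatically, and a Friedrichs mollification makes
them smooth. The bound `τ ≤ C₀ |μ|` comes from uniform convexity of `ρ` along nearly tangential
geodesics and, for the other directions, from a uniform bound on exit times. -/

noncomputable section

/-! ### Flows of bounded Lipschitz vector fields -/

/-- `Φ` is the global flow of the autonomous vector field `F`. -/
structure IsFlow {E : Type*} [NormedAddCommGroup E] [NormedSpace ℝ E] (F : E → E)
    (Φ : ℝ → E → E) : Prop where
  zero : ∀ p, Φ 0 p = p
  hasDerivAt : ∀ p t, HasDerivAt (fun s => Φ s p) (F (Φ t p)) t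

section Flow

variable {E : Type*} [NormedAddCommGroup E] [NormedSpace ℝ E] {F : E → E} {K : ℝ≥0}

theorem exists_isFlow [CompleteSpace E] (hF : LipschitzWith K F) {B : ℝ≥0}
    (hB : ∀ x, ‖F x‖ ≤ B) : ∃ Φ, IsFlow F Φ := by
  have key : ∀ p : E, ∀ n : ℕ, ∃ α : ℝ → E, α 0 = p ∧ ∀ t ∈ Icc (-(n : ℝ)) n,
      HasDerivWithinAt α (F (α t)) (Icc (-(n : ℝ)) n) t := by
    intro p n
    have h0 : (0 : ℝ) ∈ Icc (-(n : ℝ)) n := by constructor <;> simp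
    -- A field bounded by `B` cannot leave the ball of radius `B * n` before time `n`, so
    -- Picard–Lindelöf works on the whole interval at once.
    have hpl : IsPicardLindelof (fun _ => F) (⟨0, h0⟩ : Icc (-(n : ℝ)) n) p (B * n) 0 B K :=
      IsPicardLindelof.of_time_independent (fun x _ => hB x) hF.lipschitzOnWith (by simp)
    exact hpl.exists_eq_forall_mem_Icc_hasDerivWithinAt₀
  choose α h0 hα using key
  have hαd : ∀ p (n : ℕ), ∀ t ∈ Ioo (-(n : ℝ)) n, HasDerivAt (α p n) (F (α p n t)) t := fun p n t ht =>
    (hα p n t (Ioo_subset_Icc_self ht)).hasDerivAt (Icc_mem_nhds ht.1 ht.2)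
  have heq : ∀ p (m n : ℕ), m ≤ n → EqOn (α p m) (α p n) (Ioo (-(m : ℝ)) m) := by
    intro p m n hmn t ht
    have hm : (0 : ℝ) < m := by have := ht.1.trans ht.2; linarith
    have hmn' : (m : ℝ) ≤ n := by exact_mod_cast hmn
    refine ODE_solution_unique_of_mem_Ioo (v := fun _ => F) (s := fun _ => univ) (K := K)
      (fun _ _ => hF.lipschitzOnWith) (t₀ := 0) (a := -(m : ℝ)) (b := m) ⟨by linarith, hm⟩
      (fun t ht => ⟨hαd p m t ht, trivial⟩)
      (fun t ht => ⟨hαd p n t ⟨by linarith [ht.1], by linarith [ht.2]⟩, trivial⟩) ?_ ht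
    rw [h0, h0]
  -- The `+ 1` puts `t` into the open interval, where the curves for different `n` agree.
  refine ⟨fun t p => α p (⌈|t|⌉₊ + 1) t, ⟨fun p => h0 _ _, fun p t => ?_⟩⟩
  have hmem : ∀ s : ℝ, s ∈ Ioo (-((⌈|s|⌉₊ + 1 : ℕ) : ℝ)) ((⌈|s|⌉₊ + 1 : ℕ) : ℝ) := by
    intro s
    have := Nat.le_ceil |s|
    rw [mem_Ioo, ← abs_lt]
    push_cast
    linarith
  -- One index that serves all `s` near `t`: if `|s| < |t| + 1`, then `⌈|s|⌉₊ + 1 ≤ N`.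
  set N := ⌈|t|⌉₊ + 2 with hN
  have htN : t ∈ Ioo (-(N : ℝ)) N := by
    have := hmem t
    push_cast [hN] at this ⊢
    constructor <;> linarith [this.1, this.2]
  have hev : (fun s => α p (⌈|s|⌉₊ + 1) s) =ᶠ[𝓝 t] α p N := by
    have h1 : ∀ᶠ s : ℝ in 𝓝 t, |s| < |t| + 1 :=
      (continuous_abs.tendsto t).eventually (gt_mem_nhds (by linarith))
    filter_upwards [h1] with s hs
    apply heq p _ _ _ (hmem s)
    have : ⌈|s|⌉₊ ≤ ⌈|t|⌉₊ + 1 := by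
      rw [Nat.ceil_le]; push_cast; linarith [Nat.le_ceil |t|]
    omega
  have h2 := (hαd p N t htN).congr_of_eventuallyEq hev
  rwa [← hev.eq_of_nhds] at h2

namespace IsFlow

variable {Φ : ℝ → E → E}

theorem neg (h : IsFlow F Φ) : IsFlow (fun p => -F p) (fun t => Φ (-t)) := by
  refine ⟨fun p => by simp [h.zero], fun p t => ?_⟩
  simpa [Function.comp_def] using (h.hasDerivAt p (-t)).scomp t (hasDerivAt_neg t)

theorem continuous_time (h : IsFlow F Φ) (p : E) : Continuous fun t => Φ t p :=
  continuous_iff_continuousAt.2 fun t => (h.hasDerivAt p t).continuousAt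

/-- A global integral curve coincides with the flow line through its starting point. -/
theorem eq_of_hasDerivAt (h : IsFlow F Φ) (hF : LipschitzWith K F) {γ : ℝ → E}
    (hγ : ∀ t, HasDerivAt γ (F (γ t)) t) (t : ℝ) : γ t = Φ t (γ 0) := by
  refine congrFun (ODE_solution_unique_univ (v := fun _ => F) (s := fun _ => univ) (K := K)
    (t₀ := 0) (g := fun t => Φ t (γ 0)) (fun _ => hF.lipschitzOnWith) (fun t => ⟨hγ t, trivial⟩)
    (fun t => ⟨h.hasDerivAt _ t, trivial⟩) ?_) t
  simp [h.zero]

/-- The flow of a vector field `F` and of a vector field `G` to which it is carried by an affine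
map with linear part `A` are conjugate. -/
theorem map_eq (h : IsFlow F Φ) (hF : LipschitzWith K F) {G : E → E} {Ψ : ℝ → E → E}
    (hΨ : IsFlow G Ψ) (A : E →L[ℝ] E) (b : E) (hA : ∀ p, F (A p + b) = A (G p)) (t : ℝ) (p : E) :
    A (Ψ t p) + b = Φ t (A p + b) := by
  have h1 := h.eq_of_hasDerivAt hF (γ := fun t => A (Ψ t p) + b) (fun t => by
    rw [hA]
    exact (A.hasFDerivAt.comp_hasDerivAt t (hΨ.hasDerivAt p t)).add_const b) t
  simpa [hΨ.zero] using h1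

theorem add (h : IsFlow F Φ) (hF : LipschitzWith K F) (s t : ℝ) (p : E) :
    Φ (s + t) p = Φ s (Φ t p) := by
  have h1 := h.eq_of_hasDerivAt hF (γ := fun s => Φ (s + t) p)
    (fun s => (h.hasDerivAt p (s + t)).comp_add_const s t) s
  simpa using h1

theorem dist_le_of_nonneg (h : IsFlow F Φ) (hF : LipschitzWith K F) (p q : E) {t : ℝ}
    (ht : 0 ≤ t) : dist (Φ t p) (Φ t q) ≤ dist p q * Real.exp (K * t) := by
  have := dist_le_of_trajectories_ODE (v := fun _ => F) (K := K) (f := fun t => Φ t p)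
    (g := fun t => Φ t q) (a := 0) (b := t) (δ := dist p q) (fun _ => hF)
    (h.continuous_time p).continuousOn (fun s _ => (h.hasDerivAt p s).hasDerivWithinAt)
    (h.continuous_time q).continuousOn (fun s _ => (h.hasDerivAt q s).hasDerivWithinAt)
    (by simp [h.zero]) t ⟨ht, le_rfl⟩
  simpa using this

theorem dist_le (h : IsFlow F Φ) (hF : LipschitzWith K F) (p q : E) (t : ℝ) :
    dist (Φ t p) (Φ t q) ≤ dist p q * Real.exp (K * |t|) := by
  rcases le_total 0 t with ht | ht
  · rw [abs_of_nonneg ht]; exact h.dist_le_of_nonneg hF p q ht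
  · rw [abs_of_nonpos ht]
    have hF' : LipschitzWith K fun p => -F p := hF.neg
    simpa using h.neg.dist_le_of_nonneg hF' p q (neg_nonneg.2 ht)

theorem dist_time_le (h : IsFlow F Φ) {B : ℝ≥0} (hB : ∀ x, ‖F x‖ ≤ B) (p : E) (s t : ℝ) :
    dist (Φ s p) (Φ t p) ≤ B * |s - t| := by
  have := Convex.norm_image_sub_le_of_norm_hasDerivWithin_le (f := fun t => Φ t p) (C := B)
    (s := univ) (fun x _ => (h.hasDerivAt p x).hasDerivWithinAt) (fun x _ => hB _) convex_univ
    (mem_univ t) (mem_univ s)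
  rwa [dist_eq_norm, ← Real.norm_eq_abs]

theorem lipschitzWith (h : IsFlow F Φ) (hF : LipschitzWith K F) (t : ℝ) :
    LipschitzWith (Real.toNNReal (Real.exp (K * |t|))) (Φ t) :=
  LipschitzWith.of_dist_le' fun p q => by
    rw [mul_comm]; exact h.dist_le hF p q t

/-- The derivative of `s ↦ Φ s p - s • F p` is `F (Φ s p) - F p`, which is `O(s)`. This compares
orbits with straight segments although `F` is only Lipschitz. -/
theorem norm_sub_linear_le (h : IsFlow F Φ) (hF : LipschitzWith K F) {B : ℝ≥0}
    (hB : ∀ x, ‖F x‖ ≤ B) (p : E) {t : ℝ} (ht : 0 ≤ t) :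
    ‖Φ t p - (p + t • F p)‖ ≤ K * B * t ^ 2 := by
  have hd : ∀ s ∈ Icc 0 t, HasDerivWithinAt (fun s => Φ s p - s • F p) (F (Φ s p) - F p)
      (Icc 0 t) s := fun s _ => by
    have := ((h.hasDerivAt p s).sub ((hasDerivAt_id s).smul_const (F p)))
    simpa [Pi.sub_def] using this.hasDerivWithinAt
  have hb : ∀ s ∈ Icc 0 t, ‖F (Φ s p) - F p‖ ≤ K * B * t := fun s hs => by
    rw [← dist_eq_norm]
    calc dist (F (Φ s p)) (F p) ≤ K * dist (Φ s p) p := hF.dist_le_mul _ _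
      _ = K * dist (Φ s p) (Φ 0 p) := by rw [h.zero]
      _ ≤ K * (B * |s - 0|) := by gcongr; exact h.dist_time_le hB p s 0
      _ ≤ K * B * t := by
        rw [sub_zero, abs_of_nonneg hs.1, mul_assoc]
        gcongr; exact hs.2
  have := (convex_Icc 0 t).norm_image_sub_le_of_norm_hasDerivWithin_le hd hb
    (left_mem_Icc.2 ht) (right_mem_Icc.2 ht)
  rw [h.zero, sub_zero, Real.norm_of_nonneg ht] at this
  calc _ = ‖Φ t p - t • F p - (p - (0 : ℝ) • F p)‖ := by congr 1; module
    _ ≤ _ := this.trans (le_of_eq (by ring))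

end IsFlow

/-! ### Integrals along the flow -/

/-- The integral of `f` along the past of the flow line through `p`, with absorption rate `l`. -/
def flowIntegral {G : Type*} [NormedAddCommGroup G] [NormedSpace ℝ G] (Φ : ℝ → E → E) (l S : ℝ)
    (f : E → G) (p : E) : G :=
  ∫ s in (0 : ℝ)..S, Real.exp (-l * s) • f (Φ (-s) p)

section FlowIntegral

variable {Φ : ℝ → E → E} {G : Type*} [NormedAddCommGroup G] [NormedSpace ℝ G] {f : E → G}
  {L : ℝ≥0}

theorem continuous_flowIntegrand (h : IsFlow F Φ) (hf : Continuous f) (l : ℝ) (p : E) :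
    Continuous fun s : ℝ => Real.exp (-l * s) • f (Φ (-s) p) :=
  (Real.continuous_exp.comp (continuous_const.mul continuous_id)).smul
    (hf.comp ((h.continuous_time p).comp continuous_neg))

theorem lipschitzWith_flowIntegral (h : IsFlow F Φ) (hF : LipschitzWith K F)
    (hf : LipschitzWith L f) {l S : ℝ} (hl : 0 ≤ l) (hS : 0 ≤ S) :
    ∃ L', LipschitzWith L' (flowIntegral Φ l S f) := by
  refine ⟨_, LipschitzWith.of_dist_le' (K := L * Real.exp (K * S) * S) fun p q => ?_⟩
  rw [dist_eq_norm, flowIntegral, flowIntegral, ← intervalIntegral.integral_sub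
    ((continuous_flowIntegrand h hf.continuous l p).intervalIntegrable _ _)
    ((continuous_flowIntegrand h hf.continuous l q).intervalIntegrable _ _)]
  refine (intervalIntegral.norm_integral_le_of_norm_le_const
    (C := L * Real.exp (K * S) * dist p q) fun s hs => ?_).trans (le_of_eq ?_)
  · rw [uIoc_of_le hS] at hs
    rw [← smul_sub, norm_smul, Real.norm_eq_abs, Real.abs_exp, ← dist_eq_norm]
    calc Real.exp (-l * s) * dist (f (Φ (-s) p)) (f (Φ (-s) q))
        ≤ 1 * (L * (dist p q * Real.exp (K * S))) := by
          gcongr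
          · exact Real.exp_le_one_iff.2 (by nlinarith [hs.1])
          · refine (hf.dist_le_mul _ _).trans ?_
            gcongr
            refine (h.dist_le hF _ _ _).trans ?_
            gcongr
            rw [abs_neg, abs_of_pos hs.1]; exact hs.2
      _ = _ := by ring
  · rw [sub_zero, abs_of_nonneg hS]; ring

/-- The substitution `r = t - s` moves the dependence on `t` into the limits of integration, so that
the derivative along the flow exists for merely continuous `f`. -/
theorem flowIntegral_comp_flow (h : IsFlow F Φ) (hF : LipschitzWith K F) (l S : ℝ) (p : E)
    (t : ℝ) : flowIntegral Φ l S f (Φ t p) =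
      Real.exp (-l * t) • ∫ r in (t - S)..t, Real.exp (l * r) • f (Φ r p) := by
  rw [flowIntegral, ← intervalIntegral.integral_smul]
  have := intervalIntegral.integral_comp_sub_left (a := 0) (b := S)
    (fun r => Real.exp (-l * t) • Real.exp (l * r) • f (Φ r p)) t
  rw [sub_zero] at this
  rw [← this]
  refine intervalIntegral.integral_congr fun s _ => ?_
  simp only [smul_smul, ← Real.exp_add, ← h.add hF]
  congr 2
  · ring
  · congr 1; ring

/-- The flow integral solves `X u + l u = f` up to the term `exp (-l S) • f ∘ Φ (-S)`. For `l > 0`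
this error is small when `S` is large; for `l = 0` it has a sign when `f ≥ 0`. -/
theorem hasDerivAt_flowIntegral [CompleteSpace G] (h : IsFlow F Φ) (hF : LipschitzWith K F)
    (hf : Continuous f) (l S : ℝ) (p : E) (t : ℝ) :
    HasDerivAt (fun t => flowIntegral Φ l S f (Φ t p))
      (f (Φ t p) - l • flowIntegral Φ l S f (Φ t p)
        - Real.exp (-l * S) • f (Φ (-S) (Φ t p))) t := by
  set k : ℝ → G := fun r => Real.exp (l * r) • f (Φ r p) with hk
  have hkc : Continuous k :=
    (Real.continuous_exp.comp (continuous_const.mul continuous_id)).smul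
      (hf.comp (h.continuous_time p))
  have hd : ∀ t, HasDerivAt (fun t => ∫ r in (0 : ℝ)..t, k r) (k t) t := fun t =>
    intervalIntegral.integral_hasDerivAt_right (hkc.intervalIntegrable _ _)
      hkc.aestronglyMeasurable.stronglyMeasurableAtFilter hkc.continuousAt
  have heq : (fun t => flowIntegral Φ l S f (Φ t p)) = fun t =>
      Real.exp (-l * t) • ((∫ r in (0 : ℝ)..t, k r) - ∫ r in (0 : ℝ)..(t - S), k r) := by
    funext t
    rw [flowIntegral_comp_flow h hF, intervalIntegral.integral_interval_sub_left
      (hkc.intervalIntegrable _ _) (hkc.intervalIntegrable _ _)]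
  have he : HasDerivAt (fun t : ℝ => Real.exp (-l * t)) (Real.exp (-l * t) * -l) t := by
    simpa using ((hasDerivAt_id t).const_mul (-l)).exp
  have h2 := he.smul ((hd t).sub ((hd (t - S)).comp_sub_const t S))
  have hval := congrFun heq t
  rw [heq, hval]
  refine h2.congr_deriv ?_
  simp only [Pi.sub_apply]
  simp only [hk, ← h.add hF, smul_sub, smul_smul, ← Real.exp_add]
  rw [show -S + t = t - S by ring, ← sub_eq_zero]
  rw [show -l * t + l * t = 0 by ring,
    show -l * t + l * (t - S) = -l * S by ring, Real.exp_zero]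
  module

/-- The derivative of `flowIntegral` along the flow. -/
def flowIntegralDeriv (Φ : ℝ → E → E) (l S : ℝ) (f : E → G) (p : E) : G :=
  f p - l • flowIntegral Φ l S f p - Real.exp (-l * S) • f (Φ (-S) p)

theorem lipschitzWith_flowIntegralDeriv (h : IsFlow F Φ) (hF : LipschitzWith K F)
    (hf : LipschitzWith L f) {l S : ℝ} (hl : 0 ≤ l) (hS : 0 ≤ S) :
    ∃ L', LipschitzWith L' (flowIntegralDeriv Φ l S f) := by
  obtain ⟨L₁, h₁⟩ := lipschitzWith_flowIntegral h hF hf hl hS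
  exact ⟨_, (hf.sub ((lipschitzWith_smul l).comp h₁)).sub
    ((lipschitzWith_smul (Real.exp (-l * S))).comp (hf.comp (h.lipschitzWith hF (-S))))⟩

/-- Smooth dependence of the flow on its starting point is avoided: a quadratic remainder along the
segments `p + t • F p` is all that the mollification below needs. -/
theorem flowIntegral_add_smul_sub_le [CompleteSpace G] (h : IsFlow F Φ) (hF : LipschitzWith K F)
    {B : ℝ≥0} (hB : ∀ x, ‖F x‖ ≤ B) (hf : LipschitzWith L f) {l S : ℝ} (hl : 0 ≤ l)
    (hS : 0 ≤ S) : ∃ C, ∀ p, ∀ t : ℝ, 0 ≤ t →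
      ‖flowIntegral Φ l S f (p + t • F p) - flowIntegral Φ l S f p
        - t • flowIntegralDeriv Φ l S f p‖ ≤ C * t ^ 2 := by
  obtain ⟨L₁, h₁⟩ := lipschitzWith_flowIntegral h hF hf hl hS
  obtain ⟨L₂, h₂⟩ := lipschitzWith_flowIntegralDeriv h hF hf hl hS
  set u := flowIntegral Φ l S f with hu
  set v := flowIntegralDeriv Φ l S f with hv
  refine ⟨L₁ * (K * B) + L₂ * B, fun p t ht => ?_⟩
  have hd : ∀ s ∈ Icc 0 t, HasDerivWithinAt (fun s => u (Φ s p) - s • v p) (v (Φ s p) - v p)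
      (Icc 0 t) s := fun s _ => by
    have := (hasDerivAt_flowIntegral h hF hf.continuous l S p s).sub
      ((hasDerivAt_id s).smul_const (v p))
    simpa [hv, hu, flowIntegralDeriv, Pi.sub_def] using this.hasDerivWithinAt
  have hb : ∀ s ∈ Icc 0 t, ‖v (Φ s p) - v p‖ ≤ L₂ * B * t := fun s hs => by
    rw [← dist_eq_norm]
    calc dist (v (Φ s p)) (v p) ≤ L₂ * dist (Φ s p) p := h₂.dist_le_mul _ _
      _ = L₂ * dist (Φ s p) (Φ 0 p) := by rw [h.zero]
      _ ≤ L₂ * (B * |s - 0|) := by gcongr; exact h.dist_time_le hB p s 0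
      _ ≤ L₂ * B * t := by
        rw [sub_zero, abs_of_nonneg hs.1, mul_assoc]
        gcongr; exact hs.2
  have h3 := (convex_Icc 0 t).norm_image_sub_le_of_norm_hasDerivWithin_le hd hb
    (left_mem_Icc.2 ht) (right_mem_Icc.2 ht)
  rw [h.zero, sub_zero, Real.norm_of_nonneg ht] at h3
  have h4 : ‖u (p + t • F p) - u (Φ t p)‖ ≤ L₁ * (K * B * t ^ 2) := by
    rw [← dist_eq_norm, dist_comm]
    refine (h₁.dist_le_mul _ _).trans ?_
    gcongr
    rw [dist_eq_norm]; exact h.norm_sub_linear_le hF hB p ht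
  calc _ = ‖(u (p + t • F p) - u (Φ t p)) + (u (Φ t p) - t • v p - (u p - (0 : ℝ) • v p))‖ := by
        congr 1; module
    _ ≤ L₁ * (K * B * t ^ 2) + L₂ * B * t * t := (norm_add_le _ _).trans (add_le_add h4 h3)
    _ = _ := by ring

end FlowIntegral

end Flow

/-! ### Friedrichs mollification along a Lipschitz field -/

section Mollify

variable {E : Type*} [NormedAddCommGroup E] [NormedSpace ℝ E] [FiniteDimensional ℝ E]
  [MeasurableSpace E] [BorelSpace E] {G : Type*} [NormedAddCommGroup G] [NormedSpace ℝ G]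
  [CompleteSpace G]

/-- A Lipschitz function that is differentiable along a Lipschitz vector field can be approximated
uniformly by smooth functions, together with its derivative along the field. -/
theorem exists_contDiff_approx_along {F : E → E} {u v : E → G} {K L L' : ℝ≥0}
    (hF : LipschitzWith K F) (hu : LipschitzWith L u) (hv : LipschitzWith L' v) {C : ℝ}
    (huv : ∀ p, ∀ t : ℝ, 0 ≤ t → ‖u (p + t • F p) - u p - t • v p‖ ≤ C * t ^ 2)
    {ε : ℝ} (hε : 0 < ε) :
    ∃ φ : E → G, ContDiff ℝ ∞ φ ∧ (∀ p, ‖φ p - u p‖ ≤ L * ε) ∧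
      (∀ p, ‖fderiv ℝ φ p (F p) - v p‖ ≤ (L * K + L') * ε) ∧
      (∀ p, (∀ y, dist y p < ε → u y = 0) → φ p = 0) ∧
      ∀ T, (∀ y, u (y + T) = u y) → ∀ y, φ (y + T) = φ y := by
  let μ : Measure E := Measure.addHaar
  let η : ContDiffBump (0 : E) := ⟨ε / 2, ε, by positivity, by linarith⟩
  have hηc : Continuous (η.normed μ) := η.continuous_normed
  have hηs : HasCompactSupport (η.normed μ) := η.hasCompactSupport_normed
  have hηi : ∫ x, η.normed μ x ∂μ = 1 := η.integral_normed
  have hη0 : ∀ x, 0 ≤ η.normed μ x := fun x => η.nonneg_normed x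
  have hηsup : ∀ q, η.normed μ q ≠ 0 → ‖q‖ < ε := fun q hq => by
    have : q ∈ Function.support (η.normed μ) := hq
    rw [η.support_normed_eq] at this
    simpa using this
  have hint : ∀ w : E → G, Continuous w → ∀ p, Integrable (fun q => η.normed μ q • w (p - q)) μ :=
    fun w hw p => Continuous.integrable_of_hasCompactSupport (by fun_prop) hηs.smul_right
  let m : (E → G) → E → G := fun w p => ∫ q, η.normed μ q • w (p - q) ∂μ
  have hm : ∀ w : E → G, m w = convolution (η.normed μ) w (ContinuousLinearMap.lsmul ℝ ℝ) μ := fun w => rfl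
  have hbound : ∀ (w : E → G) (M : ℝ), (∀ q, ‖q‖ < ε → ‖w q‖ ≤ M) →
      ‖∫ q, η.normed μ q • w q ∂μ‖ ≤ M := by
    intro w M hM
    calc ‖∫ q, η.normed μ q • w q ∂μ‖ ≤ ∫ q, η.normed μ q * M ∂μ := by
          refine norm_integral_le_of_norm_le
            ((hηc.integrable_of_hasCompactSupport hηs).mul_const M) (ae_of_all _ fun q => ?_)
          rw [norm_smul, Real.norm_of_nonneg (hη0 q)]
          by_cases hq : η.normed μ q = 0
          · simp [hq]
          · exact mul_le_mul_of_nonneg_left (hM q (hηsup q hq)) (hη0 q)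
      _ = M := by rw [integral_mul_const, hηi, one_mul]
  have hclose : ∀ (w : E → G) (M : ℝ≥0), LipschitzWith M w → ∀ p, ‖m w p - w p‖ ≤ M * ε := by
    intro w M hw p
    have h1 : m w p - w p = ∫ q, η.normed μ q • (w (p - q) - w p) ∂μ := by
      have : w p = ∫ q, η.normed μ q • w p ∂μ := by rw [integral_smul_const, hηi, one_smul]
      conv_lhs => rw [this]
      rw [← integral_sub (hint w hw.continuous p)
        ((hηc.integrable_of_hasCompactSupport hηs).smul_const _)]
      simp only [smul_sub]
    rw [h1]
    refine hbound (fun q => w (p - q) - w p) _ fun q hq => ?_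
    rw [← dist_eq_norm]
    refine (hw.dist_le_mul _ _).trans ?_
    gcongr
    simpa [dist_eq_norm] using hq.le
  have hsm : ContDiff ℝ ∞ (m u) := by
    rw [hm]
    exact hηs.contDiff_convolution_left _ η.contDiff_normed hu.continuous.locallyIntegrable
  refine ⟨m u, hsm, hclose u L hu, fun p => ?_, fun p hp => ?_, fun T hT y => ?_⟩
  -- The commutator estimate. Under the convolution the known expansion of `u` at `p - q` is along
  -- `F (p - q)`, while `F p` is wanted. The two differ by at most `K ε`, which costs `L K ε t`;
  -- dividing by `t → 0` then removes the quadratic term.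
  · have hlin : ∀ t : ℝ, 0 ≤ t →
        ‖m u (p + t • F p) - m u p - t • m v p‖ ≤ C * t ^ 2 + L * K * ε * t := by
      intro t ht
      have h1 : m u (p + t • F p) - m u p - t • m v p =
          ∫ q, η.normed μ q • (u (p + t • F p - q) - u (p - q) - t • v (p - q)) ∂μ := by
        simp only [m]
        rw [← integral_smul, ← integral_sub (hint u hu.continuous _) (hint u hu.continuous _),
          ← integral_sub (by exact (hint u hu.continuous _).sub (hint u hu.continuous _))
            (by exact (hint v hv.continuous _).smul t)]
        refine integral_congr_ae (ae_of_all _ fun q => ?_)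
        simp only [smul_sub]
        rw [smul_comm t]
      rw [h1]
      refine hbound (fun q => u (p + t • F p - q) - u (p - q) - t • v (p - q)) _ fun q hq => ?_
      have h2 := huv (p - q) t ht
      have h3 : ‖u (p + t • F p - q) - u (p - q + t • F (p - q))‖ ≤ L * K * ε * t := by
        rw [← dist_eq_norm]
        refine (hu.dist_le_mul _ _).trans ?_
        have : dist (p + t • F p - q) (p - q + t • F (p - q)) = t * dist (F p) (F (p - q)) := by
          rw [dist_eq_norm, dist_eq_norm, ← Real.norm_of_nonneg ht, ← norm_smul,
            Real.norm_of_nonneg ht]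
          congr 1; module
        rw [this]
        have h4 : dist (F p) (F (p - q)) ≤ K * ε := by
          refine (hF.dist_le_mul _ _).trans ?_
          gcongr
          simpa [dist_eq_norm] using hq.le
        calc (L : ℝ) * (t * dist (F p) (F (p - q))) ≤ L * (t * (K * ε)) := by gcongr
          _ = _ := by ring
      calc _ = ‖(u (p - q + t • F (p - q)) - u (p - q) - t • v (p - q)) +
            (u (p + t • F p - q) - u (p - q + t • F (p - q)))‖ := by congr 1; abel
        _ ≤ _ := (norm_add_le _ _).trans (add_le_add h2 h3)
    have hd : HasDerivAt (fun t : ℝ => m u (p + t • F p)) (fderiv ℝ (m u) p (F p)) 0 := by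
      have h1 : HasDerivAt (fun t : ℝ => p + t • F p) (F p) 0 := by
        simpa using ((hasDerivAt_id (0 : ℝ)).smul_const (F p)).const_add p
      have h2 : HasFDerivAt (m u) (fderiv ℝ (m u) p) (p + (0 : ℝ) • F p) := by
        simpa using ((hsm.differentiable (by simp)) p).hasFDerivAt
      exact h2.comp_hasDerivAt 0 h1
    have hlim : ‖fderiv ℝ (m u) p (F p) - m v p‖ ≤ L * K * ε := by
      have ht := (hd.tendsto_slope_zero_right.sub_const (m v p)).norm
      have hr : Tendsto (fun t : ℝ => C * t + L * K * ε) (𝓝[>] 0) (𝓝 (L * K * ε)) := by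
        have : Tendsto (fun t : ℝ => C * t + L * K * ε) (𝓝 0) (𝓝 (C * 0 + L * K * ε)) :=
          (by fun_prop : Continuous fun t : ℝ => C * t + L * K * ε).tendsto 0
        simpa using this.mono_left nhdsWithin_le_nhds
      refine le_of_tendsto_of_tendsto ht hr ?_
      filter_upwards [self_mem_nhdsWithin] with t (ht : 0 < t)
      have h1 := hlin t ht.le
      rw [zero_add, zero_smul, add_zero]
      have h2 : t⁻¹ • (m u (p + t • F p) - m u p) - m v p =
          t⁻¹ • (m u (p + t • F p) - m u p - t • m v p) := by
        rw [smul_sub t⁻¹ (_ - _), smul_smul, inv_mul_cancel₀ ht.ne', one_smul]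
      rw [h2, norm_smul, norm_inv, Real.norm_of_nonneg ht.le, inv_mul_le_iff₀ ht]
      linarith [h1]
    calc ‖fderiv ℝ (m u) p (F p) - v p‖
        = ‖(fderiv ℝ (m u) p (F p) - m v p) + (m v p - v p)‖ := by congr 1; abel
      _ ≤ L * K * ε + L' * ε := (norm_add_le _ _).trans (add_le_add hlim (hclose v L' hv p))
      _ = _ := by ring
  · have : ‖∫ q, η.normed μ q • u (p - q) ∂μ‖ ≤ 0 := hbound (fun q => u (p - q)) 0 fun q hq => by
      rw [hp (p - q) (by simpa [dist_eq_norm] using hq), norm_zero]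
    exact norm_le_zero_iff.1 this
  · simp only [m]
    congr 1
    funext q
    rw [show y + T - q = y - q + T by abel, hT]

end Mollify

/-! ### The geodesic field and the defining function along geodesics -/

theorem hasDerivAt_dir (θ : ℝ) : HasDerivAt dir !₂[-Real.sin θ, Real.cos θ] θ := by
  have : HasDerivAt (fun t : ℝ => (![Real.cos t, Real.sin t] : Fin 2 → ℝ))
      ![-Real.sin θ, Real.cos θ] θ := by
    rw [hasDerivAt_pi]
    intro i
    fin_cases i
    · simpa using Real.hasDerivAt_cos θ
    · simpa using Real.hasDerivAt_sin θ
  exact (PiLp.continuousLinearEquiv 2 ℝ (fun _ : Fin 2 => ℝ)).symm.hasFDerivAt.comp_hasDerivAt θ this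

theorem contDiff_dir {n : WithTop ℕ∞} : ContDiff ℝ n dir := by
  rw [contDiff_euclidean]
  intro i
  fin_cases i
  · simpa [dir] using Real.contDiff_cos
  · simpa [dir] using Real.contDiff_sin

theorem norm_dir (θ : ℝ) : ‖dir θ‖ = 1 := by
  rw [EuclideanSpace.norm_eq]
  simp [dir, Fin.sum_univ_two]

theorem dir_add_pi (θ : ℝ) : dir (θ + Real.pi) = -dir θ := by
  ext i
  fin_cases i <;> simp [dir, Real.cos_add_pi, Real.sin_add_pi]

theorem Plane.clm_apply {G : Type*} [NormedAddCommGroup G] [NormedSpace ℝ G]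
    (A : Plane →L[ℝ] G) (v : Plane) : A v = v 0 • A !₂[1, 0] + v 1 • A !₂[0, 1] := by
  conv_lhs => rw [show v = v 0 • !₂[(1 : ℝ), 0] + v 1 • !₂[(0 : ℝ), 1] by
    ext i; fin_cases i <;> simp]
  rw [map_add, map_smul, map_smul]

theorem inner_gradient {f : Plane → ℝ} (x v : Plane) :
    inner ℝ (gradient f x) v = fderiv ℝ f x v := by
  rw [gradient, InnerProductSpace.toDual_symm_apply]

theorem Plane.inner_eq (v w : Plane) : inner ℝ v w = v 0 * w 0 + v 1 * w 1 := by
  simp [PiLp.inner_apply, Fin.sum_univ_two, mul_comm]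

theorem gradient_zero_coord {f : Plane → ℝ} (x : Plane) :
    gradient f x 0 = fderiv ℝ f x !₂[1, 0] := by
  rw [← inner_gradient, Plane.inner_eq]; simp

theorem gradient_one_coord {f : Plane → ℝ} (x : Plane) :
    gradient f x 1 = fderiv ℝ f x !₂[0, 1] := by
  rw [← inner_gradient, Plane.inner_eq]; simp

namespace ConformalDomain

variable (D : ConformalDomain)

theorem contDiff_unitVec : ContDiff ℝ ∞ D.unitVec :=
  (D.c_smooth.comp contDiff_fst).smul (contDiff_dir.comp contDiff_snd)

theorem contDiff_field : ContDiff ℝ ∞ D.field := by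
  have h : ContDiff ℝ ∞ (fderiv ℝ D.c) := D.c_smooth.fderiv_right (by simp)
  have h1 : ContDiff ℝ ∞ fun p : Phase => fderiv ℝ D.c p.1 := h.comp contDiff_fst
  refine D.contDiff_unitVec.prodMk (ContDiff.add (ContDiff.mul (ContDiff.neg ?_) ?_)
    (ContDiff.mul ?_ ?_))
  · exact h1.clm_apply contDiff_const
  · exact Real.contDiff_cos.comp contDiff_snd
  · exact h1.clm_apply contDiff_const
  · exact Real.contDiff_sin.comp contDiff_snd

/-- `X ρ`, the rate of change of the defining function along geodesics. -/
def slope (p : Phase) : ℝ := fderiv ℝ D.ρ p.1 (D.unitVec p)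

/-- `X X ρ`, the second derivative of the defining function along geodesics. -/
def slopeDeriv (p : Phase) : ℝ := fderiv ℝ D.slope p (D.field p)

theorem contDiff_slope : ContDiff ℝ ∞ D.slope := by
  have h : ContDiff ℝ ∞ (fderiv ℝ D.ρ) := D.ρ_smooth.fderiv_right (by simp)
  exact (h.comp contDiff_fst).clm_apply D.contDiff_unitVec

theorem contDiff_slopeDeriv : ContDiff ℝ ∞ D.slopeDeriv := by
  have h : ContDiff ℝ ∞ (fderiv ℝ D.slope) := D.contDiff_slope.fderiv_right (by simp)
  exact h.clm_apply D.contDiff_field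

theorem unitVec_add_pi (p : Phase) : D.unitVec (p + (0, Real.pi)) = -D.unitVec p := by
  simp [unitVec, dir_add_pi]

/-- Time reversal: turning the direction by `π` reverses the geodesic flow. Statements about the
past of a point follow in this way from statements about the future. -/
theorem field_add_pi (p : Phase) : D.field (p + (0, Real.pi)) = -D.field p := by
  ext1
  · simp [field, dir_add_pi]
  · simp [field, Real.cos_add_pi, Real.sin_add_pi]; ring

theorem slope_add_pi (p : Phase) : D.slope (p + (0, Real.pi)) = -D.slope p := by
  simp only [slope, unitVec_add_pi, map_neg]
  simp

theorem add_two_pi_eq (p : Phase) :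
    p + (0, 2 * Real.pi) = p + (0, Real.pi) + (0, Real.pi) := by
  ext1 <;> simp; ring

theorem field_add_two_pi (p : Phase) : D.field (p + (0, 2 * Real.pi)) = D.field p := by
  rw [add_two_pi_eq, field_add_pi, field_add_pi, neg_neg]

theorem slope_add_two_pi (p : Phase) : D.slope (p + (0, 2 * Real.pi)) = D.slope p := by
  rw [add_two_pi_eq, slope_add_pi, slope_add_pi, neg_neg]

theorem slopeDeriv_add_two_pi (p : Phase) :
    D.slopeDeriv (p + (0, 2 * Real.pi)) = D.slopeDeriv p := by
  have : fderiv ℝ D.slope (p + (0, 2 * Real.pi)) = fderiv ℝ D.slope p := by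
    rw [← fderiv_comp_add_right]
    congr 1
    exact funext D.slope_add_two_pi
  rw [slopeDeriv, slopeDeriv, field_add_two_pi, this]

/-- This is the geodesic equation `∇_v v = 0`. It links the explicit formula for `field` to the
Levi-Civita connection used in the second fundamental form. -/
theorem fderiv_unitVec_field (p : Phase) :
    fderiv ℝ D.unitVec p (D.field p) = -D.christoffel p.1 (D.unitVec p) (D.unitVec p) := by
  have h1 : HasFDerivAt (fun p : Phase => D.c p.1)
      ((fderiv ℝ D.c p.1).comp (ContinuousLinearMap.fst ℝ Plane ℝ)) p :=
    ((D.c_smooth.differentiable (by simp)) p.1).hasFDerivAt.comp p hasFDerivAt_fst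
  have h2 : HasFDerivAt (fun p : Phase => dir p.2)
      ((ContinuousLinearMap.toSpanSingleton ℝ !₂[-Real.sin p.2, Real.cos p.2]).comp
        (ContinuousLinearMap.snd ℝ Plane ℝ)) p :=
    (hasDerivAt_dir p.2).hasFDerivAt.comp p hasFDerivAt_snd
  have h3 : HasFDerivAt D.unitVec _ p := h1.smul h2
  rw [h3.fderiv]
  have hcs := Real.sin_sq_add_cos_sq p.2
  set x := p.1
  set A := fderiv ℝ D.c x
  have hA : A (dir p.2) = Real.cos p.2 * A !₂[1, 0] + Real.sin p.2 * A !₂[0, 1] := by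
    rw [Plane.clm_apply A]; simp [dir]
  have hin : inner ℝ (D.unitVec p) (D.unitVec p) = D.c x ^ 2 := by
    rw [real_inner_self_eq_norm_sq, unitVec, norm_smul, norm_dir, mul_one, Real.norm_eq_abs, sq_abs]
  have hAv : A (D.unitVec p) = D.c x * A (dir p.2) := by rw [unitVec, map_smul, smul_eq_mul]
  have hf1 : A (D.field p).1 = D.c x * A (dir p.2) := by rw [field, map_smul, smul_eq_mul]
  rw [christoffel, hin, hAv]
  ext i
  fin_cases i
  · simp [hf1, hA, gradient_zero_coord]
    simp [unitVec, dir, field, x, A]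
    field_simp
    linear_combination -D.c p.1 * (fderiv ℝ D.c p.1 !₂[1, 0]) * hcs
  · simp [hf1, hA, gradient_one_coord]
    simp [unitVec, dir, field, x, A]
    field_simp
    linear_combination -D.c p.1 * (fderiv ℝ D.c p.1 !₂[0, 1]) * hcs

/-- In the product rule for `X (dρ(v))`, the derivative of `v` contributes exactly the Christoffel
term of the covariant Hessian, by the geodesic equation. -/
theorem slopeDeriv_eq_hess (p : Phase) :
    D.slopeDeriv p = D.hess p.1 (D.unitVec p) (D.unitVec p) := by
  have hρ : ContDiff ℝ ∞ (fderiv ℝ D.ρ) := D.ρ_smooth.fderiv_right (by simp)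
  have h1 : HasFDerivAt (fun p : Phase => fderiv ℝ D.ρ p.1)
      ((fderiv ℝ (fderiv ℝ D.ρ) p.1).comp (ContinuousLinearMap.fst ℝ Plane ℝ)) p :=
    ((hρ.differentiable (by simp)) p.1).hasFDerivAt.comp p hasFDerivAt_fst
  have h2 : HasFDerivAt D.unitVec (fderiv ℝ D.unitVec p) p :=
    ((D.contDiff_unitVec.differentiable (by simp)) p).hasFDerivAt
  have h3 : HasFDerivAt D.slope _ p := h1.clm_apply h2
  rw [slopeDeriv, h3.fderiv, hess]
  simp [fderiv_unitVec_field D p]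
  rw [neg_add_eq_sub]
  rfl

theorem gradient_ne_zero {x : Plane} (hx : x ∈ D.bd) : 0 < ‖gradient D.ρ x‖ :=
  norm_pos_iff.2 (D.ρ_regular x hx)

theorem bd_subset : D.bd ⊆ D.M := fun _ hx => le_of_eq hx

theorem c_pos_of_mem {x : Plane} (hx : x ∈ D.M) : 0 < D.c x := D.c_pos x hx

theorem normal_eq {x : Plane} (hx : x ∈ D.bd) :
    D.normal x = (D.c x * ‖gradient D.ρ x‖⁻¹) • gradient D.ρ x := by
  have hc := D.c_pos_of_mem (D.bd_subset hx)
  rw [normal, g, real_inner_self_eq_norm_sq, Real.sqrt_mul (by positivity), Real.sqrt_inv,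
    Real.sqrt_sq hc.le, Real.sqrt_sq (norm_nonneg _), mul_inv, inv_inv]

/-- `μ` is the Euclidean inner product of the Euclidean unit normal and direction. -/
theorem mu_eq {p : Phase} (hp : p.1 ∈ D.bd) :
    D.mu p = ‖gradient D.ρ p.1‖⁻¹ * fderiv ℝ D.ρ p.1 (dir p.2) := by
  have hc := D.c_pos_of_mem (D.bd_subset hp)
  rw [mu, g, D.normal_eq hp, unitVec, inner_smul_left, inner_smul_right, inner_gradient]
  simp
  field_simp

/-- `slope` serves as a substitute for `μ` that is smooth on all of phase space and has the same
sign over the boundary. -/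
theorem slope_eq {p : Phase} (hp : p.1 ∈ D.bd) :
    D.slope p = D.c p.1 * ‖gradient D.ρ p.1‖ * D.mu p := by
  have h := D.gradient_ne_zero hp
  rw [D.mu_eq hp, slope, unitVec, map_smul, smul_eq_mul]
  field_simp

theorem slope_pos_iff {p : Phase} (hp : p.1 ∈ D.bd) : 0 < D.slope p ↔ 0 < D.mu p := by
  have hc := D.c_pos_of_mem (D.bd_subset hp)
  have h := D.gradient_ne_zero hp
  rw [D.slope_eq hp, mul_pos_iff_of_pos_left (by positivity)]

theorem slope_neg_iff {p : Phase} (hp : p.1 ∈ D.bd) : D.slope p < 0 ↔ D.mu p < 0 := by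
  have hc := D.c_pos_of_mem (D.bd_subset hp)
  have h := D.gradient_ne_zero hp
  have h2 : 0 < D.c p.1 * ‖gradient D.ρ p.1‖ := by positivity
  rw [D.slope_eq hp]
  exact ⟨fun h => by by_contra hn; push Not at hn; nlinarith [mul_nonneg h2.le hn],
    fun h => mul_neg_of_pos_of_neg h2 h⟩

theorem mem_outflow_iff {p : Phase} : p ∈ D.outflow ↔ p.1 ∈ D.bd ∧ 0 < D.slope p :=
  and_congr_right fun h => (D.slope_pos_iff h).symm

theorem mem_inflow_iff {p : Phase} : p ∈ D.inflow ↔ p.1 ∈ D.bd ∧ D.slope p < 0 :=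
  and_congr_right fun h => (D.slope_neg_iff h).symm

/-- Zero slope means that the direction is tangent to `∂M`, and the Hessian of `ρ` is a positive
multiple of the second fundamental form. All uses of strict convexity go through this inequality. -/
theorem slopeDeriv_pos (hconv : D.StrictlyConvex) {p : Phase} (hp : p.1 ∈ D.bd)
    (h0 : D.slope p = 0) : 0 < D.slopeDeriv p := by
  have hc := D.c_pos_of_mem (D.bd_subset hp)
  have hg := D.gradient_ne_zero hp
  have hmu : D.mu p = 0 := by
    have := D.slope_eq hp
    rw [h0] at this
    have h2 : D.c p.1 * ‖gradient D.ρ p.1‖ ≠ 0 := by positivity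
    exact (mul_eq_zero.1 this.symm).resolve_left h2
  have hv : D.unitVec p ≠ 0 := by
    rw [unitVec, Ne, smul_eq_zero, not_or]
    refine ⟨hc.ne', fun h => ?_⟩
    have := norm_dir p.2
    rw [h] at this; simp at this
  have := hconv p.1 hp (D.unitVec p) hv hmu
  rw [secondFundForm, div_pos_iff_of_pos_right (by positivity)] at this
  rwa [D.slopeDeriv_eq_hess p]

theorem isClosed_M : IsClosed D.M := isClosed_le D.ρ_smooth.continuous continuous_const

theorem isCompact_M : IsCompact D.M := D.compact

theorem isClosed_bd : IsClosed D.bd := isClosed_eq D.ρ_smooth.continuous continuous_const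

theorem isCompact_bd : IsCompact D.bd := D.isCompact_M.of_isClosed_subset D.isClosed_bd D.bd_subset

end ConformalDomain

/-! ### Compactness modulo full turns, and the extended flow -/

/-- One full turn of the angle. -/
abbrev turn : Phase := (0, 2 * Real.pi)

/-- Angles are real numbers, so the phase space over a compact set is not compact. Compactness
arguments first translate into one period. -/
theorem exists_zsmul_turn (p : Phase) :
    ∃ n : ℤ, (p + n • turn).1 = p.1 ∧ (p + n • turn).2 ∈ Ico 0 (2 * Real.pi) := by
  obtain ⟨n, hn, -⟩ := existsUnique_add_zsmul_mem_Ico Real.two_pi_pos p.2 0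
  exact ⟨n, by simp, by simpa using hn⟩

theorem exists_norm_le_of_periodic {G : Type*} [NormedAddCommGroup G] {f : Phase → G}
    (hf : Continuous f) (hper : Function.Periodic f turn) {K : Set Plane} (hK : IsCompact K) :
    ∃ B : ℝ≥0, ∀ p : Phase, p.1 ∈ K → ‖f p‖ ≤ B := by
  obtain ⟨B, hB⟩ := (hK.prod (isCompact_Icc (a := (0 : ℝ)) (b := 2 * Real.pi))).exists_bound_of_continuousOn
    hf.continuousOn
  refine ⟨B.toNNReal, fun p hp => ?_⟩
  obtain ⟨n, h1, h2⟩ := exists_zsmul_turn p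
  rw [← hper.zsmul n p]
  refine (hB _ ⟨by rwa [h1], Ico_subset_Icc_self h2⟩).trans (Real.le_coe_toNNReal B)

theorem periodic_fderiv {G : Type*} [NormedAddCommGroup G] [NormedSpace ℝ G] {f : Phase → G}
    (hper : Function.Periodic f turn) : Function.Periodic (fderiv ℝ f) turn := fun p => by
  rw [← fderiv_comp_add_right]
  congr 1
  exact funext hper

/-- A smooth function that is periodic in the angle and whose support is compact in the base
variable is Lipschitz. -/
theorem exists_lipschitzWith_of_periodic {G : Type*} [NormedAddCommGroup G] [NormedSpace ℝ G]
    {f : Phase → G} (hf : ContDiff ℝ 1 f) (hper : Function.Periodic f turn) {K : Set Plane}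
    (hK : IsCompact K) (hsupp : ∀ p : Phase, p.1 ∉ K → f p = 0) : ∃ L, LipschitzWith L f := by
  obtain ⟨B, hB⟩ := exists_norm_le_of_periodic (hf.continuous_fderiv (by simp))
    (periodic_fderiv hper) hK
  refine ⟨B, lipschitzWith_of_nnnorm_fderiv_le (𝕜 := ℝ) (hf.differentiable (by simp)) fun p => ?_⟩
  by_cases hp : p.1 ∈ K
  · exact hB p hp
  · have : f =ᶠ[𝓝 p] fun _ => 0 := by
      have : ∀ᶠ y : Phase in 𝓝 p, y.1 ∉ K :=
        (hK.isClosed.isOpen_compl.preimage continuous_fst).mem_nhds hp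
      filter_upwards [this] with y hy using hsupp y hy
    rw [this.fderiv_eq]; simp

namespace ConformalDomain

variable {D : ConformalDomain}

theorem periodic_field : Function.Periodic D.field turn := D.field_add_two_pi

theorem periodic_slope : Function.Periodic D.slope turn := D.slope_add_two_pi

theorem periodic_slopeDeriv : Function.Periodic D.slopeDeriv turn := D.slopeDeriv_add_two_pi

/-- Near the boundary, the defining function is strictly convex along geodesics that are almost
tangent to its level sets. -/
theorem exists_collar (hconv : D.StrictlyConvex) : ∃ ε κ : ℝ, 0 < ε ∧ 0 < κ ∧ ∀ p : Phase,
    p.1 ∈ Metric.cthickening ε D.M → -ε ≤ D.ρ p.1 → |D.slope p| ≤ ε → κ ≤ D.slopeDeriv p := by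
  by_contra! hcon
  have hpos : ∀ n : ℕ, (0 : ℝ) < 1 / (n + 1) := fun n => by positivity
  choose p hp1 hp2 hp3 hp4 using fun n : ℕ => hcon _ _ (hpos n) (hpos n)
  choose m hm1 hm2 using fun n => exists_zsmul_turn (p n)
  set p' : ℕ → Phase := fun n => p n + m n • turn with hp'
  have hs : ∀ n, D.slope (p' n) = D.slope (p n) := fun n => periodic_slope.zsmul (m n) (p n)
  have hsd : ∀ n, D.slopeDeriv (p' n) = D.slopeDeriv (p n) :=
    fun n => periodic_slopeDeriv.zsmul (m n) (p n)
  have hK : IsCompact (Metric.cthickening 1 D.M ×ˢ Icc 0 (2 * Real.pi)) :=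
    (D.isCompact_M.cthickening).prod isCompact_Icc
  have hmem : ∀ n, p' n ∈ Metric.cthickening 1 D.M ×ˢ Icc 0 (2 * Real.pi) := fun n => by
    refine ⟨?_, Ico_subset_Icc_self (hm2 n)⟩
    rw [hm1 n]
    refine Metric.cthickening_mono ?_ _ (hp1 n)
    rw [div_le_one (by positivity)]; linarith [(Nat.cast_nonneg n : (0 : ℝ) ≤ n)]
  obtain ⟨q, -, φ, hφ, hlim⟩ := hK.tendsto_subseq hmem
  have h0 : Tendsto (fun n => (1 : ℝ) / ((φ n : ℕ) + 1)) atTop (𝓝 0) :=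
    tendsto_one_div_add_atTop_nhds_zero_nat.comp hφ.tendsto_atTop
  have hlim1 : Tendsto (fun n => (p' (φ n)).1) atTop (𝓝 q.1) :=
    (continuous_fst.tendsto q).comp hlim
  have hqM : q.1 ∈ D.M := by
    by_cases hne : D.M.Nonempty
    · rw [← D.isClosed_M.closure_eq, Metric.mem_closure_iff_infDist_zero hne]
      refine le_antisymm (le_of_tendsto_of_tendsto
        (((Metric.continuous_infDist_pt D.M).tendsto q.1).comp hlim1) h0 (Eventually.of_forall
          fun n => ?_)) Metric.infDist_nonneg
      simp only [Function.comp_apply, hm1, hp']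
      exact ENNReal.toReal_le_of_le_ofReal (hpos _).le (Metric.mem_cthickening_iff.1 (hp1 (φ n)))
    · rw [not_nonempty_iff_eq_empty] at hne
      have := hp1 0
      simp [hne] at this
  have hρ : 0 ≤ D.ρ q.1 := by
    refine le_of_tendsto_of_tendsto (f := fun n => -((1 : ℝ) / ((φ n : ℕ) + 1)))
      (by simpa using h0.neg) ((D.ρ_smooth.continuous.tendsto q.1).comp hlim1)
      (Eventually.of_forall fun n => ?_)
    simp only [Function.comp_apply, hm1, hp']
    exact hp2 (φ n)
  have hsl : D.slope q = 0 := by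
    have := le_of_tendsto_of_tendsto
      (((D.contDiff_slope.continuous.tendsto q).comp hlim).abs) h0
      (Eventually.of_forall fun n => by
        simp only [Function.comp_apply, hs]; exact hp3 (φ n))
    exact abs_nonpos_iff.1 this
  have hsd' : D.slopeDeriv q ≤ 0 :=
    le_of_tendsto_of_tendsto ((D.contDiff_slopeDeriv.continuous.tendsto q).comp hlim) h0
      (Eventually.of_forall fun n => by
        simp only [Function.comp_apply, hsd]; exact (hp4 (φ n)).le)
  -- The limit of the counterexamples is a tangential boundary point at which the second derivative
  -- of `ρ` is not positive.
  exact absurd (D.slopeDeriv_pos hconv (le_antisymm hqM hρ) hsl) (not_lt.2 hsd')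

variable (D) in
/-- A complete flow on phase space that coincides with the geodesic flow over `M` and is such that
orbits that have left `M` do not come back. -/
structure FlowExtension where
  /-- the factor by which the geodesic vector field is multiplied -/
  χ : Plane → ℝ
  /-- the flow -/
  Φ : ℝ → Phase → Phase
  /-- the Lipschitz constant of the vector field -/
  K : ℝ≥0
  /-- a bound for the vector field -/
  B : ℝ≥0
  /-- the width of the collar -/
  ε : ℝ
  χ_nonneg : ∀ x, 0 ≤ χ x
  χ_eq_one : ∀ x ∈ D.M, χ x = 1
  isFlow : IsFlow (fun p => χ p.1 • D.field p) Φ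
  lipschitz : LipschitzWith K fun p : Phase => χ p.1 • D.field p
  bound : ∀ p : Phase, ‖χ p.1 • D.field p‖ ≤ B
  ε_pos : 0 < ε
  convex : ∀ p : Phase, -ε ≤ D.ρ p.1 → |D.slope p| ≤ ε → 0 ≤ χ p.1 * D.slopeDeriv p

/-- The factor `χ` is one on `M` and vanishes off the collar in which `ρ` is convex along nearly
tangential geodesics. Being nonnegative, it only slows geodesics down, so the signs of the
derivatives of `ρ` survive. Periodicity and compact support in the base make the field bounded and
Lipschitz. -/
theorem nonempty_flowExtension (hconv : D.StrictlyConvex) : Nonempty D.FlowExtension := by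
  obtain ⟨ε, κ, hε, hκ, hcol⟩ := exists_collar hconv
  obtain ⟨χ, h0, h1, h01⟩ := exists_contMDiffMap_zero_one_of_isClosed (n := (⊤ : ℕ∞))
    (modelWithCornersSelf ℝ Plane)
    (Metric.isOpen_thickening (δ := ε) (E := D.M)).isClosed_compl D.isClosed_M
    (disjoint_compl_left_iff_subset.2 (Metric.self_subset_thickening hε D.M))
  have hχ : ContDiff ℝ ∞ χ := χ.contMDiff.contDiff
  have hK : IsCompact (Metric.cthickening ε D.M) := D.isCompact_M.cthickening
  have hχ0 : ∀ x, x ∉ Metric.cthickening ε D.M → χ x = 0 := fun x hx =>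
    h0 fun h => hx (Metric.thickening_subset_cthickening _ _ h)
  have hF : ContDiff ℝ ∞ fun p : Phase => χ p.1 • D.field p :=
    (hχ.comp contDiff_fst).smul D.contDiff_field
  have hper : Function.Periodic (fun p : Phase => χ p.1 • D.field p) turn := fun p => by
    simp only [periodic_field p]; simp
  have hsupp : ∀ p : Phase, p.1 ∉ Metric.cthickening ε D.M → χ p.1 • D.field p = 0 :=
    fun p hp => by rw [hχ0 _ hp, zero_smul]
  obtain ⟨K, hL⟩ := exists_lipschitzWith_of_periodic (hF.of_le (by simp)) hper hK hsupp
  obtain ⟨B, hB⟩ := exists_norm_le_of_periodic hF.continuous hper hK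
  have hB' : ∀ p : Phase, ‖χ p.1 • D.field p‖ ≤ B := fun p => by
    by_cases hp : p.1 ∈ Metric.cthickening ε D.M
    · exact hB p hp
    · rw [hsupp p hp, norm_zero]; exact B.2
  obtain ⟨Φ, hΦ⟩ := exists_isFlow hL hB'
  refine ⟨⟨χ, Φ, K, B, ε, fun x => (h01 x).1, fun x hx => h1 hx, hΦ, hL, hB', hε,
    fun p hp1 hp2 => ?_⟩⟩
  by_cases hp : p.1 ∈ Metric.cthickening ε D.M
  · exact mul_nonneg (h01 _).1 (hκ.le.trans (hcol p hp hp1 hp2))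
  · rw [hχ0 _ hp, zero_mul]

namespace FlowExtension

variable (X : D.FlowExtension)

theorem Φ_zero (p : Phase) : X.Φ 0 p = p := X.isFlow.zero p

theorem continuous_Φ_time (p : Phase) : Continuous fun t => X.Φ t p := X.isFlow.continuous_time p

theorem Φ_add_turn (t : ℝ) (p : Phase) : X.Φ t (p + turn) = X.Φ t p + turn := by
  have := X.isFlow.map_eq X.lipschitz X.isFlow (ContinuousLinearMap.id ℝ Phase) turn
    (fun p => by simp [periodic_field p]) t p
  simpa using this.symm

theorem Φ_neg_add_pi (t : ℝ) (p : Phase) :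
    X.Φ (-t) p + (0, Real.pi) = X.Φ t (p + (0, Real.pi)) := by
  have := X.isFlow.map_eq X.lipschitz X.isFlow.neg (ContinuousLinearMap.id ℝ Phase) (0, Real.pi)
    (fun p => by simp [D.field_add_pi p]) t p
  simpa using this

theorem hasDerivAt_ρ (p : Phase) (t : ℝ) : HasDerivAt (fun t => D.ρ (X.Φ t p).1)
    (X.χ (X.Φ t p).1 * D.slope (X.Φ t p)) t := by
  have h1 : HasDerivAt (fun t => (X.Φ t p).1) (X.χ (X.Φ t p).1 • D.unitVec (X.Φ t p)) t :=
    (ContinuousLinearMap.fst ℝ Plane ℝ).hasFDerivAt.comp_hasDerivAt t (X.isFlow.hasDerivAt p t)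
  have h2 := ((D.ρ_smooth.differentiable (by simp)) (X.Φ t p).1).hasFDerivAt.comp_hasDerivAt t h1
  simpa [slope, Function.comp_def] using h2

theorem hasDerivAt_slope (p : Phase) (t : ℝ) : HasDerivAt (fun t => D.slope (X.Φ t p))
    (X.χ (X.Φ t p).1 * D.slopeDeriv (X.Φ t p)) t := by
  have h2 := ((D.contDiff_slope.differentiable (by simp)) (X.Φ t p)).hasFDerivAt.comp_hasDerivAt t
    (X.isFlow.hasDerivAt p t)
  simpa [slopeDeriv, Function.comp_def] using h2

theorem continuous_ρ (p : Phase) : Continuous fun t => D.ρ (X.Φ t p).1 :=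
  D.ρ_smooth.continuous.comp (continuous_fst.comp (X.continuous_Φ_time p))

theorem continuous_slope (p : Phase) : Continuous fun t => D.slope (X.Φ t p) :=
  D.contDiff_slope.continuous.comp (X.continuous_Φ_time p)

theorem ρ_monotoneOn {p : Phase} {a b : ℝ} (h : ∀ t ∈ Icc a b, 0 ≤ D.slope (X.Φ t p)) :
    MonotoneOn (fun t => D.ρ (X.Φ t p).1) (Icc a b) :=
  monotoneOn_of_deriv_nonneg (convex_Icc a b) (X.continuous_ρ p).continuousOn
    (fun t _ => (X.hasDerivAt_ρ p t).differentiableAt.differentiableWithinAt) fun t ht => by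
      rw [(X.hasDerivAt_ρ p t).deriv]
      exact mul_nonneg (X.χ_nonneg _) (h t (interior_subset ht))

/-- Orbits that leave `M`, or touch the boundary from outside, stay outside. -/
theorem ρ_nonneg_of_slope_nonneg {p : Phase} (hρ : 0 ≤ D.ρ p.1) (hs : 0 ≤ D.slope p) {t : ℝ}
    (ht : 0 ≤ t) : 0 ≤ D.ρ (X.Φ t p).1 := by
  -- Continuous induction: the closed set of times at which both `ρ` and `slope` are nonnegative can
  -- always be prolonged to the right.
  set S : Set ℝ := {t | 0 ≤ D.ρ (X.Φ t p).1 ∧ 0 ≤ D.slope (X.Φ t p)} with hS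
  have hclosed : IsClosed S := (isClosed_le continuous_const (X.continuous_ρ p)).inter
    (isClosed_le continuous_const (X.continuous_slope p))
  have h0 : (0 : ℝ) ∈ S := by simpa [hS, X.Φ_zero] using ⟨hρ, hs⟩
  have hsub : Icc 0 t ⊆ S := by
    refine (hclosed.inter isClosed_Icc).Icc_subset_of_forall_exists_gt h0 ?_
    rintro x ⟨⟨hx1, hx2⟩, -⟩ y (hy : x < y)
    suffices h : ∃ z, x < z ∧ ∀ s ∈ Icc x z, 0 ≤ D.slope (X.Φ s p) by
      obtain ⟨z, hz, hzs⟩ := h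
      have hxm : x < min y z := lt_min hy hz
      refine ⟨min y z, ⟨?_, hzs _ ⟨hxm.le, min_le_right _ _⟩⟩, hxm, min_le_left _ _⟩
      exact hx1.trans (X.ρ_monotoneOn hzs (left_mem_Icc.2 hz.le) ⟨hxm.le, min_le_right _ _⟩ hxm.le)
    rcases hx2.eq_or_lt with h | h
    -- At zero slope the orbit is in the region covered by `convex`, so the slope does not decrease
    -- for a short time.
    · have hev : ∀ᶠ s in 𝓝 x, -X.ε < D.ρ (X.Φ s p).1 ∧ |D.slope (X.Φ s p)| < X.ε := by
        refine ((X.continuous_ρ p).tendsto x).eventually (lt_mem_nhds (by linarith [X.ε_pos])) |>.and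
          (((X.continuous_slope p).abs.tendsto x).eventually (gt_mem_nhds ?_))
        rw [← h, abs_zero]; exact X.ε_pos
      obtain ⟨r, hr, hball⟩ := Metric.eventually_nhds_iff.1 hev
      refine ⟨x + r / 2, by linarith, fun s hs => ?_⟩
      have hmono : MonotoneOn (fun t => D.slope (X.Φ t p)) (Icc x (x + r / 2)) := by
        refine monotoneOn_of_deriv_nonneg (convex_Icc _ _) (X.continuous_slope p).continuousOn
          (fun t _ => (X.hasDerivAt_slope p t).differentiableAt.differentiableWithinAt)
          fun t ht => ?_
        rw [(X.hasDerivAt_slope p t).deriv]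
        have ht' := interior_subset ht
        have := hball (y := t) (by
          rw [Real.dist_eq, abs_of_nonneg (by linarith [ht'.1])]; linarith [ht'.2])
        exact X.convex _ this.1.le this.2.le
      rw [h]
      exact hmono (left_mem_Icc.2 (by linarith)) hs hs.1
    · have hev : ∀ᶠ s in 𝓝 x, 0 < D.slope (X.Φ s p) :=
        ((X.continuous_slope p).tendsto x).eventually (lt_mem_nhds h)
      obtain ⟨r, hr, hball⟩ := Metric.eventually_nhds_iff.1 hev
      refine ⟨x + r / 2, by linarith, fun s hs => (hball ?_).le⟩
      rw [Real.dist_eq, abs_of_nonneg (by linarith [hs.1])]; linarith [hs.2]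
  exact (hsub (right_mem_Icc.2 ht)).1

/-- The time reversal of `ρ_nonneg_of_slope_nonneg`. It is the reason why flow integrals of
functions supported inside `M` vanish at incoming and tangential boundary points. -/
theorem ρ_nonneg_of_slope_nonpos {p : Phase} (hρ : 0 ≤ D.ρ p.1) (hs : D.slope p ≤ 0) {t : ℝ}
    (ht : 0 ≤ t) : 0 ≤ D.ρ (X.Φ (-t) p).1 := by
  have := X.ρ_nonneg_of_slope_nonneg (p := p + (0, Real.pi)) (by simpa using hρ)
    (by rw [D.slope_add_pi]; linarith) ht
  rw [← X.Φ_neg_add_pi] at this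
  simpa using this

theorem isOrbit_Φ {p : Phase} {t : ℝ} (h : ∀ s ∈ Icc 0 t, (X.Φ s p).1 ∈ D.M) :
    D.IsOrbit p t fun s => X.Φ s p := by
  refine ⟨X.Φ_zero p, fun s hs => ⟨?_, h s hs⟩⟩
  have := (X.isFlow.hasDerivAt p s).hasDerivWithinAt (s := Icc 0 t)
  rwa [X.χ_eq_one _ (h s hs), one_smul] at this

/-- An orbit that stays in `M` only sees `χ = 1`, so uniqueness for the extended field applies, and
exit times can be computed with `Φ`. -/
theorem eqOn_of_isOrbit {p : Phase} {t : ℝ} {γ : ℝ → Phase} (h : D.IsOrbit p t γ) :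
    EqOn γ (fun s => X.Φ s p) (Icc 0 t) := by
  have hd : ∀ s ∈ Icc 0 t,
      HasDerivWithinAt γ (X.χ (γ s).1 • D.field (γ s)) (Icc 0 t) s := fun s hs => by
    rw [X.χ_eq_one _ (h.2 s hs).2, one_smul]; exact (h.2 s hs).1
  refine ODE_solution_unique (v := fun _ p => X.χ p.1 • D.field p) (K := X.K)
    (fun _ => X.lipschitz) (fun s hs => (hd s hs).continuousWithinAt) (fun s hs => ?_)
    (X.continuous_Φ_time p).continuousOn
    (fun s _ => (X.isFlow.hasDerivAt p s).hasDerivWithinAt) (by rw [h.1, X.Φ_zero])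
  exact (hd s (Ico_subset_Icc_self hs)).mono_of_mem_nhdsWithin (Icc_mem_nhdsGE_of_mem hs)

theorem le_exitTime {p : Phase} {t : ℝ} (ht : 0 ≤ t) (h : ∀ s ∈ Icc 0 t, (X.Φ s p).1 ∈ D.M) :
    ENNReal.ofReal t ≤ D.exitTime p :=
  le_iSup (fun t : {t : ℝ≥0 // ∃ γ, D.IsOrbit p t γ} => ((t : ℝ≥0) : ℝ≥0∞))
    ⟨t.toNNReal, _, X.isOrbit_Φ (p := p) (t := t.toNNReal) (by rwa [Real.coe_toNNReal t ht])⟩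

theorem mem_M_of_lt_exitTime {p : Phase} {t : ℝ} (h : ENNReal.ofReal t < D.exitTime p) :
    ∀ s ∈ Icc 0 t, (X.Φ s p).1 ∈ D.M := by
  intro s hs
  obtain ⟨⟨t', γ, hγ⟩, ht'⟩ := lt_iSup_iff.1 h
  have hst : s ∈ Icc 0 (t' : ℝ) := by
    refine ⟨hs.1, hs.2.trans ?_⟩
    have : ENNReal.ofReal t < ENNReal.ofReal t' := by simpa using ht'
    exact (ENNReal.ofReal_lt_ofReal_iff'.1 this).1.le
  have h1 : γ s = X.Φ s p := X.eqOn_of_isOrbit hγ hst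
  exact h1 ▸ (hγ.2 s hst).2

end FlowExtension

end ConformalDomain

/-! ### Exit times and the convexity constant -/

namespace ConformalDomain

variable {D : ConformalDomain}

namespace FlowExtension

variable (X : D.FlowExtension)

/-- The orbit through a boundary point of `M` stays in `M` for some time, unless it is outgoing. -/
theorem exists_forall_mem_M {p : Phase} (t : ℝ) (hM : (X.Φ t p).1 ∈ D.M)
    (h : D.ρ (X.Φ t p).1 < 0 ∨ D.slope (X.Φ t p) < 0) :
    ∃ z, t < z ∧ ∀ s ∈ Icc t z, (X.Φ s p).1 ∈ D.M := by
  rcases h with h | h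
  · have hev : ∀ᶠ s in 𝓝 t, D.ρ (X.Φ s p).1 < 0 :=
      ((X.continuous_ρ p).tendsto t).eventually (gt_mem_nhds h)
    obtain ⟨r, hr, hball⟩ := Metric.eventually_nhds_iff.1 hev
    refine ⟨t + r / 2, by linarith, fun s hs => (hball ?_).le⟩
    rw [Real.dist_eq, abs_of_nonneg (by linarith [hs.1])]; linarith [hs.2]
  · have hev : ∀ᶠ s in 𝓝 t, D.slope (X.Φ s p) < 0 :=
      ((X.continuous_slope p).tendsto t).eventually (gt_mem_nhds h)
    obtain ⟨r, hr, hball⟩ := Metric.eventually_nhds_iff.1 hev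
    have hanti : AntitoneOn (fun t => D.ρ (X.Φ t p).1) (Icc t (t + r / 2)) := by
      refine antitoneOn_of_deriv_nonpos (convex_Icc _ _) (X.continuous_ρ p).continuousOn
        (fun t _ => (X.hasDerivAt_ρ p t).differentiableAt.differentiableWithinAt) fun s hs => ?_
      rw [(X.hasDerivAt_ρ p s).deriv]
      have hs := interior_subset hs
      refine mul_nonpos_of_nonneg_of_nonpos (X.χ_nonneg _) (hball ?_).le
      rw [Real.dist_eq, abs_of_nonneg (by linarith [hs.1])]; linarith [hs.2]
    exact ⟨t + r / 2, by linarith, fun s hs =>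
      (hanti (left_mem_Icc.2 (by linarith)) hs hs.1).trans hM⟩

/-- A geodesic entering at `p` stays in the interior until it leaves: an interior tangency to the
boundary is impossible in a strictly convex region. As `M` is closed, the supremum defining the exit
time is attained. -/
theorem exit_properties (hconv : D.StrictlyConvex) {p : Phase} (hp : p ∈ D.inflow)
    (hfin : D.exitTime p ≠ ⊤) : ∃ T : ℝ, 0 < T ∧ ENNReal.ofReal T = D.exitTime p ∧
      (∀ s ∈ Icc 0 T, (X.Φ s p).1 ∈ D.M) ∧ (∀ s ∈ Ioo 0 T, D.ρ (X.Φ s p).1 < 0) ∧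
      (X.Φ T p).1 ∈ D.bd ∧ 0 ≤ D.slope (X.Φ T p) := by
  rw [mem_inflow_iff] at hp
  set T := (D.exitTime p).toReal with hT
  have hT' : ENNReal.ofReal T = D.exitTime p := ENNReal.ofReal_toReal hfin
  have hT0 : 0 ≤ T := ENNReal.toReal_nonneg
  have hIco : ∀ s ∈ Ico 0 T, (X.Φ s p).1 ∈ D.M := fun s hs =>
    X.mem_M_of_lt_exitTime (t := s) (by
      rw [← hT']; exact (ENNReal.ofReal_lt_ofReal_iff (hs.1.trans_lt hs.2)).2 hs.2) s ⟨hs.1, le_rfl⟩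
  have hM : ∀ s ∈ Icc 0 T, (X.Φ s p).1 ∈ D.M := by
    intro s hs
    rcases hT0.eq_or_lt with h | h
    · have : s = 0 := le_antisymm (hs.2.trans h.ge) hs.1
      rw [this, X.Φ_zero]; exact D.bd_subset hp.1
    · have hcl : IsClosed {s | (X.Φ s p).1 ∈ D.M} :=
        D.isClosed_M.preimage (continuous_fst.comp (X.continuous_Φ_time p))
      have := closure_minimal (s := Ico 0 T) hIco hcl
      rw [closure_Ico h.ne] at this
      exact this hs
  -- Otherwise the orbit could be continued inside `M` beyond the supremum.
  have hend : ¬ (D.ρ (X.Φ T p).1 < 0 ∨ D.slope (X.Φ T p) < 0) := by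
    intro h
    obtain ⟨z, hz, hzM⟩ := X.exists_forall_mem_M T (hM T ⟨hT0, le_rfl⟩) h
    have := X.le_exitTime (p := p) (hT0.trans hz.le) fun s hs => by
      rcases le_total s T with h | h
      exacts [hM s ⟨hs.1, h⟩, hzM s ⟨h, hs.2⟩]
    rw [← hT', ENNReal.ofReal_le_ofReal_iff hT0] at this
    linarith
  push Not at hend
  refine ⟨T, hT0.lt_of_ne fun h => ?_, hT', hM, fun s hs => ?_,
    le_antisymm (hM T ⟨hT0, le_rfl⟩) hend.1, hend.2⟩
  · have := hend.2
    rw [← h, X.Φ_zero] at this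
    linarith [hp.2]
  -- If the orbit touched the boundary at an intermediate time, `ρ` would have a local maximum with
  -- zero slope there. But its second derivative is positive, so `ρ` would become positive just
  -- afterwards.
  · refine lt_of_le_of_ne (hM s (Ioo_subset_Icc_self hs)) fun h0 => ?_
    have hmax : IsLocalMax (fun t => D.ρ (X.Φ t p).1) s := by
      filter_upwards [Ioo_mem_nhds hs.1 hs.2] with t ht
      rw [h0]; exact hM t (Ioo_subset_Icc_self ht)
    have hsl : D.slope (X.Φ s p) = 0 := by
      have := hmax.hasDerivAt_eq_zero (X.hasDerivAt_ρ p s)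
      rwa [X.χ_eq_one _ (hM s (Ioo_subset_Icc_self hs)), one_mul] at this
    have hpos := D.slopeDeriv_pos hconv (p := X.Φ s p) h0 hsl
    have hev : ∀ᶠ t in 𝓝[>] s, 0 < D.slope (X.Φ t p) := by
      have hd := X.hasDerivAt_slope p s
      rw [X.χ_eq_one _ (hM s (Ioo_subset_Icc_self hs)), one_mul] at hd
      filter_upwards [hd.tendsto_slope.mono_left (nhdsGT_le_nhdsNE s)
        |>.eventually (lt_mem_nhds hpos), self_mem_nhdsWithin] with t ht (hst : s < t)
      rw [slope_def_field, hsl, sub_zero] at ht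
      exact (div_pos_iff_of_pos_right (by linarith)).1 ht
    obtain ⟨z, hz, hzs⟩ := (mem_nhdsGT_iff_exists_Ioc_subset).1
      (hev.and (Ioo_mem_nhdsGT hs.2))
    have hstrict : StrictMonoOn (fun t => D.ρ (X.Φ t p).1) (Icc s z) := by
      refine strictMonoOn_of_deriv_pos (convex_Icc _ _) (X.continuous_ρ p).continuousOn
        fun t ht => ?_
      rw [interior_Icc] at ht
      have := hzs (Ioo_subset_Ioc_self ht)
      rw [(X.hasDerivAt_ρ p t).deriv, X.χ_eq_one _ (hM t ⟨(hs.1.trans ht.1).le, this.2.2.le⟩),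
        one_mul]
      exact this.1
    have h1 := hstrict (left_mem_Icc.2 (le_of_lt hz)) (right_mem_Icc.2 (le_of_lt hz)) hz
    have h2 := hzs (right_mem_Ioc.2 hz)
    have h3 : D.ρ (X.Φ z p).1 ≤ 0 := hM z ⟨(hs.1.trans h2.2.1).le, h2.2.2.le⟩
    simp only [h0] at h1
    linarith

theorem mu_add_pi (p : Phase) : D.mu (p + (0, Real.pi)) = -D.mu p := by
  rw [mu, unitVec_add_pi, mu, g, g, inner_neg_right, mul_neg]; simp

/-- The past of an outgoing boundary point up to the entry into `M`. -/
theorem entry_properties (hconv : D.StrictlyConvex) {C₀ : ℝ} (hC : D.IsConvexityConstant C₀)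
    {p : Phase} (hp : p ∈ D.outflow) : ∃ T : ℝ, 0 < T ∧ T ≤ C₀ * D.mu p ∧
      (∀ s ∈ Icc 0 T, (X.Φ (-s) p).1 ∈ D.M) ∧ (∀ s ∈ Ioo 0 T, D.ρ (X.Φ (-s) p).1 < 0) ∧
      (X.Φ (-T) p).1 ∈ D.bd ∧ D.slope (X.Φ (-T) p) ≤ 0 := by
  have hp' : p + (0, Real.pi) ∈ D.inflow := by
    refine ⟨by simpa using hp.1, ?_⟩
    rw [mu_add_pi]; linarith [hp.2]
  have hle := hC _ hp'
  rw [mu_add_pi, abs_neg, abs_of_pos hp.2] at hle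
  obtain ⟨T, hT, hT', h1, h2, h3, h4⟩ := X.exit_properties hconv hp'
    (hle.trans_lt ENNReal.ofReal_lt_top).ne
  rw [← hT'] at hle
  have hfst : ∀ s, (X.Φ s (p + (0, Real.pi))).1 = (X.Φ (-s) p).1 := fun s => by
    rw [← X.Φ_neg_add_pi]; simp
  simp only [hfst] at h1 h2 h3
  rw [← X.Φ_neg_add_pi, D.slope_add_pi] at h4
  refine ⟨T, hT, ?_, h1, h2, h3, by linarith⟩
  rcases ENNReal.ofReal_le_ofReal_iff'.1 hle with h | h
  · exact h
  · linarith

theorem periodic_Φ_fst (t : ℝ) : Function.Periodic (fun p => (X.Φ t p).1) turn := fun p => by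
  simp [X.Φ_add_turn]

/-- If exit times were unbounded, points with longer and longer orbits would accumulate, modulo full
turns, at a point whose orbit never leaves `M`: a trapped geodesic. -/
theorem exists_exitTime_le (X : D.FlowExtension) (hnt : D.NonTrapping) :
    ∃ T : ℝ, ∀ p : Phase, p.1 ∈ D.M → D.exitTime p ≤ ENNReal.ofReal T := by
  by_contra! hcon
  choose p hpM hp using fun n : ℕ => hcon n
  choose m hm1 hm2 using fun n => exists_zsmul_turn (p n)
  have hmem : ∀ n, p n + m n • turn ∈ D.M ×ˢ Icc 0 (2 * Real.pi) := fun n =>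
    ⟨by rw [hm1]; exact hpM n, Ico_subset_Icc_self (hm2 n)⟩
  obtain ⟨q, hq, φ, hφ, hlim⟩ := (D.isCompact_M.prod isCompact_Icc).tendsto_subseq hmem
  have hall : ∀ s : ℝ, 0 ≤ s → (X.Φ s q).1 ∈ D.M := by
    intro s hs
    have hc : Continuous fun p => (X.Φ s p).1 :=
      continuous_fst.comp (X.isFlow.lipschitzWith X.lipschitz s).continuous
    refine D.isClosed_M.mem_of_tendsto ((hc.tendsto q).comp hlim) ?_
    have h2 : Tendsto (fun n => ((φ n : ℕ) : ℝ)) atTop atTop :=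
      tendsto_natCast_atTop_atTop.comp hφ.tendsto_atTop
    filter_upwards [h2.eventually_ge_atTop s] with n hn
    simp only [Function.comp_apply]
    have hs' : (X.Φ s (p (φ n) + m (φ n) • turn)).1 = (X.Φ s (p (φ n))).1 :=
      (X.periodic_Φ_fst s).zsmul (m (φ n)) (p (φ n))
    rw [hs']
    exact X.mem_M_of_lt_exitTime (hp (φ n)) s ⟨hs, hn⟩
  refine (hnt q hq.1).ne (ENNReal.eq_top_of_forall_nnreal_le fun r => ?_)
  have := X.le_exitTime (p := q) r.2 fun s hs => hall s hs.1
  exact (ENNReal.ofReal_coe_nnreal (p := r)) ▸ this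

/-- Taylor's lower bound of second order, by integrating `κ ≤ slopeDeriv` twice along the orbit. -/
theorem le_ρ_of_le_slopeDeriv {p : Phase} {t κ : ℝ} (ht : 0 ≤ t)
    (hM : ∀ s ∈ Icc 0 t, (X.Φ s p).1 ∈ D.M) (hκ : ∀ s ∈ Icc 0 t, κ ≤ D.slopeDeriv (X.Φ s p)) :
    D.ρ p.1 + D.slope p * t + κ * t ^ 2 / 2 ≤ D.ρ (X.Φ t p).1 := by
  have h1 : MonotoneOn (fun s => D.slope (X.Φ s p) - κ * s) (Icc 0 t) := by
    have hd : ∀ s, HasDerivAt (fun s => D.slope (X.Φ s p) - κ * s)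
        (X.χ (X.Φ s p).1 * D.slopeDeriv (X.Φ s p) - κ) s := fun s => by
      simpa [Pi.sub_def] using (X.hasDerivAt_slope p s).sub ((hasDerivAt_id s).const_mul κ)
    refine monotoneOn_of_deriv_nonneg (convex_Icc _ _)
      (fun s _ => (hd s).continuousAt.continuousWithinAt)
      (fun s _ => (hd s).differentiableAt.differentiableWithinAt) fun s hs => ?_
    have hs := interior_subset hs
    rw [(hd s).deriv, X.χ_eq_one _ (hM s hs), one_mul, sub_nonneg]
    exact hκ s hs
  have h2 : MonotoneOn (fun s => D.ρ (X.Φ s p).1 - D.slope p * s - κ * s ^ 2 / 2) (Icc 0 t) := by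
    have hd : ∀ s, HasDerivAt (fun s => D.ρ (X.Φ s p).1 - D.slope p * s - κ * s ^ 2 / 2)
        (X.χ (X.Φ s p).1 * D.slope (X.Φ s p) - D.slope p - κ * s) s := fun s => by
      have h := ((X.hasDerivAt_ρ p s).sub ((hasDerivAt_id s).const_mul (D.slope p))).sub
        ((((hasDerivAt_id s).pow 2).const_mul κ).div_const 2)
      refine (h.congr_deriv ?_).congr_of_eventuallyEq (Eventually.of_forall fun x => ?_)
      · simp; ring
      · simp
    refine monotoneOn_of_deriv_nonneg (convex_Icc _ _)
      (fun s _ => (hd s).continuousAt.continuousWithinAt)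
      (fun s _ => (hd s).differentiableAt.differentiableWithinAt) fun s hs => ?_
    have hs := interior_subset hs
    rw [(hd s).deriv, X.χ_eq_one _ (hM s hs), one_mul]
    have := h1 (left_mem_Icc.2 ht) hs hs.1
    simp only [X.Φ_zero] at this
    linarith
  have := h2 (left_mem_Icc.2 ht) (right_mem_Icc.2 ht) ht
  simp only [X.Φ_zero] at this
  linarith

end FlowExtension

/-- For slopes bounded away from zero the uniform bound on exit times suffices. For small slopes, `0
≥ ρ ≥ slope * t + κ t² / 2` as long as the orbit stays in `M`, which forces `t ≤ 2 |slope| / κ`. -/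
theorem exists_convexityConstant (hconv : D.StrictlyConvex) (hnt : D.NonTrapping) :
    ∃ C₀ : ℝ, 0 < C₀ ∧ D.IsConvexityConstant C₀ := by
  obtain ⟨X⟩ := nonempty_flowExtension hconv
  obtain ⟨ε, κ, hε, hκ, hcol⟩ := exists_collar hconv
  obtain ⟨Tm, hTm⟩ := X.exists_exitTime_le hnt
  obtain ⟨A, hA⟩ := exists_norm_le_of_periodic D.contDiff_slope.continuous periodic_slope
    D.isCompact_M
  obtain ⟨A', hA'⟩ := exists_norm_le_of_periodic D.contDiff_slopeDeriv.continuous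
    periodic_slopeDeriv D.isCompact_M
  obtain ⟨m, hm⟩ : ∃ m : ℝ, ∀ x ∈ D.bd, D.c x * ‖gradient D.ρ x‖ ≤ m := by
    have hc : Continuous fun x => D.c x * ‖gradient D.ρ x‖ := by
      have h1 : Continuous (fderiv ℝ D.ρ) := D.ρ_smooth.continuous_fderiv (by simp)
      exact D.c_smooth.continuous.mul
        ((InnerProductSpace.toDual ℝ Plane).symm.continuous.comp h1).norm
    obtain ⟨m, hm⟩ := D.isCompact_bd.exists_bound_of_continuousOn hc.continuousOn
    exact ⟨m, fun x hx => (le_abs_self _).trans (hm x hx)⟩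
  -- Within time `t₀` both `ρ` and `slope` change by at most `ε / 2`, so a nearly tangential orbit
  -- stays in the convex collar.
  set t₀ : ℝ := ε / (2 * (A + A' + 1)) with ht₀
  have hA0 : (0 : ℝ) ≤ A := A.2
  have hA0' : (0 : ℝ) ≤ A' := A'.2
  have ht₀p : 0 < t₀ := by positivity
  have ht₀e : t₀ * (A + A' + 1) = ε / 2 := by rw [ht₀]; field_simp
  -- `ε / 2` leaves room for the variation of the slope. `κ * t₀ / 4` makes the resulting bound on
  -- `t = min T t₀` smaller than `t₀`, so that `t` is the exit time `T` itself.
  set η : ℝ := min (ε / 2) (κ * t₀ / 4) with hη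
  have hηp : 0 < η := lt_min (by positivity) (by positivity)
  set C : ℝ := max (2 / κ) (max Tm 0 / η) with hC
  have hCp : 0 < C := lt_of_lt_of_le (by positivity) (le_max_left _ _)
  have key : ∀ p ∈ D.inflow, D.exitTime p ≤ ENNReal.ofReal (C * |D.slope p|) := by
    intro p hp
    have hpM : p.1 ∈ D.M := D.bd_subset hp.1
    obtain ⟨T, hT, hT', hM, -, -, -⟩ := X.exit_properties hconv hp (hnt p hpM).ne
    rw [← hT']
    apply ENNReal.ofReal_le_ofReal
    rcases le_or_gt η |D.slope p| with hb | hb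
    · have h1 : T ≤ max Tm 0 := by
        have h2 := hTm p hpM
        rw [← hT'] at h2
        rcases ENNReal.ofReal_le_ofReal_iff'.1 h2 with h | h
        · exact h.trans (le_max_left _ _)
        · linarith
      calc T ≤ max Tm 0 := h1
        _ = max Tm 0 / η * η := by field_simp
        _ ≤ C * |D.slope p| := by
          gcongr
          exact le_max_right _ _
    · set t := min T t₀ with ht
      have htp : 0 < t := lt_min hT ht₀p
      have hρ0 : D.ρ p.1 = 0 := hp.1
      have hsub : ∀ s ∈ Icc 0 t, (X.Φ s p).1 ∈ D.M := fun s hs =>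
        hM s ⟨hs.1, hs.2.trans (min_le_left _ _)⟩
      have hconvx : ∀ s ∈ Icc 0 t, κ ≤ D.slopeDeriv (X.Φ s p) := by
        intro s hs
        have hst : s ≤ t₀ := hs.2.trans (min_le_right _ _)
        have h0s : (0 : ℝ) ∈ Icc 0 t := left_mem_Icc.2 htp.le
        have e1 : |D.ρ (X.Φ s p).1 - D.ρ (X.Φ 0 p).1| ≤ A * |s - 0| := by
          refine (convex_Icc 0 t).norm_image_sub_le_of_norm_hasDerivWithin_le
            (f := fun s => D.ρ (X.Φ s p).1)
            (fun x _ => (X.hasDerivAt_ρ p x).hasDerivWithinAt) (fun x hx => ?_) h0s hs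
          rw [X.χ_eq_one _ (hsub x hx), one_mul]
          exact hA _ (hsub x hx)
        have e2 : |D.slope (X.Φ s p) - D.slope (X.Φ 0 p)| ≤ A' * |s - 0| := by
          refine (convex_Icc 0 t).norm_image_sub_le_of_norm_hasDerivWithin_le
            (f := fun s => D.slope (X.Φ s p))
            (fun x _ => (X.hasDerivAt_slope p x).hasDerivWithinAt) (fun x hx => ?_) h0s hs
          rw [X.χ_eq_one _ (hsub x hx), one_mul]
          exact hA' _ (hsub x hx)
        rw [X.Φ_zero, sub_zero, abs_of_nonneg hs.1] at e1 e2
        rw [hρ0, sub_zero] at e1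
        have e3 : A * s ≤ A * t₀ := mul_le_mul_of_nonneg_left hst hA0
        have e4 : A' * s ≤ A' * t₀ := mul_le_mul_of_nonneg_left hst hA0'
        have e5 : A * t₀ + A' * t₀ ≤ ε / 2 := by nlinarith
        have e6 : 0 ≤ A * t₀ := by positivity
        have e7 : 0 ≤ A' * t₀ := by positivity
        refine hcol _ (Metric.self_subset_cthickening _ (hsub s hs)) ?_ ?_
        · linarith [(abs_le.1 e1).1]
        · have := abs_sub_abs_le_abs_sub (D.slope (X.Φ s p)) (D.slope p)
          linarith [min_le_left (ε / 2) (κ * t₀ / 4)]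
      have h1 := X.le_ρ_of_le_slopeDeriv htp.le hsub hconvx
      have h2 : D.ρ (X.Φ t p).1 ≤ 0 := hsub t (right_mem_Icc.2 htp.le)
      have h3 : -|D.slope p| ≤ D.slope p := neg_abs_le _
      have h4 : κ * t ≤ 2 * |D.slope p| := by
        by_contra! h
        have : 0 < t * (κ * t - 2 * |D.slope p|) := mul_pos htp (by linarith)
        nlinarith
      have h5 : t ≤ 2 / κ * |D.slope p| := by
        rw [div_mul_eq_mul_div, le_div_iff₀ hκ]; linarith
      have h6 : t < t₀ := by
        have := min_le_right (ε / 2) (κ * t₀ / 4)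
        by_contra! h
        nlinarith
      have h7 : t = T := by
        rcases min_choice T t₀ with h | h
        · exact h
        · rw [← ht] at h; linarith
      rw [← h7]
      exact h5.trans (mul_le_mul_of_nonneg_right (le_max_left _ _) (abs_nonneg _))
  -- The factor `m` converts `slope` into `μ`, since `slope = c ‖∇ρ‖ μ`; the maximum with `1` keeps
  -- the constant positive.
  refine ⟨C * max m 1, by positivity, fun p hp => (key p hp).trans (ENNReal.ofReal_le_ofReal ?_)⟩
  have hc := D.c_pos_of_mem (D.bd_subset hp.1)
  rw [D.slope_eq hp.1, abs_mul,
    abs_of_nonneg (by positivity : 0 ≤ D.c p.1 * ‖gradient D.ρ p.1‖), mul_assoc C]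
  exact mul_le_mul_of_nonneg_left (mul_le_mul_of_nonneg_right
    ((hm _ hp.1).trans (le_max_left _ _)) (abs_nonneg _)) hCp.le

end ConformalDomain

/-! ### Tubular coordinates at the boundary -/

theorem Plane.det_eq (A : Plane →L[ℝ] Plane) :
    A.det = A !₂[1, 0] 0 * A !₂[0, 1] 1 - A !₂[0, 1] 0 * A !₂[1, 0] 1 := by
  have h := LinearMap.det_toMatrix (EuclideanSpace.basisFun (Fin 2) ℝ).toBasis (A : Plane →ₗ[ℝ] Plane)
  have e0 : EuclideanSpace.single (0 : Fin 2) (1 : ℝ) = !₂[1, 0] := by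
    ext i; fin_cases i <;> simp
  have e1 : EuclideanSpace.single (1 : Fin 2) (1 : ℝ) = !₂[0, 1] := by
    ext i; fin_cases i <;> simp
  rw [ContinuousLinearMap.det, ← h, Matrix.det_fin_two]
  simp [LinearMap.toMatrix_apply, e0, e1]

/-- The coordinate functionals of the plane. -/
def Plane.coord (i : Fin 2) : Plane →L[ℝ] ℝ := EuclideanSpace.proj i

@[simp] theorem Plane.coord_apply (i : Fin 2) (v : Plane) : Plane.coord i v = v i := rfl

theorem Plane.norm_sq_eq (v : Plane) : ‖v‖ ^ 2 = v 0 ^ 2 + v 1 ^ 2 := by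
  rw [EuclideanSpace.norm_sq_eq]; simp [Fin.sum_univ_two]

/-- The area spanned by orthogonal vectors. -/
theorem Plane.abs_area_of_inner_eq_zero {v w : Plane} (h : inner ℝ v w = 0) :
    |v 0 * w 1 - w 0 * v 1| = ‖v‖ * ‖w‖ := by
  rw [Plane.inner_eq] at h
  rw [← abs_of_nonneg (by positivity : 0 ≤ ‖v‖ * ‖w‖), ← sq_eq_sq_iff_abs_eq_abs, mul_pow,
    Plane.norm_sq_eq, Plane.norm_sq_eq]
  linear_combination -(v 0 * w 0 + v 1 * w 1) * h

namespace ConformalDomain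

variable (D : ConformalDomain)

theorem contDiff_gradient : ContDiff ℝ ∞ (gradient D.ρ) :=
  (InnerProductSpace.toDual ℝ Plane).symm.contDiff.comp (D.ρ_smooth.fderiv_right (by simp))

/-- The gradient of the defining function along the boundary curve. -/
def conormal (s : ℝ) : Plane := gradient D.ρ (D.bdry s)

theorem contDiff_conormal : ContDiff ℝ ∞ D.conormal := D.contDiff_gradient.comp D.bdry_smooth

theorem bdry_mem (s : ℝ) : D.bdry s ∈ D.bd := by
  have : D.bdry s ∈ range D.bdry := mem_range_self s
  rwa [D.bdry_range] at this

theorem conormal_ne_zero (s : ℝ) : D.conormal s ≠ 0 := D.ρ_regular _ (D.bdry_mem s)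

theorem hasDerivAt_bdry (s : ℝ) : HasDerivAt D.bdry (deriv D.bdry s) s :=
  (D.bdry_smooth.differentiable (by simp) s).hasDerivAt

theorem inner_deriv_bdry_conormal (s : ℝ) : inner ℝ (deriv D.bdry s) (D.conormal s) = 0 := by
  rw [real_inner_comm, conormal, inner_gradient]
  have h1 := ((D.ρ_smooth.differentiable (by simp)) (D.bdry s)).hasFDerivAt.comp_hasDerivAt s
    (D.hasDerivAt_bdry s)
  have h2 : D.ρ ∘ D.bdry = fun _ => 0 := funext fun s => D.bdry_mem s
  rw [h2] at h1
  exact h1.unique (hasDerivAt_const s 0)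

/-- Tubular coordinates at the boundary, with the normal coordinate scaled by `ε`. -/
def tube (ε : ℝ) (y : Plane) : Plane := D.bdry (y 0) + (ε * y 1) • D.conormal (y 0)

/-- The derivative of `tube`. -/
def tubeDeriv (ε : ℝ) (y : Plane) : Plane →L[ℝ] Plane :=
  (Plane.coord 0).smulRight
      (deriv D.bdry (y 0) + (ε * y 1) • deriv D.conormal (y 0)) +
    (Plane.coord 1).smulRight (ε • D.conormal (y 0))

theorem contDiff_tube (ε : ℝ) : ContDiff ℝ ∞ (D.tube ε) := by
  have h0 : ContDiff ℝ ∞ fun y : Plane => y 0 := (Plane.coord 0).contDiff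
  have h1 : ContDiff ℝ ∞ fun y : Plane => y 1 := (Plane.coord 1).contDiff
  exact (D.bdry_smooth.comp h0).add ((contDiff_const.mul h1).smul (D.contDiff_conormal.comp h0))

theorem hasFDerivAt_tube (ε : ℝ) (y : Plane) : HasFDerivAt (D.tube ε) (D.tubeDeriv ε y) y := by
  have h0 : HasFDerivAt (fun y : Plane => y 0) (Plane.coord 0) y :=
    (Plane.coord 0).hasFDerivAt
  have h1 : HasFDerivAt (fun y : Plane => y 1) (Plane.coord 1) y :=
    (Plane.coord 1).hasFDerivAt
  have hc : HasDerivAt D.conormal (deriv D.conormal (y 0)) (y 0) :=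
    (D.contDiff_conormal.differentiable (by simp) _).hasDerivAt
  have hb' := (D.hasDerivAt_bdry (y 0)).hasFDerivAt.comp y h0
  have hc' := hc.hasFDerivAt.comp y h0
  have h := hb'.add ((h1.const_mul ε).smul hc')
  refine h.congr_fderiv ?_
  ext1 w
  simp [tubeDeriv]
  module

theorem det_tubeDeriv (ε : ℝ) (y : Plane) : (D.tubeDeriv ε y).det =
    ε * ((deriv D.bdry (y 0) + (ε * y 1) • deriv D.conormal (y 0)) 0 * D.conormal (y 0) 1 -
      D.conormal (y 0) 0 * (deriv D.bdry (y 0) + (ε * y 1) • deriv D.conormal (y 0)) 1) := by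
  rw [Plane.det_eq]
  simp [tubeDeriv]
  ring

theorem tube_eq (ε : ℝ) (y : Plane) : D.tube ε y = D.tube 1 !₂[y 0, ε * y 1] := by
  simp [tube]

theorem tube_apply_zero (s : ℝ) : D.tube 1 !₂[s, 0] = D.bdry s := by simp [tube]

theorem conormal_periodic : Function.Periodic D.conormal 1 := fun s => by
  rw [conormal, D.bdry_periodic, conormal]

theorem tube_add_int (n : ℤ) (y : Plane) : D.tube 1 !₂[y 0 + n, y 1] = D.tube 1 y := by
  have h1 := D.bdry_periodic.int_mul n (y 0)
  have h2 := D.conormal_periodic.int_mul n (y 0)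
  rw [mul_one] at h1 h2
  simp [tube, h1, h2]

/-- At the boundary the Jacobian is, up to sign, `‖bdry'‖ * ‖∇ρ‖`, because the gradient is
orthogonal to the curve; the inverse function theorem applies. -/
theorem tube_isLocalHomeomorph (s : ℝ) : ∃ e : OpenPartialHomeomorph Plane Plane,
    !₂[s, 0] ∈ e.source ∧ (e : Plane → Plane) = D.tube 1 := by
  have hstrict : HasStrictFDerivAt (D.tube 1) (D.tubeDeriv 1 !₂[s, 0]) !₂[s, 0] := by
    have := ((D.contDiff_tube 1).contDiffAt (x := !₂[s, 0])).hasStrictFDerivAt (by simp)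
    rwa [(D.hasFDerivAt_tube 1 _).fderiv] at this
  have hdet : (D.tubeDeriv 1 !₂[s, 0]).det ≠ 0 := by
    rw [det_tubeDeriv]
    have h := Plane.abs_area_of_inner_eq_zero (D.inner_deriv_bdry_conormal s)
    intro h0
    simp at h0
    rw [h0, abs_zero] at h
    have h1 : 0 < ‖deriv D.bdry s‖ := norm_pos_iff.2 (D.bdry_regular s)
    have h2 : 0 < ‖D.conormal s‖ := norm_pos_iff.2 (D.conormal_ne_zero s)
    have : 0 < ‖deriv D.bdry s‖ * ‖D.conormal s‖ := by positivity
    linarith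
  let A := ContinuousLinearMap.toContinuousLinearEquivOfDetNeZero _ hdet
  have hA : HasStrictFDerivAt (D.tube 1) (A : Plane →L[ℝ] Plane) !₂[s, 0] := by
    rwa [ContinuousLinearMap.coe_toContinuousLinearEquivOfDetNeZero]
  exact ⟨hA.toOpenPartialHomeomorph _, hA.mem_toOpenPartialHomeomorph_source,
    hA.toOpenPartialHomeomorph_coe⟩

theorem bdry_eq_iff {s s' : ℝ} (hs : s ∈ Icc (0 : ℝ) 1) (hs' : s' ∈ Icc (0 : ℝ) 1)
    (h : D.bdry s = D.bdry s') : s = s' ∨ (s = 0 ∧ s' = 1) ∨ (s = 1 ∧ s' = 0) := by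
  have h01 : D.bdry 1 = D.bdry 0 := by simpa using D.bdry_periodic 0
  rcases hs.2.eq_or_lt with h1 | h1 <;> rcases hs'.2.eq_or_lt with h1' | h1'
  · left; rw [h1, h1']
  · right; right
    rw [h1, h01] at h
    exact ⟨h1, (D.bdry_injOn ⟨le_rfl, one_pos⟩ ⟨hs'.1, h1'⟩ h).symm⟩
  · right; left
    rw [h1', h01] at h
    exact ⟨D.bdry_injOn ⟨hs.1, h1⟩ ⟨le_rfl, one_pos⟩ h, h1'⟩
  · left; exact D.bdry_injOn ⟨hs.1, h1⟩ ⟨hs'.1, h1'⟩ h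

/-- Pairs of distinct points with equal images in thinner and thinner strips accumulate at two
parameters of the same boundary point. Since the curve is simple these agree up to a period, against
local injectivity. -/
theorem exists_injOn_tube :
    ∃ r > 0, InjOn (D.tube 1) {y : Plane | y 0 ∈ Ioc (0 : ℝ) 1 ∧ |y 1| < r} := by
  by_contra! hcon
  have hpos : ∀ n : ℕ, (0 : ℝ) < 1 / (n + 1) := fun n => by positivity
  have h1 : ∀ n : ℕ, ∃ y z : Plane, y 0 ∈ Ioc (0 : ℝ) 1 ∧ |y 1| < 1 / (n + 1) ∧
      z 0 ∈ Ioc (0 : ℝ) 1 ∧ |z 1| < 1 / (n + 1) ∧ D.tube 1 y = D.tube 1 z ∧ y ≠ z := fun n => by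
    have h := hcon _ (hpos n)
    simp only [InjOn, not_forall] at h
    obtain ⟨y, hy, z, hz, h, hne⟩ := h
    exact ⟨y, z, hy.1, hy.2, hz.1, hz.2, h, hne⟩
  choose y z hy0 hy1 hz0 hz1 heq hne using h1
  obtain ⟨⟨s, s'⟩, ⟨hs, hs'⟩, φ, hφ, hlim⟩ :=
    ((isCompact_Icc (a := (0 : ℝ)) (b := 1)).prod (isCompact_Icc (a := (0 : ℝ)) (b := 1))).tendsto_subseq
      (x := fun n => (y n 0, z n 0)) fun n => ⟨Ioc_subset_Icc_self (hy0 n), Ioc_subset_Icc_self (hz0 n)⟩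
  have h0 : Tendsto (fun n => (1 : ℝ) / ((φ n : ℕ) + 1)) atTop (𝓝 0) :=
    tendsto_one_div_add_atTop_nhds_zero_nat.comp hφ.tendsto_atTop
  have hlimof : ∀ (w : ℕ → Plane) (a : ℝ), Tendsto (fun n => w (φ n) 0) atTop (𝓝 a) →
      (∀ n : ℕ, |w n 1| < 1 / (n + 1)) → Tendsto (fun n => w (φ n)) atTop (𝓝 !₂[a, 0]) := by
    intro w a ha hw
    have h1 : Tendsto (fun n => w (φ n) 1) atTop (𝓝 0) :=
      squeeze_zero_norm (fun n => (hw (φ n)).le) h0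
    have h2 : Tendsto (fun n => (WithLp.toLp 2 ![w (φ n) 0, w (φ n) 1] : Plane)) atTop
        (𝓝 !₂[a, 0]) := by
      refine ((PiLp.continuous_toLp 2 _).tendsto _).comp (tendsto_pi_nhds.2 fun i => ?_)
      fin_cases i
      · simpa using ha
      · simpa using h1
    refine h2.congr fun n => ?_
    ext i; fin_cases i <;> simp
  have hys : Tendsto (fun n => y (φ n) 0) atTop (𝓝 s) := (continuous_fst.tendsto _).comp hlim
  have hzs : Tendsto (fun n => z (φ n) 0) atTop (𝓝 s') := (continuous_snd.tendsto _).comp hlim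
  have hy := hlimof y s hys hy1
  have hz := hlimof z s' hzs hz1
  have hcont := (D.contDiff_tube 1).continuous
  have hb : D.bdry s = D.bdry s' := by
    rw [← D.tube_apply_zero, ← D.tube_apply_zero]
    refine tendsto_nhds_unique ((hcont.tendsto _).comp hy) ?_
    refine ((hcont.tendsto _).comp hz).congr fun n => (heq (φ n)).symm
  have hloc : ∀ (a : ℝ) (u w : ℕ → Plane), Tendsto u atTop (𝓝 !₂[a, 0]) →
      Tendsto w atTop (𝓝 !₂[a, 0]) → (∀ n, D.tube 1 (u n) = D.tube 1 (w n)) →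
      ∃ n, u n = w n := by
    intro a u w hu hw huw
    obtain ⟨e, he, hec⟩ := D.tube_isLocalHomeomorph a
    have hsrc := e.open_source.mem_nhds he
    obtain ⟨n, h1, h2⟩ := ((hu.eventually hsrc).and (hw.eventually hsrc)).exists
    refine ⟨n, e.injOn h1 h2 ?_⟩
    rw [hec]; exact huw n
  have hshift : ∀ (u : ℕ → Plane), Tendsto u atTop (𝓝 !₂[0, 0]) →
      Tendsto (fun n => !₂[u n 0 + (1 : ℤ), u n 1]) atTop (𝓝 (!₂[1, 0] : Plane)) := by
    intro u hu
    have hc : Continuous fun y : Plane => (!₂[y 0 + (1 : ℤ), y 1] : Plane) := by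
      refine (PiLp.continuous_toLp 2 _).comp (continuous_pi fun i => ?_)
      fin_cases i
      · exact (Plane.coord 0).continuous.add continuous_const
      · exact (Plane.coord 1).continuous
    have := (hc.tendsto !₂[0, 0]).comp hu
    simpa [Function.comp_def] using this
  -- If the two limits are the ends `0` and `1`, one sequence is shifted by a period. It then meets
  -- the other one, which `Ioc` excludes because a shifted coordinate exceeds `1`.
  rcases D.bdry_eq_iff hs hs' hb with (h : s = s') | ⟨h, h'⟩ | ⟨h, h'⟩
  · obtain ⟨n, hn⟩ := hloc s _ _ hy (by rw [h]; exact hz) fun n => heq _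
    exact hne _ hn
  · subst h h'
    obtain ⟨n, hn⟩ := hloc 1 _ _ (hshift _ hy) hz fun n => by
      rw [D.tube_add_int]; exact heq _
    have h2 := congrArg (fun v : Plane => v 0) hn
    simp at h2
    linarith [(hz0 (φ n)).2, (hy0 (φ n)).1]
  · subst h h'
    obtain ⟨n, hn⟩ := hloc 1 _ _ (hshift _ hz) hy fun n => by
      rw [D.tube_add_int]; exact (heq _).symm
    have h2 := congrArg (fun v : Plane => v 0) hn
    simp at h2
    linarith [(hy0 (φ n)).2, (hz0 (φ n)).1]

/-- The image of the strip is a neighbourhood of the boundary, so `ρ` has a negative maximum on the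
compact remainder of `M`. -/
theorem exists_tube_covers {r : ℝ} (hr : 0 < r) : ∃ ε > 0, ∀ x : Plane, -ε < D.ρ x → D.ρ x ≤ 0 →
    ∃ y : Plane, (y 0 ∈ Ioc (0 : ℝ) 1 ∧ |y 1| < r) ∧ D.tube 1 y = x := by
  set U : Set Plane := D.tube 1 '' {y | |y 1| < r} with hU
  have hUn : ∀ x ∈ D.bd, U ∈ 𝓝 x := by
    intro x hx
    have hx' : x ∈ range D.bdry := by rw [D.bdry_range]; exact hx
    obtain ⟨s, rfl⟩ := hx'
    obtain ⟨e, he, hec⟩ := D.tube_isLocalHomeomorph s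
    have h1 : {y : Plane | |y 1| < r} ∈ 𝓝 (!₂[s, 0] : Plane) := by
      refine (isOpen_lt ?_ continuous_const).mem_nhds (by simpa using hr)
      exact (Plane.coord 1).continuous.abs
    have h2 := e.map_nhds_eq he
    rw [hec, D.tube_apply_zero] at h2
    rw [← h2]
    exact image_mem_map h1
  have hcomp : IsCompact (D.M \ interior U) := D.isCompact_M.diff isOpen_interior
  obtain ⟨ε, hε, hεU⟩ : ∃ ε > 0, ∀ x ∈ D.M \ interior U, D.ρ x ≤ -ε := by
    rcases (D.M \ interior U).eq_empty_or_nonempty with h | h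
    · exact ⟨1, one_pos, fun x hx => by simp [h] at hx⟩
    · obtain ⟨x₀, hx₀, hmax⟩ := hcomp.exists_isMaxOn h D.ρ_smooth.continuous.continuousOn
      refine ⟨-D.ρ x₀, ?_, fun x hx => by simpa using hmax hx⟩
      have h1 : D.ρ x₀ ≤ 0 := hx₀.1
      rcases h1.eq_or_lt with h2 | h2
      · exact absurd (mem_interior_iff_mem_nhds.2 (hUn x₀ h2)) hx₀.2
      · exact neg_pos.2 h2
  refine ⟨ε, hε, fun x hx1 hx2 => ?_⟩
  have hxU : x ∈ U := by
    by_contra h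
    have := hεU x ⟨hx2, fun h' => h (interior_subset h')⟩
    linarith
  obtain ⟨y, hy, rfl⟩ := hxU
  obtain ⟨n, hn, -⟩ := existsUnique_add_zsmul_mem_Ioc (one_pos : (0 : ℝ) < 1) (y 0) 0
  refine ⟨!₂[y 0 + n, y 1], ⟨by simpa using hn, by simpa using hy⟩, D.tube_add_int n y⟩

/-- On the boundary the derivative of `ρ` in the normal coordinate is `‖∇ρ‖²`, at least `2 κ` by
compactness, and it stays above `κ` nearby. This confines the layer `|ρ| ≤ ε` to a strip of width
comparable to `ε`. -/
theorem exists_le_abs_ρ_tube : ∃ r > 0, ∃ κ > 0, ∀ y : Plane, y 0 ∈ Icc (0 : ℝ) 1 → |y 1| < r →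
    κ * |y 1| ≤ |D.ρ (D.tube 1 y)| := by
  have hc1 : Continuous D.conormal := D.contDiff_conormal.continuous
  obtain ⟨s₀, -, hmin⟩ := (isCompact_Icc (a := (0 : ℝ)) (b := 1)).exists_isMinOn
    ⟨0, by simp⟩ (f := fun s => ‖D.conormal s‖ ^ 2) (hc1.norm.pow 2).continuousOn
  set κ := ‖D.conormal s₀‖ ^ 2 / 2 with hκ
  have hκp : 0 < κ := by
    have := norm_pos_iff.2 (D.conormal_ne_zero s₀)
    positivity
  let f : ℝ × ℝ → ℝ := fun z => fderiv ℝ D.ρ (D.tube 1 !₂[z.1, z.2]) (D.conormal z.1)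
  have hmk : Continuous fun z : ℝ × ℝ => (!₂[z.1, z.2] : Plane) := by
    refine (PiLp.continuous_toLp 2 _).comp (continuous_pi fun i => ?_)
    fin_cases i
    · exact continuous_fst
    · exact continuous_snd
  have hf : Continuous f :=
    ((D.ρ_smooth.continuous_fderiv (by simp)).comp ((D.contDiff_tube 1).continuous.comp hmk)).clm_apply
      (hc1.comp continuous_fst)
  obtain ⟨r, hr, hthick⟩ := ((isCompact_Icc (a := (0 : ℝ)) (b := 1)).prod
    (isCompact_singleton (x := (0 : ℝ)))).exists_thickening_subset_open
    (isOpen_lt continuous_const hf : IsOpen {z | κ < f z}) (by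
      rintro ⟨s, t⟩ ⟨hs, rfl : t = 0⟩
      simp only [mem_ofPred_eq, f, tube_apply_zero]
      rw [← inner_gradient, ← conormal, real_inner_self_eq_norm_sq]
      have : ‖D.conormal s₀‖ ^ 2 ≤ ‖D.conormal s‖ ^ 2 := hmin hs
      linarith)
  refine ⟨r, hr, κ, hκp, fun y hy0 hy1 => ?_⟩
  have hd : ∀ t, HasDerivAt (fun t => D.ρ (D.tube 1 !₂[y 0, t])) (f (y 0, t)) t := by
    intro t
    have h1 : HasDerivAt (fun t => D.tube 1 !₂[y 0, t]) (D.conormal (y 0)) t := by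
      simpa [tube] using ((hasDerivAt_id t).smul_const (D.conormal (y 0))).const_add (D.bdry (y 0))
    exact ((D.ρ_smooth.differentiable (by simp)) _).hasFDerivAt.comp_hasDerivAt t h1
  have hmono : MonotoneOn (fun t => D.ρ (D.tube 1 !₂[y 0, t]) - κ * t) (Ioo (-r) r) := by
    have hd' : ∀ t, HasDerivAt (fun t => D.ρ (D.tube 1 !₂[y 0, t]) - κ * t) (f (y 0, t) - κ) t :=
      fun t => by simpa [Pi.sub_def] using (hd t).sub ((hasDerivAt_id t).const_mul κ)
    refine monotoneOn_of_deriv_nonneg (convex_Ioo _ _)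
      (fun t _ => (hd' t).continuousAt.continuousWithinAt)
      (fun t _ => (hd' t).differentiableAt.differentiableWithinAt) fun t ht => ?_
    have ht := interior_subset ht
    rw [(hd' t).deriv, sub_nonneg]
    refine (hthick ?_).le
    rw [Metric.mem_thickening_iff]
    refine ⟨(y 0, 0), ⟨hy0, rfl⟩, ?_⟩
    rw [Prod.dist_eq, dist_self, max_eq_right dist_nonneg, Real.dist_eq, sub_zero]
    exact abs_lt.2 ht
  have h0 : (0 : ℝ) ∈ Ioo (-r) r := ⟨by linarith, hr⟩
  have hy : (!₂[y 0, y 1] : Plane) = y := by ext i; fin_cases i <;> simp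
  have hb : D.ρ (D.bdry (y 0)) = 0 := D.bdry_mem _
  rcases le_total 0 (y 1) with h | h
  · have := hmono h0 (abs_lt.1 hy1) h
    simp only [tube_apply_zero, hy, hb] at this
    rw [abs_of_nonneg h]
    exact le_trans (by linarith) (le_abs_self _)
  · have := hmono (abs_lt.1 hy1) h0 h
    simp only [tube_apply_zero, hy, hb] at this
    rw [abs_of_nonpos h]
    exact le_trans (by linarith) (neg_le_abs _)

end ConformalDomain

/-! ### Boundary layers and the divergence theorem -/

theorem Plane.volume_preserving_coord :
    MeasurePreserving (fun y : Plane => (y 0, y 1)) volume volume :=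
  (volume_preserving_finTwoArrow ℝ).comp (PiLp.volume_preserving_ofLp (Fin 2))

theorem Plane.measurableEmbedding_coord : MeasurableEmbedding fun y : Plane => (y 0, y 1) :=
  (MeasurableEquiv.finTwoArrow (α := ℝ)).measurableEmbedding.comp
    (MeasurableEquiv.toLp 2 (Fin 2 → ℝ)).symm.measurableEmbedding

theorem continuous_deriv_smoothTransition : Continuous (deriv Real.smoothTransition) :=
  (Real.smoothTransition.contDiff (n := 1)).continuous_deriv (by simp)

theorem hasDerivAt_smoothTransition (t : ℝ) :
    HasDerivAt Real.smoothTransition (deriv Real.smoothTransition t) t :=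
  ((Real.smoothTransition.contDiff (n := 1)).differentiable (by simp) t).hasDerivAt

theorem deriv_smoothTransition_eq_zero {t : ℝ} (ht : t ∉ Icc (0 : ℝ) 1) :
    deriv Real.smoothTransition t = 0 := by
  rw [mem_Icc, not_and_or, not_le, not_le] at ht
  rcases ht with ht | ht
  · have : Real.smoothTransition =ᶠ[𝓝 t] fun _ => 0 := by
      filter_upwards [gt_mem_nhds ht] with s hs using Real.smoothTransition.zero_of_nonpos hs.le
    rw [this.deriv_eq, deriv_const]
  · have : Real.smoothTransition =ᶠ[𝓝 t] fun _ => 1 := by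
      filter_upwards [lt_mem_nhds ht] with s hs using Real.smoothTransition.one_of_one_le hs.le
    rw [this.deriv_eq, deriv_const]

theorem integral_deriv_smoothTransition : ∫ t, deriv Real.smoothTransition t = 1 := by
  have h1 : ∫ t in (0 : ℝ)..1, deriv Real.smoothTransition t = 1 := by
    rw [intervalIntegral.integral_eq_sub_of_hasDerivAt (fun t _ => hasDerivAt_smoothTransition t)
      (continuous_deriv_smoothTransition.intervalIntegrable _ _)]
    simp
  rw [intervalIntegral.integral_of_le zero_le_one, ← integral_Icc_eq_integral_Ioc] at h1
  rw [← h1, setIntegral_eq_integral_of_forall_compl_eq_zero]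
  exact fun t ht => deriv_smoothTransition_eq_zero ht

theorem exists_abs_deriv_smoothTransition_le : ∃ B, ∀ t, |deriv Real.smoothTransition t| ≤ B := by
  obtain ⟨B, hB⟩ := (isCompact_Icc (a := (0 : ℝ)) (b := 1)).exists_bound_of_continuousOn
    continuous_deriv_smoothTransition.continuousOn
  refine ⟨max B 0, fun t => ?_⟩
  by_cases ht : t ∈ Icc (0 : ℝ) 1
  · exact (hB t ht).trans (le_max_left _ _)
  · rw [deriv_smoothTransition_eq_zero ht, abs_zero]; exact le_max_right _ _

namespace ConformalDomain

variable (D : ConformalDomain)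

/-- The Jacobian of the tubular coordinates. -/
def tubeJac (s r : ℝ) : ℝ :=
  (deriv D.bdry s + r • deriv D.conormal s) 0 * D.conormal s 1 -
    D.conormal s 0 * (deriv D.bdry s + r • deriv D.conormal s) 1

theorem continuous_tubeJac : Continuous fun z : ℝ × ℝ => D.tubeJac z.1 z.2 := by
  have h1 : Continuous (deriv D.bdry) := D.bdry_smooth.continuous_deriv (by simp)
  have h2 : Continuous (deriv D.conormal) := D.contDiff_conormal.continuous_deriv (by simp)
  have h3 : Continuous D.conormal := D.contDiff_conormal.continuous
  have h4 : Continuous fun z : ℝ × ℝ => deriv D.bdry z.1 + z.2 • deriv D.conormal z.1 := by fun_prop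
  have h5 : Continuous fun z : ℝ × ℝ => D.conormal z.1 := by fun_prop
  have c := fun i => (Plane.coord i).continuous
  exact (((c 0).comp h4).mul ((c 1).comp h5)).sub (((c 0).comp h5).mul ((c 1).comp h4))

theorem abs_tubeJac_zero (s : ℝ) : |D.tubeJac s 0| = ‖deriv D.bdry s‖ * ‖D.conormal s‖ := by
  rw [← Plane.abs_area_of_inner_eq_zero (D.inner_deriv_bdry_conormal s)]
  simp [tubeJac]

theorem continuous_tube_pair : Continuous fun z : ℝ × ℝ => D.tube 1 !₂[z.1, z.2] := by
  have h1 := D.bdry_smooth.continuous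
  have h3 : Continuous D.conormal := D.contDiff_conormal.continuous
  simp only [tube]
  simp
  fun_prop

/-- The density in tubular coordinates of the layer of width `ε` at the boundary. -/
def layerDensity (G : Plane → ℂ) (ε : ℝ) (y : Plane) : ℂ :=
  (|D.tubeJac (y 0) (ε * y 1)| * deriv Real.smoothTransition (-D.ρ (D.tube ε y) / ε)) •
    G (D.tube ε y)

/-- The limit of `layerDensity` for `ε → 0`. -/
def limitDensity (G : Plane → ℂ) (y : Plane) : ℂ :=
  (‖deriv D.bdry (y 0)‖ * ‖D.conormal (y 0)‖ *
    deriv Real.smoothTransition (-(y 1) * ‖D.conormal (y 0)‖ ^ 2)) • G (D.bdry (y 0))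

/-- The quotient `ρ (tube ε y) / ε` is a difference quotient at a zero of `ρ` and tends to the
normal derivative `y 1 * ‖∇ρ‖²`. -/
theorem tendsto_layerDensity {G : Plane → ℂ} (hG : Continuous G) (y : Plane) :
    Tendsto (fun ε => D.layerDensity G ε y) (𝓝[>] 0) (𝓝 (D.limitDensity G y)) := by
  have ht : Tendsto (fun ε : ℝ => ε * y 1) (𝓝[>] 0) (𝓝 0) := by
    have : Tendsto (fun ε : ℝ => ε * y 1) (𝓝 0) (𝓝 (0 * y 1)) :=
      (continuous_id.mul continuous_const).tendsto 0
    rw [zero_mul] at this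
    exact this.mono_left nhdsWithin_le_nhds
  have h1 : Tendsto (fun ε : ℝ => |D.tubeJac (y 0) (ε * y 1)|) (𝓝[>] 0)
      (𝓝 (‖deriv D.bdry (y 0)‖ * ‖D.conormal (y 0)‖)) := by
    rw [← abs_tubeJac_zero]
    have : Continuous fun r => |D.tubeJac (y 0) r| :=
      (D.continuous_tubeJac.comp (continuous_const.prodMk continuous_id)).abs
    exact (this.tendsto 0).comp ht
  have h2 : Tendsto (fun ε : ℝ => G (D.tube ε y)) (𝓝[>] 0) (𝓝 (G (D.bdry (y 0)))) := by
    have hc : Continuous fun r => G (D.tube 1 !₂[y 0, r]) :=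
      hG.comp (D.continuous_tube_pair.comp (continuous_const.prodMk continuous_id))
    have := (hc.tendsto 0).comp ht
    rw [tube_apply_zero] at this
    exact this.congr fun ε => by rw [D.tube_eq]; rfl
  have h3 : Tendsto (fun ε : ℝ => -D.ρ (D.tube ε y) / ε) (𝓝[>] 0)
      (𝓝 (-(y 1) * ‖D.conormal (y 0)‖ ^ 2)) := by
    have hd : HasDerivAt (fun ε => D.tube ε y) (y 1 • D.conormal (y 0)) 0 := by
      have := (((hasDerivAt_id (0 : ℝ)).mul_const (y 1)).smul_const
        (D.conormal (y 0))).const_add (D.bdry (y 0))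
      simpa [tube] using this
    have hb : D.tube 0 y = D.bdry (y 0) := by simp [tube]
    have hd' : HasDerivAt (fun ε => D.ρ (D.tube ε y)) (y 1 * ‖D.conormal (y 0)‖ ^ 2) 0 := by
      have h := ((D.ρ_smooth.differentiable (by simp)) (D.tube 0 y)).hasFDerivAt.comp_hasDerivAt
        0 hd
      rw [hb, map_smul, ← inner_gradient, ← conormal, real_inner_self_eq_norm_sq] at h
      exact h
    have := hd'.tendsto_slope_zero_right.neg
    rw [← neg_mul] at this
    refine this.congr fun ε => ?_
    have h0 : D.ρ (D.bdry (y 0)) = 0 := D.bdry_mem _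
    rw [zero_add, hb, h0]
    simp; ring
  exact (h1.mul ((continuous_deriv_smoothTransition.tendsto _).comp h3)).smul h2

/-- Integration against an approximate delta function of `ρ` converges to an integral along the
boundary curve. -/
theorem tendsto_integral_layer {G : Plane → ℂ} (hG : Continuous G) :
    IntegrableOn (D.limitDensity G) {y : Plane | y 0 ∈ Ioc (0 : ℝ) 1} ∧
    Tendsto (fun ε : ℝ => ∫ x, (ε⁻¹ * deriv Real.smoothTransition (-D.ρ x / ε)) • G x)
      (𝓝[>] 0) (𝓝 (∫ y in {y : Plane | y 0 ∈ Ioc (0 : ℝ) 1}, D.limitDensity G y)) := by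
  obtain ⟨r₁, hr₁, hinj⟩ := D.exists_injOn_tube
  obtain ⟨r₂, hr₂, κ, hκ, hlow⟩ := D.exists_le_abs_ρ_tube
  set r := min r₁ r₂ with hr
  have hrp : 0 < r := lt_min hr₁ hr₂
  obtain ⟨ε₁, hε₁, hcov⟩ := D.exists_tube_covers hrp
  obtain ⟨B, hB⟩ := exists_abs_deriv_smoothTransition_le
  have hK : IsCompact (Icc (0 : ℝ) 1 ×ˢ Icc (-r) r) := isCompact_Icc.prod isCompact_Icc
  obtain ⟨B₁, hB₁⟩ := hK.exists_bound_of_continuousOn D.continuous_tubeJac.continuousOn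
  obtain ⟨B₂, hB₂⟩ := hK.exists_bound_of_continuousOn (hG.comp D.continuous_tube_pair).continuousOn
  set Str : Set Plane := {y : Plane | y 0 ∈ Ioc (0 : ℝ) 1} with hStr
  have hc0 : Continuous fun y : Plane => y 0 := (Plane.coord 0).continuous
  have hc1 : Continuous fun y : Plane => y 1 := (Plane.coord 1).continuous
  have hStrM : MeasurableSet Str := measurableSet_Ioc.preimage hc0.measurable
  -- The part of the strip on which the rescaled coordinates are injective and the compactness
  -- bounds hold; every point of the strip belongs to it for small `ε`.
  set A : ℝ → Set Plane := fun ε => {y | y 0 ∈ Ioc (0 : ℝ) 1 ∧ |ε * y 1| < r} with hA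
  have hAM : ∀ ε, MeasurableSet (A ε) := fun ε => hStrM.inter
    (isOpen_lt (continuous_const.mul hc1).abs continuous_const).measurableSet
  -- Where the density does not vanish, `κ ε |y 1| ≤ |ρ| ≤ ε`. Hence after rescaling all layers lie
  -- in the box `|y 1| ≤ κ⁻¹`, independently of `ε`, which gives an integrable majorant.
  set bnd : Plane → ℝ := ({y : Plane | y 0 ∈ Icc (0 : ℝ) 1 ∧ y 1 ∈ Icc (-κ⁻¹) κ⁻¹}).indicator
    fun _ => |B₁| * |B| * |B₂| with hbnd
  have hbndi : Integrable bnd := by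
    have hms : MeasurableSet {y : Plane | y 0 ∈ Icc (0 : ℝ) 1 ∧ y 1 ∈ Icc (-κ⁻¹) κ⁻¹} :=
      (isClosed_Icc.preimage hc0).measurableSet.inter (isClosed_Icc.preimage hc1).measurableSet
    refine (integrable_indicator_iff hms).2 (integrableOn_const ?_)
    have : {y : Plane | y 0 ∈ Icc (0 : ℝ) 1 ∧ y 1 ∈ Icc (-κ⁻¹) κ⁻¹} =
        (fun y : Plane => (y 0, y 1)) ⁻¹' (Icc (0 : ℝ) 1 ×ˢ Icc (-κ⁻¹) κ⁻¹) := rfl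
    rw [this, Plane.volume_preserving_coord.measure_preimage
      (measurableSet_Icc.prod measurableSet_Icc).nullMeasurableSet]
    exact (isCompact_Icc.prod isCompact_Icc).measure_lt_top.ne
  have hle : ∀ ε : ℝ, 0 < ε → ∀ y ∈ Str,
      ‖(A ε).indicator (D.layerDensity G ε) y‖ ≤ bnd y := by
    intro ε hε y hy
    have hb0 : 0 ≤ bnd y := indicator_nonneg (fun _ _ => by positivity) y
    by_cases hyA : y ∈ A ε
    · rw [indicator_of_mem hyA, layerDensity, norm_smul, Real.norm_eq_abs, abs_mul, abs_abs]
      by_cases hη : deriv Real.smoothTransition (-D.ρ (D.tube ε y) / ε) = 0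
      · rw [hη, abs_zero, mul_zero, zero_mul]; exact hb0
      · have hmem : -D.ρ (D.tube ε y) / ε ∈ Icc (0 : ℝ) 1 := by
          by_contra h; exact hη (deriv_smoothTransition_eq_zero h)
        have h1 := hlow !₂[y 0, ε * y 1] (Ioc_subset_Icc_self hyA.1)
          (hyA.2.trans_le (min_le_right _ _))
        rw [← D.tube_eq] at h1
        have h2 : |D.ρ (D.tube ε y)| ≤ ε := by
          have h3 : |-D.ρ (D.tube ε y) / ε| ≤ 1 := abs_le.2 ⟨by linarith [hmem.1], hmem.2⟩
          rwa [abs_div, abs_neg, abs_of_pos hε, div_le_one hε] at h3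
        have h4 : |y 1| ≤ κ⁻¹ := by
          have h5 : κ * (ε * |y 1|) ≤ ε := by
            have : |(!₂[y 0, ε * y 1] : Plane) 1| = ε * |y 1| := by
              simp [abs_mul, abs_of_pos hε]
            rw [this] at h1
            exact h1.trans h2
          rw [← one_div, le_div_iff₀ hκ]
          by_contra! h
          nlinarith
        have hz : (y 0, ε * y 1) ∈ Icc (0 : ℝ) 1 ×ˢ Icc (-r) r :=
          ⟨Ioc_subset_Icc_self hyA.1, abs_le.1 hyA.2.le⟩
        have e1 : |D.tubeJac (y 0) (ε * y 1)| ≤ |B₁| := (hB₁ _ hz).trans (le_abs_self _)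
        have e2 : ‖G (D.tube ε y)‖ ≤ |B₂| := by
          rw [D.tube_eq]; exact (hB₂ _ hz).trans (le_abs_self _)
        have e3 := (hB (-D.ρ (D.tube ε y) / ε)).trans (le_abs_self B)
        have hyb : y ∈ {y : Plane | y 0 ∈ Icc (0 : ℝ) 1 ∧ y 1 ∈ Icc (-κ⁻¹) κ⁻¹} :=
          ⟨Ioc_subset_Icc_self hyA.1, abs_le.1 h4⟩
        rw [hbnd, indicator_of_mem hyb]
        gcongr
    · rw [indicator_of_notMem hyA, norm_zero]; exact hb0
  have hlim : ∀ y ∈ Str, Tendsto (fun ε => (A ε).indicator (D.layerDensity G ε) y) (𝓝[>] 0)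
      (𝓝 (D.limitDensity G y)) := by
    intro y hy
    refine (D.tendsto_layerDensity hG y).congr' ?_
    have : ∀ᶠ ε : ℝ in 𝓝 0, |ε * y 1| < r := by
      have hc : Continuous fun ε : ℝ => |ε * y 1| := by fun_prop
      have h0 := hc.tendsto 0
      rw [zero_mul, abs_zero] at h0
      exact h0.eventually (gt_mem_nhds hrp)
    filter_upwards [nhdsWithin_le_nhds this] with ε hε
    rw [indicator_of_mem (show y ∈ A ε from ⟨hy, hε⟩)]
  have hlimc : Continuous (D.limitDensity G) := by
    have h1 : Continuous (deriv D.bdry) := D.bdry_smooth.continuous_deriv (by simp)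
    have h2 := D.bdry_smooth.continuous
    have h3 : Continuous D.conormal := D.contDiff_conormal.continuous
    have h4 := continuous_deriv_smoothTransition
    have e1 : Continuous fun y : Plane => ‖deriv D.bdry (y 0)‖ := (h1.comp hc0).norm
    have e2 : Continuous fun y : Plane => ‖D.conormal (y 0)‖ := (h3.comp hc0).norm
    exact ((e1.mul e2).mul (h4.comp (hc1.neg.mul (e2.pow 2)))).smul (hG.comp (h2.comp hc0))
  refine ⟨?_, ?_⟩
  · refine (hbndi.integrableOn (s := Str)).mono' hlimc.aestronglyMeasurable ?_
    refine (ae_restrict_iff' hStrM).2 (ae_of_all _ fun y hy => ?_)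
    refine le_of_tendsto (hlim y hy).norm ?_
    filter_upwards [self_mem_nhdsWithin] with ε hε using hle ε hε y hy
  have hmain : Tendsto (fun ε => ∫ y in Str, (A ε).indicator (D.layerDensity G ε) y) (𝓝[>] 0)
      (𝓝 (∫ y in Str, D.limitDensity G y)) := by
    refine tendsto_integral_filter_of_dominated_convergence bnd ?_ ?_
      (hbndi.integrableOn (s := Str)) ?_
    · refine Eventually.of_forall fun ε => ?_
      refine AEStronglyMeasurable.indicator (Continuous.aestronglyMeasurable ?_) (hAM ε)
      have e1 : Continuous fun y : Plane => |D.tubeJac (y 0) (ε * y 1)| :=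
        (D.continuous_tubeJac.comp (hc0.prodMk (continuous_const.mul hc1))).abs
      have e2 : Continuous (D.tube ε) := (D.contDiff_tube ε).continuous
      have e3 : Continuous fun y => -D.ρ (D.tube ε y) / ε :=
        (D.ρ_smooth.continuous.comp e2).neg.div_const ε
      exact (e1.mul (continuous_deriv_smoothTransition.comp e3)).smul (hG.comp e2)
    · filter_upwards [self_mem_nhdsWithin] with ε hε
      exact (ae_restrict_iff' hStrM).2 (ae_of_all _ fun y hy => hle ε hε y hy)
    · exact (ae_restrict_iff' hStrM).2 (ae_of_all _ fun y hy => hlim y hy)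
  refine hmain.congr' ?_
  have hev : ∀ᶠ ε : ℝ in 𝓝[>] 0, ε < ε₁ := nhdsWithin_le_nhds (gt_mem_nhds hε₁)
  filter_upwards [self_mem_nhdsWithin, hev] with ε (hε : 0 < ε) hε'
  have hinjA : InjOn (D.tube ε) (A ε) := by
    intro y hy z hz h
    rw [D.tube_eq, D.tube_eq ε z] at h
    have h1 := hinj (show !₂[y 0, ε * y 1] ∈ _ from ⟨hy.1, hy.2.trans_le (min_le_left _ _)⟩)
      (show !₂[z 0, ε * z 1] ∈ _ from ⟨hz.1, hz.2.trans_le (min_le_left _ _)⟩) h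
    have h2 := congrArg (fun v : Plane => v 0) h1
    have h3 := congrArg (fun v : Plane => v 1) h1
    simp [hε.ne'] at h2 h3
    ext i; fin_cases i
    · exact h2
    · exact h3
  have hzero : ∀ x, x ∉ D.tube ε '' A ε →
      (ε⁻¹ * deriv Real.smoothTransition (-D.ρ x / ε)) • G x = 0 := by
    intro x hx
    by_cases hη : deriv Real.smoothTransition (-D.ρ x / ε) = 0
    · rw [hη, mul_zero, zero_smul]
    · exfalso
      have hmem : -D.ρ x / ε ∈ Icc (0 : ℝ) 1 := by
        by_contra h; exact hη (deriv_smoothTransition_eq_zero h)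
      have h1 : D.ρ x ≤ 0 := by
        have := mul_nonneg hmem.1 hε.le
        rw [div_mul_cancel₀ _ hε.ne'] at this
        linarith
      have h2 : -ε ≤ D.ρ x := by
        have := hmem.2
        rw [div_le_one hε] at this
        linarith
      obtain ⟨y, ⟨hy0, hy1⟩, rfl⟩ := hcov x (by linarith) h1
      refine hx ⟨!₂[y 0, ε⁻¹ * y 1], ⟨hy0, ?_⟩, ?_⟩
      · simpa [hε.ne'] using hy1
      · rw [D.tube_eq]
        congr 1
        ext i; fin_cases i <;> simp [hε.ne']
  rw [← setIntegral_eq_integral_of_forall_compl_eq_zero hzero,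
    integral_image_eq_integral_abs_det_fderiv_smul volume (hAM ε)
      (fun y _ => (D.hasFDerivAt_tube ε y).hasFDerivWithinAt) hinjA,
    setIntegral_indicator (hAM ε), show Str ∩ A ε = A ε from
      inter_eq_right.2 fun y hy => hy.1]
  refine integral_congr_ae (ae_of_all _ fun y => ?_)
  simp only [layerDensity, det_tubeDeriv, smul_smul]
  rw [abs_mul, abs_of_pos hε, ← tubeJac]
  congr 1
  field_simp

/-- The Euclidean flux density of the direction `v` through the boundary curve. -/
def flux (v : Plane) (s : ℝ) : ℝ :=
  ‖deriv D.bdry s‖ * ‖D.conormal s‖⁻¹ * fderiv ℝ D.ρ (D.bdry s) v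

/-- The boundary is the image of the degenerate map `tube 0`, whose Jacobian vanishes identically.
-/
theorem volume_bd : volume D.bd = 0 := by
  have hsub : D.bd ⊆ (D.tube 0) '' univ := by
    intro x hx
    have hx' : x ∈ range D.bdry := by rw [D.bdry_range]; exact hx
    obtain ⟨s, rfl⟩ := hx'
    exact ⟨!₂[s, 0], trivial, by simp [tube]⟩
  refine measure_mono_null hsub (addHaar_image_eq_zero_of_det_fderivWithin_eq_zero volume
    (fun y _ => (D.hasFDerivAt_tube 0 y).hasFDerivWithinAt) fun y _ => ?_)
  rw [det_tubeDeriv, zero_mul]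

/-- The normal variable is integrated out: the bump has integral one, and the scaling by `‖∇ρ‖²`
leaves the factor `‖∇ρ‖⁻²`. -/
theorem integral_limitDensity {G : Plane → ℂ} (hG : Continuous G) :
    ∫ y in {y : Plane | y 0 ∈ Ioc (0 : ℝ) 1}, D.limitDensity G y =
      ∫ s in Ioc (0 : ℝ) 1, (‖deriv D.bdry s‖ * ‖D.conormal s‖⁻¹) • G (D.bdry s) := by
  have hI := (D.tendsto_integral_layer hG).1
  set H : ℝ × ℝ → ℂ := fun z => (‖deriv D.bdry z.1‖ * ‖D.conormal z.1‖ *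
    deriv Real.smoothTransition (-z.2 * ‖D.conormal z.1‖ ^ 2)) • G (D.bdry z.1) with hH
  have hset : {y : Plane | y 0 ∈ Ioc (0 : ℝ) 1} =
      (fun y : Plane => (y 0, y 1)) ⁻¹' (Ioc (0 : ℝ) 1 ×ˢ univ) := by ext y; simp
  have h1 : ∫ y in {y : Plane | y 0 ∈ Ioc (0 : ℝ) 1}, D.limitDensity G y =
      ∫ z in Ioc (0 : ℝ) 1 ×ˢ univ, H z := by
    rw [hset]
    exact Plane.volume_preserving_coord.setIntegral_preimage_emb
      Plane.measurableEmbedding_coord H _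
  have h2 : IntegrableOn H (Ioc (0 : ℝ) 1 ×ˢ univ) (volume.prod volume) := by
    rw [hset] at hI
    exact (Plane.volume_preserving_coord.integrableOn_comp_preimage
      Plane.measurableEmbedding_coord).1 hI
  rw [h1, Measure.volume_eq_prod, setIntegral_prod H h2]
  refine integral_congr_ae (ae_of_all _ fun s => ?_)
  have hn : 0 < ‖D.conormal s‖ := norm_pos_iff.2 (D.conormal_ne_zero s)
  simp only [hH, Measure.restrict_univ]
  rw [integral_smul_const, integral_const_mul]
  have h3 : ∫ t : ℝ, deriv Real.smoothTransition (-t * ‖D.conormal s‖ ^ 2) =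
      (‖D.conormal s‖ ^ 2)⁻¹ := by
    have h4 := Measure.integral_comp_mul_right (deriv Real.smoothTransition) (-‖D.conormal s‖ ^ 2)
    simp only [integral_deriv_smoothTransition] at h4
    rw [abs_inv, abs_neg, abs_of_nonneg (by positivity), smul_eq_mul, mul_one] at h4
    rw [← h4]
    refine integral_congr_ae (ae_of_all _ fun t => ?_)
    simp
  rw [h3]
  congr 1
  field_simp

/-- The divergence theorem on `M`. -/
theorem integral_fderiv_M {F : Plane → ℂ} (hF : ContDiff ℝ 1 F) (v : Plane) :
    ∫ x in D.M, fderiv ℝ F x v = ∫ s in Ioc (0 : ℝ) 1, D.flux v s • F (D.bdry s) := by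
  have hρ1 : Continuous (fderiv ℝ D.ρ) := D.ρ_smooth.continuous_fderiv (by simp)
  have hF1 : Continuous fun x => fderiv ℝ F x v :=
    (hF.continuous_fderiv (by simp)).clm_apply continuous_const
  set G : Plane → ℂ := fun x => fderiv ℝ D.ρ x v • F x with hGdef
  have hG : Continuous G := (hρ1.clm_apply continuous_const).smul hF.continuous
  -- A smoothed indicator function: zero off `M` and one where `ρ ≤ -ε`. Integration by parts
  -- against it has no boundary term, and its derivative is an approximate delta function of `ρ`.
  set χ : ℝ → Plane → ℝ := fun ε x => Real.smoothTransition (-D.ρ x / ε) with hχ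
  have hχc : ∀ ε, ContDiff ℝ 1 (χ ε) := fun ε =>
    Real.smoothTransition.contDiff.comp ((D.ρ_smooth.of_le (by simp)).neg.div_const ε)
  have hχd : ∀ ε x, fderiv ℝ (χ ε) x v =
      -(ε⁻¹ * deriv Real.smoothTransition (-D.ρ x / ε)) * fderiv ℝ D.ρ x v := by
    intro ε x
    have h1 : HasFDerivAt (fun x => -D.ρ x / ε) ((ε⁻¹) • (-fderiv ℝ D.ρ x)) x := by
      have := (((D.ρ_smooth.differentiable (by simp)) x).hasFDerivAt.neg).const_smul ε⁻¹
      refine this.congr_of_eventuallyEq (Eventually.of_forall fun z => ?_)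
      simp [div_eq_inv_mul]
    have h2 : HasFDerivAt (χ ε) _ x := (hasDerivAt_smoothTransition _).hasFDerivAt.comp x h1
    rw [h2.fderiv]
    simp; ring
  have hχM : ∀ ε, 0 < ε → ∀ x, x ∉ D.M → χ ε x = 0 := fun ε hε x hx => by
    refine Real.smoothTransition.zero_of_nonpos ?_
    have : 0 < D.ρ x := not_le.1 hx
    exact div_nonpos_of_nonpos_of_nonneg (by linarith) hε.le
  have hχs : ∀ ε, 0 < ε → HasCompactSupport (χ ε) := fun ε hε =>
    HasCompactSupport.intro D.isCompact_M fun x hx => hχM ε hε x hx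
  have hparts : ∀ ε : ℝ, 0 < ε → ∫ x in D.M, χ ε x • fderiv ℝ F x v =
      ∫ x, (ε⁻¹ * deriv Real.smoothTransition (-D.ρ x / ε)) • G x := by
    intro ε hε
    have hχ1 : Continuous fun x => fderiv ℝ (χ ε) x v :=
      ((hχc ε).continuous_fderiv (by simp)).clm_apply continuous_const
    have hs1 : HasCompactSupport fun x => fderiv ℝ (χ ε) x v := by
      refine HasCompactSupport.comp_left (g := fun A : Plane →L[ℝ] ℝ => A v) ?_ (by simp)
      exact (hχs ε hε).fderiv (𝕜 := ℝ)
    rw [setIntegral_eq_integral_of_forall_compl_eq_zero (fun x hx => by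
      rw [hχM ε hε x hx, zero_smul])]
    have := integral_smul_fderiv_eq_neg_fderiv_smul_of_integrable (μ := volume) (𝕜 := ℝ)
      (f := χ ε) (g := F) (v := v)
      ((hχ1.smul hF.continuous).integrable_of_hasCompactSupport hs1.smul_right)
      (((hχc ε).continuous.smul hF1).integrable_of_hasCompactSupport (hχs ε hε).smul_right)
      (((hχc ε).continuous.smul hF.continuous).integrable_of_hasCompactSupport
        (hχs ε hε).smul_right)
      (fun x _ => (hχc ε).differentiable (by simp) x) (fun x _ => hF.differentiable (by simp) x)
    rw [this, ← integral_neg]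
    refine integral_congr_ae (ae_of_all _ fun x => ?_)
    simp only [hχd, hGdef, smul_smul]
    rw [neg_mul, neg_smul, neg_neg]
  have hlimL : Tendsto (fun ε => ∫ x in D.M, χ ε x • fderiv ℝ F x v) (𝓝[>] 0)
      (𝓝 (∫ x in D.M, fderiv ℝ F x v)) := by
    refine tendsto_integral_filter_of_dominated_convergence (fun x => ‖fderiv ℝ F x v‖) ?_ ?_ ?_ ?_
    · exact Eventually.of_forall fun ε => ((hχc ε).continuous.smul hF1).aestronglyMeasurable
    · refine Eventually.of_forall fun ε => ae_of_all _ fun x => ?_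
      rw [norm_smul, Real.norm_of_nonneg (Real.smoothTransition.nonneg _)]
      exact mul_le_of_le_one_left (norm_nonneg _) (Real.smoothTransition.le_one _)
    · exact (hF1.norm.continuousOn.integrableOn_compact D.isCompact_M)
    · have hbd : ∀ᵐ x ∂volume.restrict D.M, x ∉ D.bd :=
        ae_restrict_of_ae (measure_eq_zero_iff_ae_notMem.1 D.volume_bd)
      filter_upwards [hbd, ae_restrict_mem D.isClosed_M.measurableSet] with x hx hxM
      have hneg : D.ρ x < 0 := lt_of_le_of_ne hxM hx
      have hev : ∀ᶠ ε : ℝ in 𝓝[>] 0, ε < -D.ρ x :=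
        nhdsWithin_le_nhds (gt_mem_nhds (by linarith))
      refine tendsto_const_nhds.congr' ?_
      filter_upwards [hev, self_mem_nhdsWithin] with ε h1 (h2 : 0 < ε)
      rw [hχ]
      simp only
      rw [Real.smoothTransition.one_of_one_le ((one_le_div h2).2 h1.le), one_smul]
  have hlimR := (D.tendsto_integral_layer hG).2
  rw [D.integral_limitDensity hG] at hlimR
  have heq := tendsto_nhds_unique (hlimL.congr' (by
    filter_upwards [self_mem_nhdsWithin] with ε hε using hparts ε hε)) hlimR
  rw [heq]
  refine integral_congr_ae (ae_of_all _ fun s => ?_)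
  simp only [hGdef, flux, smul_smul]

end ConformalDomain

/-! ### Measures on phase space and Green's formula -/

namespace ConformalDomain

variable (D : ConformalDomain)

theorem measurable_density : Measurable fun x => ENNReal.ofReal (D.c x ^ 2)⁻¹ :=
  (D.c_smooth.continuous.measurable.pow_const 2).inv.ennreal_ofReal

theorem continuousOn_inv_c : ContinuousOn (fun x => (D.c x ^ 2)⁻¹) D.M :=
  ContinuousOn.inv₀ (D.c_smooth.continuous.pow 2).continuousOn fun _ hx =>
    (pow_pos (D.c_pos_of_mem hx) 2).ne'

/-- The area of `(M, g)`. -/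
abbrev gArea : Measure Plane := D.areaM.withDensity fun x => ENNReal.ofReal (D.c x ^ 2)⁻¹

instance : IsFiniteMeasure D.gArea :=
  isFiniteMeasure_withDensity_ofReal (D.continuousOn_inv_c.integrableOn_compact D.isCompact_M).2

instance : IsFiniteMeasure D.liouville := by unfold liouville; infer_instance

theorem ae_gArea_iff {P : Plane → Prop} : (∀ᵐ x ∂D.gArea, P x) ↔ ∀ᵐ x ∂D.areaM, P x := by
  rw [gArea, ae_withDensity_iff D.measurable_density]
  have h : ∀ᵐ x ∂D.areaM, x ∈ D.M := ae_restrict_mem D.isClosed_M.measurableSet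
  constructor
  · intro h1
    filter_upwards [h, h1] with x hx h2
    exact h2 (by simpa using D.c_pos_of_mem hx |>.ne')
  · intro h1
    filter_upwards [h1] with x h2 _ using h2

theorem ae_liouville_mem : ∀ᵐ p ∂D.liouville, p.1 ∈ D.M ∧ p.2 ∈ Ioc 0 (2 * Real.pi) := by
  have h1 : ∀ᵐ x ∂D.gArea, x ∈ D.M :=
    D.ae_gArea_iff.2 (ae_restrict_mem D.isClosed_M.measurableSet)
  have h2 : ∀ᵐ θ ∂volume.restrict (Ioc 0 (2 * Real.pi)), θ ∈ Ioc 0 (2 * Real.pi) :=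
    ae_restrict_mem measurableSet_Ioc
  exact (Measure.quasiMeasurePreserving_fst.ae h1).and (Measure.quasiMeasurePreserving_snd.ae h2)

/-- The Euclidean speed of the boundary curve divided by `c`. -/
theorem measurable_arclengthDensity : Measurable fun s =>
    ENNReal.ofReal √(D.g (D.bdry s) (deriv D.bdry s) (deriv D.bdry s)) := by
  have h1 : Continuous (deriv D.bdry) := D.bdry_smooth.continuous_deriv (by simp)
  have h2 := D.bdry_smooth.continuous
  have h3 := D.c_smooth.continuous
  refine (Measurable.sqrt (Measurable.mul ?_ ?_)).ennreal_ofReal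
  · exact ((h3.comp h2).measurable.pow_const 2).inv
  · exact (h1.inner h1).measurable

theorem sqrt_g (s : ℝ) : √(D.g (D.bdry s) (deriv D.bdry s) (deriv D.bdry s)) =
    (D.c (D.bdry s))⁻¹ * ‖deriv D.bdry s‖ := by
  have hc := D.c_pos_of_mem (D.bd_subset (D.bdry_mem s))
  rw [g, real_inner_self_eq_norm_sq, Real.sqrt_mul (by positivity), Real.sqrt_inv,
    Real.sqrt_sq hc.le, Real.sqrt_sq (norm_nonneg _)]

theorem continuous_arclengthDensity :
    Continuous fun s => (D.c (D.bdry s))⁻¹ * ‖deriv D.bdry s‖ := by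
  have h1 : Continuous (deriv D.bdry) := D.bdry_smooth.continuous_deriv (by simp)
  exact ((D.c_smooth.continuous.comp D.bdry_smooth.continuous).inv₀ fun s =>
    (D.c_pos_of_mem (D.bd_subset (D.bdry_mem s))).ne').mul h1.norm

instance : IsFiniteMeasure D.arclength := by
  have : IsFiniteMeasure ((volume.restrict (Ioc (0 : ℝ) 1)).withDensity fun s =>
      ENNReal.ofReal √(D.g (D.bdry s) (deriv D.bdry s) (deriv D.bdry s))) := by
    simp only [sqrt_g]
    refine isFiniteMeasure_withDensity_ofReal ?_
    exact ((D.continuous_arclengthDensity.continuousOn.integrableOn_compact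
      (isCompact_Icc (a := (0 : ℝ)) (b := 1))).mono_set Ioc_subset_Icc_self).2
  unfold arclength
  infer_instance

instance : IsFiniteMeasure D.bdMeasure := by unfold bdMeasure; infer_instance

theorem ae_bdMeasure_mem : ∀ᵐ p ∂D.bdMeasure, p.1 ∈ D.bd ∧ p.2 ∈ Ioc 0 (2 * Real.pi) := by
  have h1 : ∀ᵐ x ∂D.arclength, x ∈ D.bd := by
    exact (ae_map_iff D.bdry_smooth.continuous.aemeasurable D.isClosed_bd.measurableSet).2
      (ae_of_all _ D.bdry_mem)
  have h2 : ∀ᵐ θ ∂volume.restrict (Ioc 0 (2 * Real.pi)), θ ∈ Ioc 0 (2 * Real.pi) :=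
    ae_restrict_mem measurableSet_Ioc
  exact (Measure.quasiMeasurePreserving_fst.ae h1).and (Measure.quasiMeasurePreserving_snd.ae h2)

variable {D}

theorem exists_ae_norm_le {G : Type*} [NormedAddCommGroup G] {f : Phase → G} (hf : Continuous f) :
    ∃ B, (∀ᵐ p ∂D.liouville, ‖f p‖ ≤ B) ∧ ∀ᵐ p ∂D.bdMeasure, ‖f p‖ ≤ B := by
  obtain ⟨B, hB⟩ := (D.isCompact_M.prod (isCompact_Icc (a := (0 : ℝ))
    (b := 2 * Real.pi))).exists_bound_of_continuousOn hf.continuousOn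
  refine ⟨B, ?_, ?_⟩
  · filter_upwards [D.ae_liouville_mem] with p hp using hB p ⟨hp.1, Ioc_subset_Icc_self hp.2⟩
  · filter_upwards [D.ae_bdMeasure_mem] with p hp using
      hB p ⟨D.bd_subset hp.1, Ioc_subset_Icc_self hp.2⟩

theorem memLp_liouville {G : Type*} [NormedAddCommGroup G] [SecondCountableTopology G]
    {f : Phase → G} (hf : Continuous f) (q : ℝ≥0∞) : MemLp f q D.liouville := by
  obtain ⟨B, hB, -⟩ := exists_ae_norm_le (D := D) hf
  exact MemLp.of_bound hf.aestronglyMeasurable B hB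

theorem memLp_bdMeasure {G : Type*} [NormedAddCommGroup G] [SecondCountableTopology G]
    {f : Phase → G} (hf : Continuous f) (q : ℝ≥0∞) : MemLp f q D.bdMeasure := by
  obtain ⟨B, -, hB⟩ := exists_ae_norm_le (D := D) hf
  exact MemLp.of_bound hf.aestronglyMeasurable B hB

theorem integrable_liouville {f : Phase → ℂ} (hf : Continuous f) : Integrable f D.liouville :=
  memLp_one_iff_integrable.1 (memLp_liouville hf 1)

theorem integral_liouville {f : Phase → ℂ} (hf : Continuous f) :
    ∫ p, f p ∂D.liouville =
      ∫ x in D.M, ∫ θ in Ioc 0 (2 * Real.pi), ((D.c x ^ 2)⁻¹) • f (x, θ) := by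
  have h := integrable_liouville (D := D) hf
  rw [liouville] at h ⊢
  rw [integral_prod f h, integral_withDensity_eq_integral_toReal_smul D.measurable_density
    (ae_of_all _ fun _ => ENNReal.ofReal_lt_top)]
  refine integral_congr_ae (ae_of_all _ fun x => ?_)
  simp only
  rw [integral_smul, ENNReal.toReal_ofReal (by positivity)]

theorem integral_bdMeasure {f : Phase → ℂ} (hf : Integrable f D.bdMeasure) :
    ∫ p, f p ∂D.bdMeasure = ∫ s in Ioc (0 : ℝ) 1, ((D.c (D.bdry s))⁻¹ * ‖deriv D.bdry s‖) •
      ∫ θ in Ioc 0 (2 * Real.pi), f (D.bdry s, θ) := by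
  have hae : AEStronglyMeasurable (fun x => ∫ θ in Ioc 0 (2 * Real.pi), f (x, θ)) D.arclength :=
    hf.1.integral_prod_right'
  rw [bdMeasure] at hf ⊢
  rw [integral_prod f hf, arclength, integral_map D.bdry_smooth.continuous.aemeasurable hae,
    integral_withDensity_eq_integral_toReal_smul D.measurable_arclengthDensity
    (ae_of_all _ fun _ => ENNReal.ofReal_lt_top)]
  refine integral_congr_ae (ae_of_all _ fun s => ?_)
  simp only [sqrt_g]
  rw [ENNReal.toReal_ofReal]
  have := D.c_pos_of_mem (D.bd_subset (D.bdry_mem s))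
  positivity

variable (D) in
/-- A smooth function on the plane that coincides with `c⁻¹` near `M`. -/
theorem exists_smooth_inv_c :
    ∃ κ : Plane → ℝ, ContDiff ℝ ∞ κ ∧ ∀ x ∈ D.M, κ =ᶠ[𝓝 x] fun x => (D.c x)⁻¹ := by
  obtain ⟨x₀, hx₀, hmin⟩ := D.isCompact_M.exists_isMinOn ⟨D.bdry 0, D.bd_subset (D.bdry_mem 0)⟩
    D.c_smooth.continuous.continuousOn
  have hpos := D.c_pos_of_mem hx₀
  set δ := D.c x₀ / 2
  have hδ : 0 < δ := by positivity
  have hopen : IsOpen {x | δ < D.c x} := isOpen_lt continuous_const D.c_smooth.continuous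
  obtain ⟨ζ, h1, h0, -⟩ := exists_contMDiffMap_one_nhds_of_subset_interior (n := (⊤ : ℕ∞))
    (modelWithCornersSelf ℝ Plane) D.isClosed_M (t := {x | δ < D.c x}) (by
      rw [hopen.interior_eq]
      intro x hx
      have : D.c x₀ ≤ D.c x := hmin hx
      simp only [mem_ofPred_eq]
      linarith [show D.c x₀ = 2 * δ by simp only [δ]; ring])
  have hζ : ContDiff ℝ ∞ ζ := ζ.contMDiff.contDiff
  refine ⟨fun x => ζ x * (D.c x)⁻¹, contDiff_iff_contDiffAt.2 fun x => ?_, fun x hx => ?_⟩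
  -- Off `M` the function `c` may vanish, but `ζ` is zero wherever `c ≤ δ`, hence near such a point.
  · by_cases hx : D.c x = 0
    · have hev : ∀ᶠ y in 𝓝 x, D.c y < δ :=
        (D.c_smooth.continuous.tendsto x).eventually (gt_mem_nhds (by rw [hx]; exact hδ))
      refine (contDiffAt_const (c := (0 : ℝ))).congr_of_eventuallyEq ?_
      filter_upwards [hev] with y hy
      rw [h0 y (by simpa using hy.le), zero_mul]
    · exact hζ.contDiffAt.mul (D.c_smooth.contDiffAt.inv hx)
  · filter_upwards [(eventually_nhdsSet_iff_forall.1 h1) x hx] with y hy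
    rw [hy, one_mul]

variable (D) in
theorem measurable_mu : Measurable D.mu := by
  have h1 : Measurable (gradient D.ρ) := D.contDiff_gradient.continuous.measurable
  have h2 : Measurable D.c := D.c_smooth.continuous.measurable
  have h3 : Measurable D.normal :=
    (((h2.pow_const 2).inv.mul (h1.inner h1)).sqrt.inv).smul h1
  exact ((h2.comp measurable_fst).pow_const 2).inv.mul
    ((h3.comp measurable_fst).inner D.contDiff_unitVec.continuous.measurable)

theorem abs_mu_le_one {p : Phase} (hp : p.1 ∈ D.bd) : |D.mu p| ≤ 1 := by
  have h := D.gradient_ne_zero hp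
  rw [D.mu_eq hp, ← inner_gradient, abs_mul, abs_inv, abs_norm, inv_mul_le_iff₀ h]
  simpa [norm_dir] using abs_real_inner_le_norm (gradient D.ρ p.1) (dir p.2)

/-- The rate of turning of geodesics. -/
theorem hasDerivAt_field_snd (x : Plane) (θ : ℝ) :
    HasDerivAt (fun θ => (D.field (x, θ)).2) (fderiv ℝ D.c x (dir θ)) θ := by
  have h := ((Real.hasDerivAt_cos θ).const_mul (-(fderiv ℝ D.c x !₂[0, 1]))).add
    ((Real.hasDerivAt_sin θ).const_mul (fderiv ℝ D.c x !₂[1, 0]))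
  refine h.congr_deriv ?_
  rw [Plane.clm_apply _ (dir θ)]
  simp [dir]
  ring

/-- **Green's formula** on the unit tangent bundle: `∫ X ψ dΣ³ = ∫ μ ψ dΣ²`. -/
theorem integral_X {ψ : Phase → ℂ} (hψ : ContDiff ℝ 1 ψ) (hper : Function.Periodic ψ turn) :
    ∫ p, D.X ψ p ∂D.liouville = ∫ p, D.mu p • ψ p ∂D.bdMeasure := by
  obtain ⟨κ, hκ, hκc⟩ := D.exists_smooth_inv_c
  have hψ1 : Continuous (fderiv ℝ ψ) := hψ.continuous_fderiv (by simp)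
  have hXc : Continuous (D.X ψ) := hψ1.clm_apply D.contDiff_field.continuous
  have hdir : Continuous dir := (contDiff_dir (n := 0)).continuous
  set b : Phase → ℝ := fun p => (D.field p).2 with hb
  have hbc : Continuous b := continuous_snd.comp D.contDiff_field.continuous
  have hκ1 : Continuous (fderiv ℝ κ) := hκ.continuous_fderiv (by simp)
  have hc1 : Continuous (fderiv ℝ D.c) := D.c_smooth.continuous_fderiv (by simp)
  -- the horizontal and the vertical part
  set A : Phase → ℂ := fun p => κ p.1 • fderiv ℝ ψ p (dir p.2, 0) +
    fderiv ℝ κ p.1 (dir p.2) • ψ p with hA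
  set V : Phase → ℂ := fun p => b p • fderiv ℝ ψ p (0, 1) +
    fderiv ℝ D.c p.1 (dir p.2) • ψ p with hV
  have hAc : Continuous A := by
    refine Continuous.add (Continuous.smul (hκ.continuous.comp continuous_fst) ?_)
      (Continuous.fun_smul ?_ hψ.continuous)
    · exact hψ1.clm_apply ((hdir.comp continuous_snd).prodMk continuous_const)
    · exact (hκ1.comp continuous_fst).clm_apply (hdir.comp continuous_snd)
  have hVc : Continuous V := by
    refine Continuous.add (hbc.smul (hψ1.clm_apply continuous_const))
      (Continuous.fun_smul ?_ hψ.continuous)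
    exact (hc1.comp continuous_fst).clm_apply (hdir.comp continuous_snd)
  have hκM : ∀ x ∈ D.M, κ x = (D.c x)⁻¹ := fun x hx => (hκc x hx).self_of_nhds
  have hκd : ∀ x ∈ D.M, fderiv ℝ κ x = -(D.c x ^ 2)⁻¹ • fderiv ℝ D.c x := fun x hx => by
    have hne := (D.c_pos_of_mem hx).ne'
    rw [(hκc x hx).fderiv_eq]
    have h := (hasDerivAt_inv hne).hasFDerivAt.comp x
      (D.c_smooth.differentiable (by simp) x).hasFDerivAt
    have h' : HasFDerivAt (fun x => (D.c x)⁻¹) _ x := h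
    rw [h'.fderiv]
    ext1 v
    simp [mul_comm]
  -- With the density `c⁻²`, the derivative along the field is a total divergence: `A` is the
  -- divergence in `x` of `c⁻¹ ψ dir`, and `V` is the `θ`-derivative of `b ψ`. The terms of order
  -- zero cancel, which is the invariance of the Liouville measure.
  have hsplit : ∀ x ∈ D.M, ∀ θ, (D.c x ^ 2)⁻¹ • D.X ψ (x, θ) =
      A (x, θ) + (D.c x ^ 2)⁻¹ • V (x, θ) := by
    intro x hx θ
    have hne := (D.c_pos_of_mem hx).ne'
    have h1 : D.X ψ (x, θ) = D.c x • fderiv ℝ ψ (x, θ) (dir θ, 0) +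
        b (x, θ) • fderiv ℝ ψ (x, θ) (0, 1) := by
      rw [X, ← map_smul, ← map_smul, ← map_add]
      congr 1
      ext1
      · simp [field]
      · simp [hb]
    rw [h1]
    simp only [hA, hV, hκM x hx, hκd x hx]
    simp
    field_simp
    ring
  -- The integral over one period of the derivative of a periodic function.
  have hvert : ∀ x, ∫ θ in Ioc 0 (2 * Real.pi), V (x, θ) = 0 := by
    intro x
    rw [← intervalIntegral.integral_of_le Real.two_pi_pos.le]
    have hd : ∀ θ, HasDerivAt (fun θ => b (x, θ) • ψ (x, θ)) (V (x, θ)) θ := by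
      intro θ
      have h1 : HasDerivAt (fun θ : ℝ => ((x, θ) : Phase)) (0, 1) θ :=
        (hasDerivAt_const θ x).prodMk (hasDerivAt_id θ)
      have h2 := (hψ.differentiable (by simp) (x, θ)).hasFDerivAt.comp_hasDerivAt θ h1
      exact (D.hasDerivAt_field_snd x θ).smul h2
    rw [intervalIntegral.integral_eq_sub_of_hasDerivAt (fun θ _ => hd θ)
      ((hVc.comp (continuous_const.prodMk continuous_id)).intervalIntegrable _ _)]
    have h1 := hper (x, 0)
    have h2 := D.field_add_two_pi (x, 0)
    simp at h1 h2
    simp only [hb, h1, h2, sub_self]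
  have hfubini : ∫ p, D.X ψ p ∂D.liouville = ∫ x in D.M, ∫ θ in Ioc 0 (2 * Real.pi), A (x, θ) := by
    rw [integral_liouville hXc]
    refine setIntegral_congr_fun D.isClosed_M.measurableSet fun x hx => ?_
    simp only [hsplit x hx]
    have i1 : IntegrableOn (fun θ => A (x, θ)) (Ioc 0 (2 * Real.pi)) :=
      ((hAc.comp (continuous_const.prodMk continuous_id)).integrableOn_Icc).mono_set
        Ioc_subset_Icc_self
    have i2 : IntegrableOn (fun θ => V (x, θ)) (Ioc 0 (2 * Real.pi)) :=
      ((hVc.comp (continuous_const.prodMk continuous_id)).integrableOn_Icc).mono_set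
        Ioc_subset_Icc_self
    rw [integral_add i1 (by exact i2.smul (D.c x ^ 2)⁻¹), integral_smul, hvert, smul_zero,
      add_zero]
  have hswap : ∫ x in D.M, ∫ θ in Ioc 0 (2 * Real.pi), A (x, θ) =
      ∫ θ in Ioc 0 (2 * Real.pi), ∫ x in D.M, A (x, θ) := by
    refine integral_integral_swap (f := fun x θ => A (x, θ)) ?_
    rw [Measure.prod_restrict]
    exact ((hAc.continuousOn).integrableOn_compact (D.isCompact_M.prod isCompact_Icc)).mono_set
      (prod_mono_right Ioc_subset_Icc_self)
  have hdiv : ∀ θ, ∫ x in D.M, A (x, θ) =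
      ∫ s in Ioc (0 : ℝ) 1, D.flux (dir θ) s • (κ (D.bdry s) • ψ (D.bdry s, θ)) := by
    intro θ
    have hcd : ContDiff ℝ 1 fun x => κ x • ψ (x, θ) :=
      (hκ.of_le (by simp)).smul (hψ.comp (contDiff_id.prodMk contDiff_const))
    rw [← D.integral_fderiv_M hcd (dir θ)]
    refine integral_congr_ae (ae_of_all _ fun x => ?_)
    have h1 : HasFDerivAt (fun x : Plane => ((x, θ) : Phase))
        (ContinuousLinearMap.inl ℝ Plane ℝ) x := hasFDerivAt_prodMk_left x θ
    have h2 := (hψ.differentiable (by simp) (x, θ)).hasFDerivAt.comp x h1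
    have h3 := (hκ.differentiable (by simp) x).hasFDerivAt.smul h2
    have h4 : HasFDerivAt (fun x => κ x • ψ (x, θ)) _ x := h3
    simp only [h4.fderiv, hA]
    simp
  have hbdi : Integrable (fun p => D.mu p • ψ p) D.bdMeasure := by
    obtain ⟨B, -, hB⟩ := exists_ae_norm_le (D := D) hψ.continuous
    refine Integrable.of_bound
      (D.measurable_mu.aestronglyMeasurable.smul hψ.continuous.aestronglyMeasurable) B ?_
    filter_upwards [hB, D.ae_bdMeasure_mem] with p h1 h2
    rw [norm_smul, Real.norm_eq_abs]
    exact (mul_le_of_le_one_left (norm_nonneg _) (abs_mu_le_one h2.1)).trans h1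
  rw [hfubini, hswap, integral_bdMeasure hbdi]
  simp only [hdiv, ← integral_smul]
  rw [integral_integral_swap (f := fun θ s => D.flux (dir θ) s • (κ (D.bdry s) • ψ (D.bdry s, θ)))]
  · refine integral_congr_ae (ae_of_all _ fun s => integral_congr_ae (ae_of_all _ fun θ => ?_))
    have hM := D.bd_subset (D.bdry_mem s)
    simp only [hκM _ hM, D.mu_eq (p := (D.bdry s, θ)) (D.bdry_mem s), flux, smul_smul, conormal]
    congr 1
    ring
  · rw [Measure.prod_restrict]
    have hd1 : Continuous (deriv D.bdry) := D.bdry_smooth.continuous_deriv (by simp)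
    have hd2 := D.bdry_smooth.continuous
    have hd3 : Continuous D.conormal := D.contDiff_conormal.continuous
    have hρ1 : Continuous (fderiv ℝ D.ρ) := D.ρ_smooth.continuous_fderiv (by simp)
    have hc : Continuous fun z : ℝ × ℝ =>
        D.flux (dir z.1) z.2 • (κ (D.bdry z.2) • ψ (D.bdry z.2, z.1)) := by
      refine Continuous.fun_smul (Continuous.fun_mul (Continuous.fun_mul ?_ ?_) ?_)
        (Continuous.fun_smul ?_ ?_)
      · exact (hd1.comp continuous_snd).norm
      · exact ((hd3.comp continuous_snd).norm).inv₀ fun z => (norm_pos_iff.2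
          (D.conormal_ne_zero z.2)).ne'
      · exact (hρ1.comp (hd2.comp continuous_snd)).clm_apply (hdir.comp continuous_fst)
      · exact hκ.continuous.comp (hd2.comp continuous_snd)
      · exact hψ.continuous.comp ((hd2.comp continuous_snd).prodMk continuous_fst)
    exact (hc.continuousOn.integrableOn_compact (isCompact_Icc.prod isCompact_Icc)).mono_set
      (prod_mono Ioc_subset_Icc_self Ioc_subset_Icc_self)

end ConformalDomain

/-! ### Smooth functions: accretivity and the local trace inequality -/

namespace ConformalDomain

variable {D : ConformalDomain}

namespace IsSmooth

variable {φ ψ : Phase → ℂ}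

theorem contDiff_one (hφ : IsSmooth φ) : ContDiff ℝ 1 φ := hφ.1.of_le (by simp)

theorem continuous (hφ : IsSmooth φ) : Continuous φ := hφ.1.continuous

theorem differentiableAt (hφ : IsSmooth φ) (p : Phase) : DifferentiableAt ℝ φ p :=
  hφ.1.differentiable (by simp) p

theorem periodic (hφ : IsSmooth φ) : Function.Periodic φ turn := fun p => by
  have h := hφ.2 p.1 p.2
  rwa [show ((p.1, p.2 + 2 * Real.pi) : Phase) = p + turn by ext1 <;> simp] at h

theorem of_periodic (h : ContDiff ℝ ∞ φ) (hper : Function.Periodic φ turn) : IsSmooth φ :=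
  ⟨h, fun x θ => by simpa using hper (x, θ)⟩

theorem zero : IsSmooth fun _ => 0 := ⟨contDiff_const, fun _ _ => rfl⟩

theorem add (hφ : IsSmooth φ) (hψ : IsSmooth ψ) : IsSmooth fun p => φ p + ψ p :=
  ⟨hφ.1.add hψ.1, fun x θ => by simp only [hφ.2, hψ.2]⟩

theorem sub (hφ : IsSmooth φ) (hψ : IsSmooth ψ) : IsSmooth fun p => φ p - ψ p :=
  ⟨hφ.1.sub hψ.1, fun x θ => by simp only [hφ.2, hψ.2]⟩

theorem mul (hφ : IsSmooth φ) (hψ : IsSmooth ψ) : IsSmooth fun p => φ p * ψ p :=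
  ⟨hφ.1.mul hψ.1, fun x θ => by simp only [hφ.2, hψ.2]⟩

theorem const_mul (c : ℂ) (hφ : IsSmooth φ) : IsSmooth fun p => c * φ p :=
  ⟨contDiff_const.mul hφ.1, fun x θ => by simp only [hφ.2]⟩

theorem conj (hφ : IsSmooth φ) : IsSmooth fun p => starRingEnd ℂ (φ p) :=
  ⟨Complex.conjCLE.contDiff.comp hφ.1, fun x θ => by simp only [hφ.2]⟩

theorem ofReal {g : Phase → ℝ} (hg : ContDiff ℝ ∞ g) (hper : Function.Periodic g turn) :
    IsSmooth fun p => (g p : ℂ) :=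
  of_periodic (Complex.ofRealCLM.contDiff.comp hg) fun p => by rw [hper p]

theorem comp_add_pi (hφ : IsSmooth φ) : IsSmooth fun p => φ (p + (0, Real.pi)) :=
  of_periodic (hφ.1.comp (contDiff_id.add contDiff_const)) fun p => by
    rw [add_right_comm]; exact hφ.periodic _

theorem continuous_X (hφ : IsSmooth φ) : Continuous (D.X φ) :=
  (hφ.contDiff_one.continuous_fderiv (by simp)).clm_apply D.contDiff_field.continuous

end IsSmooth

section Calculus

variable {φ ψ : Phase → ℂ} {p : Phase}

theorem X_add (hφ : DifferentiableAt ℝ φ p) (hψ : DifferentiableAt ℝ ψ p) :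
    D.X (fun p => φ p + ψ p) p = D.X φ p + D.X ψ p := by
  simp [X, fderiv_fun_add hφ hψ]

theorem X_sub (hφ : DifferentiableAt ℝ φ p) (hψ : DifferentiableAt ℝ ψ p) :
    D.X (fun p => φ p - ψ p) p = D.X φ p - D.X ψ p := by
  simp [X, fderiv_fun_sub hφ hψ]

theorem X_mul (hφ : DifferentiableAt ℝ φ p) (hψ : DifferentiableAt ℝ ψ p) :
    D.X (fun p => φ p * ψ p) p = D.X φ p * ψ p + φ p * D.X ψ p := by
  simp [X, fderiv_fun_mul hφ hψ]; ring

theorem X_const_mul (c : ℂ) (hφ : DifferentiableAt ℝ φ p) :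
    D.X (fun p => c * φ p) p = c * D.X φ p := by
  simp [X, fderiv_const_mul hφ]

theorem X_zero : D.X (fun _ => 0) p = 0 := by simp [X]

theorem X_conj (hφ : DifferentiableAt ℝ φ p) :
    D.X (fun p => starRingEnd ℂ (φ p)) p = starRingEnd ℂ (D.X φ p) := by
  have h := (Complex.conjCLE.toContinuousLinearMap.hasFDerivAt.comp p hφ.hasFDerivAt)
  have h' : HasFDerivAt (fun p => starRingEnd ℂ (φ p)) _ p := h
  rw [X, h'.fderiv]
  rfl

theorem X_ofReal {g : Phase → ℝ} (hg : DifferentiableAt ℝ g p) :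
    D.X (fun p => (g p : ℂ)) p = (fderiv ℝ g p (D.field p) : ℝ) := by
  have h := (Complex.ofRealCLM.hasFDerivAt.comp p hg.hasFDerivAt)
  have h' : HasFDerivAt (fun p => (g p : ℂ)) _ p := h
  rw [X, h'.fderiv]
  rfl

theorem X_comp_add_pi : D.X (fun p => φ (p + (0, Real.pi))) p = -D.X φ (p + (0, Real.pi)) := by
  rw [X, fderiv_comp_add_right, X, field_add_pi, map_neg, neg_neg]

end Calculus

/-- Integration by parts. -/
theorem integral_X_mul {φ ψ : Phase → ℂ} (hφ : IsSmooth φ) (hψ : IsSmooth ψ) :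
    ∫ p, (D.X φ p * ψ p + φ p * D.X ψ p) ∂D.liouville =
      ∫ p, D.mu p • (φ p * ψ p) ∂D.bdMeasure := by
  rw [← integral_X (hφ.mul hψ).contDiff_one (hφ.mul hψ).periodic]
  exact integral_congr_ae (ae_of_all _ fun p =>
    (X_mul (hφ.differentiableAt p) (hψ.differentiableAt p)).symm)

theorem integrable_mu_smul {G : Type*} [NormedAddCommGroup G] [NormedSpace ℝ G]
    [SecondCountableTopology G] {ψ : Phase → G} (hψ : Continuous ψ) :
    Integrable (fun p => D.mu p • ψ p) D.bdMeasure := by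
  obtain ⟨B, -, hB⟩ := exists_ae_norm_le (D := D) hψ
  refine Integrable.of_bound
    (D.measurable_mu.aestronglyMeasurable.smul hψ.aestronglyMeasurable) B ?_
  filter_upwards [hB, D.ae_bdMeasure_mem] with p h1 h2
  rw [norm_smul, Real.norm_eq_abs]
  exact (mul_le_of_le_one_left (norm_nonneg _) (abs_mu_le_one h2.1)).trans h1

variable (D) in
/-- Smooth functions that vanish at the boundary points whose direction does not point
outward. -/
structure VanishesOnInflow (φ : Phase → ℂ) : Prop where
  smooth : IsSmooth φ
  eq_zero : ∀ p : Phase, p.1 ∈ D.bd → D.slope p ≤ 0 → φ p = 0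

namespace VanishesOnInflow

variable {φ ψ : Phase → ℂ}

theorem zero : D.VanishesOnInflow fun _ => 0 := ⟨.zero, fun _ _ _ => rfl⟩

theorem add (hφ : D.VanishesOnInflow φ) (hψ : D.VanishesOnInflow ψ) :
    D.VanishesOnInflow fun p => φ p + ψ p :=
  ⟨hφ.smooth.add hψ.smooth, fun p h1 h2 => by simp [hφ.eq_zero p h1 h2, hψ.eq_zero p h1 h2]⟩

theorem const_mul (c : ℂ) (hφ : D.VanishesOnInflow φ) : D.VanishesOnInflow fun p => c * φ p :=
  ⟨hφ.smooth.const_mul c, fun p h1 h2 => by simp [hφ.eq_zero p h1 h2]⟩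

/-- Green's formula for `|φ|²`: twice the left integral is the boundary integral of `μ |φ|²`, to
which only outgoing directions contribute. -/
theorem re_integral_nonneg (hφ : D.VanishesOnInflow φ) :
    0 ≤ ∫ p, (D.X φ p * starRingEnd ℂ (φ p)).re ∂D.liouville := by
  have h := integral_X_mul (D := D) hφ.smooth hφ.smooth.conj
  have e1 : ∀ p, D.X φ p * starRingEnd ℂ (φ p) + φ p * D.X (fun p => starRingEnd ℂ (φ p)) p =
      ((2 * (D.X φ p * starRingEnd ℂ (φ p)).re : ℝ) : ℂ) := fun p => by
    rw [X_conj (hφ.smooth.differentiableAt p)]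
    apply Complex.ext <;> simp <;> ring
  have e2 : ∀ p, D.mu p • (φ p * starRingEnd ℂ (φ p)) = ((D.mu p * ‖φ p‖ ^ 2 : ℝ) : ℂ) := fun p => by
    rw [Complex.mul_conj, Complex.normSq_eq_norm_sq]; simp
  simp only [e1, e2] at h
  rw [integral_complex_ofReal, integral_complex_ofReal, Complex.ofReal_inj, integral_const_mul] at h
  have h0 : 0 ≤ ∫ p, D.mu p * ‖φ p‖ ^ 2 ∂D.bdMeasure := by
    refine integral_nonneg_of_ae ?_
    filter_upwards [D.ae_bdMeasure_mem] with p hp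
    rcases le_or_gt (D.slope p) 0 with hs | hs
    · simp [hφ.eq_zero p hp.1 hs]
    · exact mul_nonneg ((D.slope_pos_iff hp.1).1 hs).le (sq_nonneg _)
  linarith

end VanishesOnInflow

/-- The trace inequality on a compact subset of the outgoing boundary. -/
theorem exists_integral_norm_sq_le {K : Set Phase} (hK : IsCompact K) (hKout : K ⊆ D.outflow) :
    ∃ C : ℝ, ∀ φ : Phase → ℂ, IsSmooth φ → ∫ p in K, ‖φ p‖ ^ 2 ∂D.bdMeasure ≤
      C * ∫ p, (‖φ p‖ ^ 2 + ‖D.X φ p‖ ^ 2) ∂D.liouville := by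
  have hsl := D.contDiff_slope.continuous
  obtain ⟨η, hη, hηK⟩ : ∃ η > 0, ∀ p ∈ K, η ≤ D.slope p := by
    rcases K.eq_empty_or_nonempty with rfl | hne
    · exact ⟨1, one_pos, by simp⟩
    · obtain ⟨q, hq, hmin⟩ := hK.exists_isMinOn hne hsl.continuousOn
      exact ⟨_, (D.mem_outflow_iff.1 (hKout hq)).2, fun p hp => hmin hp⟩
  have hgr : Continuous fun p : Phase => D.c p.1 * ‖gradient D.ρ p.1‖ :=
    (D.c_smooth.continuous.comp continuous_fst).mul
      ((D.contDiff_gradient.continuous.comp continuous_fst).norm)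
  obtain ⟨N, hN⟩ := hK.exists_bound_of_continuousOn hgr.continuousOn
  -- A cutoff that is one on `K` and zero at all boundary points that are not outgoing. Green's
  -- formula for `g |φ|²` then has a nonnegative boundary integrand.
  set g : Phase → ℝ := fun p => Real.smoothTransition (D.slope p / η) with hg
  have hgs : ContDiff ℝ ∞ g := Real.smoothTransition.contDiff.comp (D.contDiff_slope.div_const η)
  have hgper : Function.Periodic g turn := fun p => by simp only [hg, periodic_slope p]
  set g' : Phase → ℝ := fun p => fderiv ℝ g p (D.field p) with hg'
  have hg'c : Continuous g' :=
    (hgs.continuous_fderiv (by simp)).clm_apply D.contDiff_field.continuous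
  obtain ⟨B, hB, -⟩ := exists_ae_norm_le (D := D) hg'c
  -- On `K` one has `1 ≤ (|N| / η) μ`, and `X (g |φ|²)` is at most `(|B| + 1) (|φ|² + |Xφ|²)`.
  refine ⟨|N| / η * (|B| + 1), fun φ hφ => ?_⟩
  have hμη : ∀ p ∈ K, η ≤ |N| * D.mu p := fun p hp => by
    have h1 := hηK p hp
    rw [D.slope_eq (hKout hp).1] at h1
    refine h1.trans (mul_le_mul_of_nonneg_right ?_ (hKout hp).2.le)
    exact (le_abs_self _).trans ((hN p hp).trans (le_abs_self _))
  have hφc := hφ.continuous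
  have hψ := (IsSmooth.ofReal hgs hgper).mul (hφ.mul hφ.conj)
  have h := integral_X (D := D) hψ.contDiff_one hψ.periodic
  have e1 : ∀ p, D.X (fun p => (g p : ℂ) * (φ p * starRingEnd ℂ (φ p))) p =
      ((g' p * ‖φ p‖ ^ 2 + g p * (2 * (D.X φ p * starRingEnd ℂ (φ p)).re) : ℝ) : ℂ) := fun p => by
    rw [X_mul ((IsSmooth.ofReal hgs hgper).differentiableAt p)
      ((hφ.mul hφ.conj).differentiableAt p), X_mul (hφ.differentiableAt p)
      (hφ.conj.differentiableAt p), X_conj (hφ.differentiableAt p),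
      X_ofReal (hgs.differentiable (by simp) p), Complex.mul_conj, Complex.normSq_eq_norm_sq]
    apply Complex.ext <;> simp [hg'] <;> ring_nf <;> simp
  have e2 : ∀ p, D.mu p • ((g p : ℂ) * (φ p * starRingEnd ℂ (φ p))) =
      ((D.mu p * (g p * ‖φ p‖ ^ 2) : ℝ) : ℂ) := fun p => by
    rw [Complex.mul_conj, Complex.normSq_eq_norm_sq]; simp
  simp only [e1, e2] at h
  rw [integral_complex_ofReal, integral_complex_ofReal, Complex.ofReal_inj] at h
  have hc2 : Continuous fun p => g p * ‖φ p‖ ^ 2 := hgs.continuous.mul (hφc.norm.pow 2)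
  have hi2 : Integrable (fun p => D.mu p * (g p * ‖φ p‖ ^ 2)) D.bdMeasure :=
    integrable_mu_smul hc2
  have hpos : 0 ≤ᵐ[D.bdMeasure] fun p => D.mu p * (g p * ‖φ p‖ ^ 2) := by
    filter_upwards [D.ae_bdMeasure_mem] with p hp
    rcases le_or_gt (D.slope p) 0 with hs | hs
    · have : g p = 0 := Real.smoothTransition.zero_of_nonpos (div_nonpos_of_nonpos_of_nonneg hs hη.le)
      simp [this]
    · exact mul_nonneg ((D.slope_pos_iff hp.1).1 hs).le
        (mul_nonneg (Real.smoothTransition.nonneg _) (sq_nonneg _))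
  have hKm : MeasurableSet K := hK.isClosed.measurableSet
  have s1 : ∫ p in K, ‖φ p‖ ^ 2 ∂D.bdMeasure ≤
      ∫ p in K, |N| / η * (D.mu p * (g p * ‖φ p‖ ^ 2)) ∂D.bdMeasure := by
    refine setIntegral_mono_on ?_ (hi2.const_mul _).integrableOn hKm fun p hp => ?_
    · exact (memLp_one_iff_integrable.1 (memLp_bdMeasure (hφc.norm.pow 2) 1)).integrableOn
    · have h1 : g p = 1 := Real.smoothTransition.one_of_one_le
        ((one_le_div hη).2 (hηK p hp))
      have h2 : 1 ≤ |N| / η * D.mu p := by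
        rw [div_mul_eq_mul_div, one_le_div hη]; exact hμη p hp
      rw [h1, one_mul, ← mul_assoc]
      exact le_mul_of_one_le_left (sq_nonneg _) h2
  have s2 : ∫ p in K, D.mu p * (g p * ‖φ p‖ ^ 2) ∂D.bdMeasure ≤
      ∫ p, D.mu p * (g p * ‖φ p‖ ^ 2) ∂D.bdMeasure :=
    setIntegral_le_integral hi2 hpos
  have hXc := hφ.continuous_X (D := D)
  have hi4 : Integrable (fun p => ‖φ p‖ ^ 2 + ‖D.X φ p‖ ^ 2) D.liouville :=
    memLp_one_iff_integrable.1 (memLp_liouville ((hφc.norm.pow 2).add (hXc.norm.pow 2)) 1)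
  have s3 : ∫ p, (g' p * ‖φ p‖ ^ 2 + g p * (2 * (D.X φ p * starRingEnd ℂ (φ p)).re)) ∂D.liouville ≤
      ∫ p, (|B| + 1) * (‖φ p‖ ^ 2 + ‖D.X φ p‖ ^ 2) ∂D.liouville := by
    refine integral_mono_ae ?_ (hi4.const_mul _) ?_
    · refine memLp_one_iff_integrable.1 (memLp_liouville ?_ 1)
      exact (hg'c.mul (hφc.norm.pow 2)).add (hgs.continuous.mul (continuous_const.mul
        (Complex.continuous_re.comp (hXc.mul (Complex.continuous_conj.comp hφc)))))
    · filter_upwards [hB] with p hp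
      have h1 : |(D.X φ p * starRingEnd ℂ (φ p)).re| ≤ ‖D.X φ p‖ * ‖φ p‖ := by
        refine (Complex.abs_re_le_norm _).trans ?_
        rw [norm_mul, RCLike.norm_conj]
      have h2 : g p ≤ 1 := Real.smoothTransition.le_one _
      have h3 : 0 ≤ g p := Real.smoothTransition.nonneg _
      have h4 : g' p ≤ |B| := (le_abs_self _).trans ((Real.norm_eq_abs _ ▸ hp).trans (le_abs_self _))
      have h5 : g p * (2 * (D.X φ p * starRingEnd ℂ (φ p)).re) ≤ ‖φ p‖ ^ 2 + ‖D.X φ p‖ ^ 2 := by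
        have h6 : 2 * (D.X φ p * starRingEnd ℂ (φ p)).re ≤ ‖φ p‖ ^ 2 + ‖D.X φ p‖ ^ 2 := by
          nlinarith [le_abs_self (D.X φ p * starRingEnd ℂ (φ p)).re,
            sq_nonneg (‖φ p‖ - ‖D.X φ p‖)]
        exact (mul_le_mul_of_nonneg_left h6 h3).trans (mul_le_of_le_one_left (by positivity) h2)
      have h7 : g' p * ‖φ p‖ ^ 2 ≤ |B| * ‖φ p‖ ^ 2 := by gcongr
      have h8 : 0 ≤ |B| * ‖D.X φ p‖ ^ 2 := by positivity
      linarith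
  rw [integral_const_mul] at s1 s3
  calc _ ≤ _ := s1
    _ ≤ |N| / η * ∫ p, D.mu p * (g p * ‖φ p‖ ^ 2) ∂D.bdMeasure := by gcongr
    _ ≤ |N| / η * ((|B| + 1) * ∫ p, (‖φ p‖ ^ 2 + ‖D.X φ p‖ ^ 2) ∂D.liouville) := by
      rw [← h]; gcongr
    _ = _ := by ring

end ConformalDomain

/-! ### The outgoing trace estimate -/

theorem sq_intervalIntegral_le {g : ℝ → ℝ} (hg : Continuous g) {T : ℝ} (hT : 0 < T) :
    (∫ s in (0 : ℝ)..T, g s) ^ 2 ≤ T * ∫ s in (0 : ℝ)..T, g s ^ 2 := by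
  set m := (∫ s in (0 : ℝ)..T, g s) / T with hm
  have hmT : ∫ s in (0 : ℝ)..T, g s = m * T := by rw [hm]; field_simp
  -- Cauchy–Schwarz against the constant function, as nonnegativity of a variance.
  have h0 : 0 ≤ ∫ s in (0 : ℝ)..T, (g s - m) ^ 2 :=
    intervalIntegral.integral_nonneg hT.le fun s _ => sq_nonneg _
  have h1 : ∫ s in (0 : ℝ)..T, (g s - m) ^ 2 =
      (∫ s in (0 : ℝ)..T, g s ^ 2) - 2 * m * (m * T) + m ^ 2 * T := by
    have e : ∀ s, (g s - m) ^ 2 = g s ^ 2 - 2 * m * g s + m ^ 2 := fun s => by ring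
    simp only [e]
    have i1 : IntervalIntegrable (fun s => g s ^ 2) volume 0 T := (hg.pow 2).intervalIntegrable _ _
    have i2 : IntervalIntegrable (fun s => 2 * m * g s) volume 0 T :=
      (hg.intervalIntegrable _ _).const_mul _
    rw [intervalIntegral.integral_add (i1.sub i2) intervalIntegrable_const,
      intervalIntegral.integral_sub i1 i2, intervalIntegral.integral_const_mul, hmT,
      intervalIntegral.integral_const]
    simp [mul_comm]
  rw [hmT]
  nlinarith

theorem flowIntegral_add {E : Type*} [NormedAddCommGroup E] [NormedSpace ℝ E] {G : Type*}
    [NormedAddCommGroup G] [NormedSpace ℝ G] {Φ : ℝ → E → E} {f : E → G} {T : E}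
    (hΦ : ∀ t p, Φ t (p + T) = Φ t p + T) (hf : ∀ p, f (p + T) = f p) (l S : ℝ) (p : E) :
    flowIntegral Φ l S f (p + T) = flowIntegral Φ l S f p := by
  simp only [flowIntegral, hΦ, hf]

namespace ConformalDomain

variable {D : ConformalDomain}

theorem measurableSet_outflow : MeasurableSet D.outflow :=
  (D.isClosed_bd.measurableSet.preimage measurable_fst).inter
    (measurableSet_lt measurable_const D.measurable_mu)

namespace FlowExtension

variable (E : D.FlowExtension)

theorem X_eq (φ : Phase → ℂ) {p : Phase} (hp : p.1 ∈ D.M) :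
    fderiv ℝ φ p (E.χ p.1 • D.field p) = D.X φ p := by
  rw [E.χ_eq_one _ hp, one_smul, X]

/-- Green's formula for integrals along the flow. -/
theorem integral_flowIntegralDeriv {f : Phase → ℂ} {L : ℝ≥0} (hf : LipschitzWith L f)
    (hper : Function.Periodic f turn) {l S : ℝ} (hl : 0 ≤ l) (hS : 0 ≤ S) :
    ∫ p, flowIntegralDeriv E.Φ l S f p ∂D.liouville =
      ∫ p, D.mu p • flowIntegral E.Φ l S f p ∂D.bdMeasure := by
  obtain ⟨L₁, h₁⟩ := lipschitzWith_flowIntegral E.isFlow E.lipschitz hf hl hS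
  obtain ⟨L₂, h₂⟩ := lipschitzWith_flowIntegralDeriv E.isFlow E.lipschitz hf hl hS
  obtain ⟨C, hC⟩ := flowIntegral_add_smul_sub_le E.isFlow E.lipschitz E.bound hf hl hS
  set N : ℝ := (L₁ * E.K + L₂) * D.liouville.real univ + L₁ * D.bdMeasure.real univ with hN
  have hN0 : 0 ≤ N := by positivity
  refine eq_of_forall_dist_le fun ε hε => ?_
  -- Green's formula is available for smooth functions only. Mollifying at scale `ε / (N + 1)`
  -- changes the two sides by at most `ε` in total.
  obtain ⟨φ, hφ, hφ1, hφ2, -, hφ4⟩ := exists_contDiff_approx_along E.lipschitz h₁ h₂ hC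
    (div_pos hε (by positivity : 0 < N + 1))
  set ε' := ε / (N + 1)
  have hφp : Function.Periodic φ turn :=
    hφ4 turn (flowIntegral_add E.Φ_add_turn hper l S)
  have hφs := IsSmooth.of_periodic hφ hφp
  have hG := integral_X (D := D) hφs.contDiff_one hφp
  have e1 : ‖∫ p, D.X φ p ∂D.liouville - ∫ p, flowIntegralDeriv E.Φ l S f p ∂D.liouville‖ ≤
      (L₁ * E.K + L₂) * ε' * D.liouville.real univ := by
    rw [← integral_sub (integrable_liouville hφs.continuous_X) (integrable_liouville h₂.continuous)]
    refine norm_integral_le_of_norm_le_const ?_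
    filter_upwards [D.ae_liouville_mem] with p hp
    rw [← E.X_eq φ hp.1]
    exact hφ2 p
  have e2 : ‖∫ p, D.mu p • φ p ∂D.bdMeasure -
      ∫ p, D.mu p • flowIntegral E.Φ l S f p ∂D.bdMeasure‖ ≤ L₁ * ε' * D.bdMeasure.real univ := by
    rw [← integral_sub (integrable_mu_smul hφs.continuous) (integrable_mu_smul h₁.continuous)]
    refine norm_integral_le_of_norm_le_const ?_
    filter_upwards [D.ae_bdMeasure_mem] with p hp
    rw [← smul_sub, norm_smul, Real.norm_eq_abs]
    exact (mul_le_of_le_one_left (norm_nonneg _) (abs_mu_le_one hp.1)).trans (hφ1 p)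
  rw [← hG] at e2
  rw [← dist_eq_norm] at e1 e2
  calc _ ≤ _ := dist_triangle_left _ _ (∫ p, D.X φ p ∂D.liouville)
    _ ≤ N * ε' := by rw [hN]; linarith
    _ ≤ (N + 1) * ε' := by gcongr; linarith
    _ = ε := by simp only [ε']; field_simp

/-- For a nonnegative function supported in the interior of `M`, the flux through the boundary of
its integral along the flow is at most its integral. -/
theorem integral_outflow_mu_flowIntegral_le {g : Phase → ℝ} {L : ℝ≥0} (hg : LipschitzWith L g)
    (hper : Function.Periodic g turn) (hg0 : ∀ p, 0 ≤ g p)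
    (hsupp : ∀ p : Phase, 0 ≤ D.ρ p.1 → g p = 0) {S : ℝ} (hS : 0 ≤ S) :
    ∫ p in D.outflow, D.mu p * flowIntegral E.Φ 0 S g p ∂D.bdMeasure ≤
      ∫ p, g p ∂D.liouville := by
  have hgC : LipschitzWith (1 * L) fun p => (g p : ℂ) :=
    (Complex.isometry_ofReal.lipschitz).comp hg
  have h := E.integral_flowIntegralDeriv hgC (fun p => by simp only [hper p]) le_rfl hS
  have e1 : ∀ p, flowIntegral E.Φ 0 S (fun p => (g p : ℂ)) p = (flowIntegral E.Φ 0 S g p : ℝ) := by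
    intro p
    rw [flowIntegral, flowIntegral, ← intervalIntegral.integral_ofReal]
    simp
  have e2 : ∀ p, flowIntegralDeriv E.Φ 0 S (fun p => (g p : ℂ)) p =
      ((g p - g (E.Φ (-S) p) : ℝ) : ℂ) := fun p => by
    simp [flowIntegralDeriv]
  have e3 : ∀ p, D.mu p • ((flowIntegral E.Φ 0 S g p : ℝ) : ℂ) =
      ((D.mu p * flowIntegral E.Φ 0 S g p : ℝ) : ℂ) := fun p => by simp
  simp only [e1, e2, e3] at h
  rw [integral_complex_ofReal, integral_complex_ofReal, Complex.ofReal_inj] at h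
  -- The past of a point that is not outgoing stays outside the interior of `M`, where `g` vanishes.
  have hzero : ∀ᵐ p ∂D.bdMeasure, p ∉ D.outflow → D.mu p * flowIntegral E.Φ 0 S g p = 0 := by
    filter_upwards [D.ae_bdMeasure_mem] with p hp hpo
    have hs : D.slope p ≤ 0 := not_lt.1 fun hs => hpo (D.mem_outflow_iff.2 ⟨hp.1, hs⟩)
    have : flowIntegral E.Φ 0 S g p = 0 := by
      refine (intervalIntegral.integral_congr (g := fun _ => 0) fun s hs' => ?_).trans (by simp)
      rw [uIcc_of_le hS] at hs'
      have := hsupp _ (E.ρ_nonneg_of_slope_nonpos hp.1.ge hs hs'.1)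
      simp [this]
    rw [this, mul_zero]
  rw [setIntegral_eq_integral_of_ae_compl_eq_zero hzero, ← h]
  have hgi : Integrable g D.liouville := memLp_one_iff_integrable.1 (memLp_liouville hg.continuous 1)
  have hgi' : Integrable (fun p => g p - g (E.Φ (-S) p)) D.liouville :=
    memLp_one_iff_integrable.1 (memLp_liouville (hg.continuous.sub
      (hg.continuous.comp (E.isFlow.lipschitzWith E.lipschitz (-S)).continuous)) 1)
  -- Green's formula produces `g - g ∘ Φ (-S)`; the subtracted term is nonnegative and is dropped,
  -- so the inequality holds for every `S`.
  exact integral_mono hgi' hgi fun p => sub_le_self _ (hg0 _)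

end FlowExtension

/-- Needed for the sign of a convexity constant: at an outgoing point `0 < T ≤ C₀ μ` forces `C₀ >
0`. -/
theorem outflow_nonempty (D : ConformalDomain) : D.outflow.Nonempty := by
  have hx := D.bdry_mem 0
  by_contra! hemp
  have h1 : ∀ θ, fderiv ℝ D.ρ (D.bdry 0) (dir θ) ≤ 0 := fun θ => by
    by_contra! h
    refine notMem_empty ((D.bdry 0, θ) : Phase) (hemp ▸ ⟨hx, ?_⟩)
    rw [D.mu_eq (by exact hx)]
    exact mul_pos (inv_pos.2 (D.gradient_ne_zero hx)) h
  have h2 : ∀ θ, fderiv ℝ D.ρ (D.bdry 0) (dir θ) = 0 := fun θ => by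
    have := h1 (θ + Real.pi)
    rw [dir_add_pi, map_neg] at this
    linarith [h1 θ]
  have e0 := h2 0
  have e1 := h2 (Real.pi / 2)
  simp only [dir, Real.cos_zero, Real.sin_zero, Real.cos_pi_div_two, Real.sin_pi_div_two] at e0 e1
  refine D.ρ_regular _ hx (ext_inner_right ℝ fun v => ?_)
  rw [inner_gradient, Plane.clm_apply, e0, e1]
  simp

/-- The bound for the outgoing trace in terms of the derivative along the flow. -/
theorem VanishesOnInflow.integral_outflow_le (hconv : D.StrictlyConvex) {C₀ : ℝ}
    (hC : D.IsConvexityConstant C₀) {φ : Phase → ℂ} (hφ : D.VanishesOnInflow φ) :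
    ∫ p in D.outflow, ‖φ p‖ ^ 2 ∂D.bdMeasure ≤ C₀ * ∫ p, ‖D.X φ p‖ ^ 2 ∂D.liouville := by
  obtain ⟨E⟩ := nonempty_flowExtension hconv
  set w := D.X φ with hw
  have hwc : Continuous w := hφ.smooth.continuous_X
  have hwper : Function.Periodic w turn := fun p => by
    simp only [hw, X, periodic_field p, periodic_fderiv hφ.smooth.periodic p]
  obtain ⟨B, hB⟩ := exists_norm_le_of_periodic hwc hwper D.isCompact_M
  -- The flux inequality needs Lipschitz functions vanishing off the interior of `M`, but the one
  -- wanted is `g'`, the discontinuous restriction of `|Xφ|²` to the interior. It is the bounded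
  -- pointwise limit of the `g j`.
  set g : ℕ → Phase → ℝ := fun j q => Real.smoothTransition (-(j * D.ρ q.1)) * ‖w q‖ ^ 2 with hg
  set g' : Phase → ℝ := fun q => if D.ρ q.1 < 0 then ‖w q‖ ^ 2 else 0 with hg'
  have hg0 : ∀ j q, 0 ≤ g j q := fun j q =>
    mul_nonneg (Real.smoothTransition.nonneg _) (sq_nonneg _)
  have hg1 : ∀ j q, g j q ≤ ‖w q‖ ^ 2 := fun j q =>
    mul_le_of_le_one_left (sq_nonneg _) (Real.smoothTransition.le_one _)
  have hgsupp : ∀ j, ∀ q : Phase, 0 ≤ D.ρ q.1 → g j q = 0 := fun j q hq => by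
    simp only [hg]
    rw [Real.smoothTransition.zero_of_nonpos, zero_mul]
    have : 0 ≤ j * D.ρ q.1 := by positivity
    linarith
  have hgB : ∀ j q, ‖g j q‖ ≤ (B : ℝ) ^ 2 := fun j q => by
    rw [Real.norm_of_nonneg (hg0 j q)]
    rcases le_or_gt 0 (D.ρ q.1) with h | h
    · rw [hgsupp j q h]; positivity
    · exact (hg1 j q).trans (pow_le_pow_left₀ (norm_nonneg _) (hB q h.le) 2)
  have hlim : ∀ q, Tendsto (fun j => g j q) atTop (𝓝 (g' q)) := fun q => by
    rcases le_or_gt 0 (D.ρ q.1) with h | h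
    · simp only [hgsupp _ q h, hg', if_neg h.not_gt]
      exact tendsto_const_nhds
    · refine tendsto_const_nhds.congr' ?_
      obtain ⟨N, hN⟩ := exists_nat_ge (1 / -D.ρ q.1)
      filter_upwards [eventually_ge_atTop N] with j hj
      have h1 : 1 ≤ -(j * D.ρ q.1) := by
        have h2 : 1 / -D.ρ q.1 ≤ j := hN.trans (by exact_mod_cast hj)
        rw [div_le_iff₀ (by linarith)] at h2
        linarith
      simp only [hg, hg', if_pos h, Real.smoothTransition.one_of_one_le h1, one_mul]
  have hwn : ContDiff ℝ 1 fun q => ‖w q‖ ^ 2 := by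
    have : ContDiff ℝ ∞ w :=
      (hφ.smooth.1.fderiv_right (m := ∞) (by simp)).clm_apply D.contDiff_field
    exact (this.of_le (by simp)).norm_sq ℝ
  have hgc : ∀ j, ContDiff ℝ 1 (g j) := fun j =>
    (Real.smoothTransition.contDiff.comp (contDiff_const.mul
      ((D.ρ_smooth.of_le (by simp)).comp contDiff_fst)).neg).mul hwn
  have hgper : ∀ j, Function.Periodic (g j) turn := fun j q => by
    simp only [hg, hwper q]; simp
  -- As `|μ| ≤ 1`, every orbit from an outgoing point back to its entry has length at most `C₀ μ ≤
  -- |C₀|`, so one time span covers all of them.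
  set S : ℝ := |C₀|
  have hS : 0 ≤ S := abs_nonneg _
  have hcontΦ : ∀ p, Continuous fun s => E.Φ (-s) p := fun p =>
    (E.continuous_Φ_time p).comp continuous_neg
  have hIlim : ∀ p, Tendsto (fun j => flowIntegral E.Φ 0 S (g j) p) atTop
      (𝓝 (flowIntegral E.Φ 0 S g' p)) := fun p => by
    refine intervalIntegral.tendsto_integral_filter_of_dominated_convergence
      (fun _ => (B : ℝ) ^ 2) ?_ ?_ (by simp) ?_
    · exact Eventually.of_forall fun j =>
        (continuous_flowIntegrand E.isFlow (hgc j).continuous 0 p).aestronglyMeasurable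
    · exact Eventually.of_forall fun j => ae_of_all _ fun s _ => by simpa using hgB j _
    · exact ae_of_all _ fun s _ => (hlim _).const_smul _
  have hIB : ∀ j p, ‖flowIntegral E.Φ 0 S (g j) p‖ ≤ (B : ℝ) ^ 2 * S := fun j p => by
    refine (intervalIntegral.norm_integral_le_of_norm_le_const (C := (B : ℝ) ^ 2)
      fun s _ => by simpa using hgB j _).trans ?_
    rw [sub_zero, abs_of_nonneg hS]
  have hIc : ∀ j, Continuous (flowIntegral E.Φ 0 S (g j)) := fun j => by
    obtain ⟨L, hL⟩ := exists_lipschitzWith_of_periodic (hgc j) (hgper j) D.isCompact_M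
      fun p hp => hgsupp j p (not_le.1 hp).le
    obtain ⟨L', hL'⟩ := lipschitzWith_flowIntegral E.isFlow E.lipschitz hL (le_refl (0 : ℝ)) hS
    exact hL'.continuous
  have hbound : ∀ᵐ p ∂D.bdMeasure.restrict D.outflow, |D.mu p| ≤ 1 :=
    (ae_restrict_mem measurableSet_outflow).mono fun p hp => abs_mu_le_one hp.1
  have hmeas : ∀ j, AEStronglyMeasurable (fun p => D.mu p * flowIntegral E.Φ 0 S (g j) p)
      (D.bdMeasure.restrict D.outflow) := fun j =>
    (D.measurable_mu.mul (hIc j).measurable).aestronglyMeasurable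
  have hle : ∀ j, ∀ᵐ p ∂D.bdMeasure.restrict D.outflow,
      ‖D.mu p * flowIntegral E.Φ 0 S (g j) p‖ ≤ (B : ℝ) ^ 2 * S := fun j => by
    filter_upwards [hbound] with p hp
    rw [norm_mul, Real.norm_eq_abs]
    exact (mul_le_of_le_one_left (norm_nonneg _) hp).trans (hIB j p)
  have hlim' : ∀ᵐ p ∂D.bdMeasure.restrict D.outflow, Tendsto
      (fun j => D.mu p * flowIntegral E.Φ 0 S (g j) p) atTop
      (𝓝 (D.mu p * flowIntegral E.Φ 0 S g' p)) := ae_of_all _ fun p => (hIlim p).const_mul _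
  have hdct := tendsto_integral_of_dominated_convergence (fun _ => (B : ℝ) ^ 2 * S) hmeas
    (integrable_const _) hle hlim'
  have hint : Integrable (fun p => D.mu p * flowIntegral E.Φ 0 S g' p)
      (D.bdMeasure.restrict D.outflow) := by
    refine Integrable.of_bound (aestronglyMeasurable_of_tendsto_ae _ hmeas hlim')
      ((B : ℝ) ^ 2 * S) ?_
    filter_upwards [hlim', ae_all_iff.2 hle] with p h1 h2
    exact le_of_tendsto h1.norm (Eventually.of_forall h2)
  have hw2i : Integrable (fun p => ‖w p‖ ^ 2) D.liouville :=
    memLp_one_iff_integrable.1 (memLp_liouville (hwc.norm.pow 2) 1)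
  have hflux : ∫ p in D.outflow, D.mu p * flowIntegral E.Φ 0 S g' p ∂D.bdMeasure ≤
      ∫ p, ‖w p‖ ^ 2 ∂D.liouville := by
    refine le_of_tendsto hdct (Eventually.of_forall fun j => ?_)
    obtain ⟨L, hL⟩ := exists_lipschitzWith_of_periodic (hgc j) (hgper j) D.isCompact_M
      fun p hp => hgsupp j p (not_le.1 hp).le
    refine (E.integral_outflow_mu_flowIntegral_le hL (hgper j) (hg0 j) (hgsupp j) hS).trans ?_
    exact integral_mono (memLp_one_iff_integrable.1 (memLp_liouville (hgc j).continuous 1)) hw2i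
      (hg1 j)
  have hg'm : Measurable g' := Measurable.ite
    (measurableSet_lt (D.ρ_smooth.continuous.measurable.comp measurable_fst) measurable_const)
    (hwc.norm.pow 2).measurable measurable_const
  have hg'0 : ∀ q, 0 ≤ g' q := fun q => by simp only [hg']; split_ifs <;> positivity
  have hg'B : ∀ q, ‖g' q‖ ≤ (B : ℝ) ^ 2 := fun q =>
    le_of_tendsto (hlim q).norm (Eventually.of_forall fun j => hgB j q)
  -- The fundamental theorem of calculus from the entry point, where `φ` vanishes, followed by
  -- Cauchy–Schwarz on an interval of length `T ≤ C₀ μ`.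
  have hpt : ∀ p ∈ D.outflow, ‖φ p‖ ^ 2 ≤ C₀ * (D.mu p * flowIntegral E.Φ 0 S g' p) := by
    intro p hp
    obtain ⟨T, hT, hTC, hM, hneg, hbd, hsl⟩ := E.entry_properties hconv hC hp
    have hTS : T ≤ S := by
      refine hTC.trans ((le_abs_self _).trans ?_)
      rw [abs_mul]
      exact mul_le_of_le_one_right (abs_nonneg _) (abs_mu_le_one hp.1)
    have hd : ∀ s ∈ uIcc 0 T, HasDerivAt (fun s => φ (E.Φ (-s) p)) (-w (E.Φ (-s) p)) s := by
      intro s hs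
      rw [uIcc_of_le hT.le] at hs
      have h1 := (hφ.smooth.differentiableAt (E.Φ (-s) p)).hasFDerivAt.comp_hasDerivAt s
        (E.isFlow.neg.hasDerivAt p s)
      refine h1.congr_deriv ?_
      rw [map_neg, E.X_eq φ (hM s hs)]
    have hwcs : Continuous fun s => w (E.Φ (-s) p) := hwc.comp (hcontΦ p)
    have hftc := intervalIntegral.integral_eq_sub_of_hasDerivAt hd
      (hwcs.neg.intervalIntegrable _ _)
    rw [hφ.eq_zero _ hbd hsl, neg_zero, E.Φ_zero, zero_sub, intervalIntegral.integral_neg,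
      neg_inj] at hftc
    have h1 : ‖φ p‖ ≤ ∫ s in (0 : ℝ)..T, ‖w (E.Φ (-s) p)‖ := by
      rw [← hftc]; exact intervalIntegral.norm_integral_le_integral_norm hT.le
    have h2 := sq_intervalIntegral_le hwcs.norm hT
    have h3 : ∫ s in (0 : ℝ)..T, ‖w (E.Φ (-s) p)‖ ^ 2 = ∫ s in (0 : ℝ)..T, g' (E.Φ (-s) p) := by
      rw [intervalIntegral.integral_of_le hT.le, intervalIntegral.integral_of_le hT.le,
        integral_Ioc_eq_integral_Ioo, integral_Ioc_eq_integral_Ioo]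
      refine setIntegral_congr_fun measurableSet_Ioo fun s hs => ?_
      simp only [hg', if_pos (hneg s hs)]
    have hii : ∀ a b : ℝ, IntervalIntegrable (fun s => g' (E.Φ (-s) p)) volume a b := fun a b => by
      refine (intervalIntegrable_const (c := (B : ℝ) ^ 2)).mono_fun
        (hg'm.comp (hcontΦ p).measurable).aestronglyMeasurable (ae_of_all _ fun s => ?_)
      simpa using hg'B _
    have h4 : ∫ s in (0 : ℝ)..T, g' (E.Φ (-s) p) ≤ flowIntegral E.Φ 0 S g' p := by
      simp only [flowIntegral, neg_zero, zero_mul, Real.exp_zero, one_smul]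
      exact intervalIntegral.integral_mono_interval le_rfl hT.le hTS
        (ae_of_all _ fun s => hg'0 _) (hii _ _)
    have h5 : 0 ≤ ∫ s in (0 : ℝ)..T, g' (E.Φ (-s) p) :=
      intervalIntegral.integral_nonneg hT.le fun s _ => hg'0 _
    calc ‖φ p‖ ^ 2 ≤ (∫ s in (0 : ℝ)..T, ‖w (E.Φ (-s) p)‖) ^ 2 :=
          pow_le_pow_left₀ (norm_nonneg _) h1 2
      _ ≤ T * ∫ s in (0 : ℝ)..T, g' (E.Φ (-s) p) := by rw [← h3]; exact h2
      _ ≤ C₀ * D.mu p * flowIntegral E.Φ 0 S g' p :=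
          mul_le_mul hTC h4 h5 (hT.le.trans hTC)
      _ = _ := mul_assoc _ _ _
  have hφi : Integrable (fun p => ‖φ p‖ ^ 2) D.bdMeasure :=
    memLp_one_iff_integrable.1 (memLp_bdMeasure (hφ.smooth.continuous.norm.pow 2) 1)
  have hfin : ∫ p in D.outflow, ‖φ p‖ ^ 2 ∂D.bdMeasure ≤
      C₀ * ∫ p in D.outflow, D.mu p * flowIntegral E.Φ 0 S g' p ∂D.bdMeasure := by
    rw [← integral_const_mul]
    exact setIntegral_mono_on hφi.integrableOn (hint.const_mul C₀) measurableSet_outflow hpt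
  have hC0 : 0 ≤ C₀ := by
    obtain ⟨p, hp⟩ := D.outflow_nonempty
    obtain ⟨T, hT, hTC, -⟩ := E.entry_properties hconv hC hp
    exact (pos_of_mul_pos_left (hT.trans_le hTC) hp.2.le).le
  exact hfin.trans (mul_le_mul_of_nonneg_left hflux hC0)

end ConformalDomain

/-! ### Approximate solutions and test functions -/

namespace ConformalDomain

variable {D : ConformalDomain}

theorem interior_M : interior D.M = {x | D.ρ x < 0} := by
  refine Subset.antisymm (fun x hx => ?_)
    (interior_maximal (fun x (hx : D.ρ x < 0) => show D.ρ x ≤ 0 from hx.le)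
      (isOpen_lt D.ρ_smooth.continuous continuous_const))
  have hle : D.ρ x ≤ 0 := (interior_subset hx : x ∈ D.M)
  refine lt_of_le_of_ne hle fun h0 => D.ρ_regular x h0 ?_
  have hmax : IsLocalMax D.ρ x := by
    filter_upwards [isOpen_interior.mem_nhds hx] with y hy
    rw [h0]
    exact (interior_subset hy : y ∈ D.M)
  rw [gradient, hmax.fderiv_eq_zero, map_zero]

/-- Approximate solutions of the damped transport equation `X φ + l φ = f` that vanish near the
boundary points whose direction does not point outward. -/
theorem exists_approx_damped (hconv : D.StrictlyConvex) {f : Phase → ℂ} (hf : IsSmooth f)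
    {K : Set Plane} (hK : IsCompact K) (hKint : K ⊆ interior D.M)
    (hsupp : ∀ p : Phase, p.1 ∉ K → f p = 0) {l ε : ℝ} (hl : 0 < l) (hε : 0 < ε) :
    ∃ φ : Phase → ℂ, IsSmooth φ ∧ (∀ p : Phase, p.1 ∈ D.M → ‖D.X φ p + l * φ p - f p‖ ≤ ε) ∧
      ∃ r > 0, ∀ p q : Phase, q.1 ∈ D.bd → D.slope q ≤ 0 → dist p q < r → φ p = 0 := by
  obtain ⟨E⟩ := nonempty_flowExtension hconv
  obtain ⟨L, hL⟩ := exists_lipschitzWith_of_periodic hf.contDiff_one hf.periodic hK hsupp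
  obtain ⟨B, hB⟩ := exists_norm_le_of_periodic hf.continuous hf.periodic hK
  have hB' : ∀ p, ‖f p‖ ≤ B := fun p => by
    by_cases hp : p.1 ∈ K
    · exact hB p hp
    · rw [hsupp p hp, norm_zero]; exact B.2
  -- Truncating the flow integral at `S` leaves an error `exp (-l S) ‖f‖`, to which half of `ε` is
  -- assigned; mollification takes the other half.
  obtain ⟨S, hS, hSε⟩ : ∃ S : ℝ, 0 ≤ S ∧ Real.exp (-l * S) * B < ε / 2 := by
    have h1 : Tendsto (fun S : ℝ => Real.exp (-l * S) * B) atTop (𝓝 (0 * B)) :=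
      (Real.tendsto_exp_atBot.comp (tendsto_id.const_mul_atTop_of_neg (by linarith))).mul_const _
    rw [zero_mul] at h1
    exact ((eventually_ge_atTop 0).and (h1.eventually (gt_mem_nhds (by linarith)))).exists
  obtain ⟨L₁, h₁⟩ := lipschitzWith_flowIntegral E.isFlow E.lipschitz hL hl.le hS
  obtain ⟨L₂, h₂⟩ := lipschitzWith_flowIntegralDeriv E.isFlow E.lipschitz hL hl.le hS
  obtain ⟨C, hC⟩ := flowIntegral_add_smul_sub_le E.isFlow E.lipschitz E.bound hL hl.le hS
  obtain ⟨d, hd, hdK⟩ := hK.exists_thickening_subset_open isOpen_interior hKint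
  -- Over time `S` the flow expands distances by at most `exp (K S)`. Points within `2 r` of a `q`
  -- whose past avoids the interior therefore have a past that avoids `K`, which lies at depth `d`.
  -- One `r` is for the mollification and one for the claimed neighbourhood.
  set r := d * Real.exp (-(E.K * S)) / 2 with hr
  have hr0 : 0 < r := by positivity
  set N : ℝ := L₁ * E.K + L₂ + l * L₁ with hN
  have hN0 : 0 ≤ N := by positivity
  set ε' := min r (ε / 2 / (N + 1))
  have hε' : 0 < ε' := lt_min hr0 (by positivity)
  have hNε : N * ε' ≤ ε / 2 := by
    calc N * ε' ≤ (N + 1) * (ε / 2 / (N + 1)) := by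
          gcongr
          · linarith
          · exact min_le_right _ _
      _ = ε / 2 := by field_simp
  obtain ⟨φ, hφ, hφ1, hφ2, hφ3, hφ4⟩ := exists_contDiff_approx_along E.lipschitz h₁ h₂ hC hε'
  refine ⟨φ, IsSmooth.of_periodic hφ (hφ4 turn (flowIntegral_add E.Φ_add_turn hf.periodic l S)),
    fun p hp => ?_, r, hr0, fun p q hq hs hpq => hφ3 p fun y hy => ?_⟩
  · set u := flowIntegral E.Φ l S f with hu
    have e : D.X φ p + l * φ p - f p = (fderiv ℝ φ p (E.χ p.1 • D.field p) -
        flowIntegralDeriv E.Φ l S f p) + l * (φ p - u p) -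
        Real.exp (-l * S) • f (E.Φ (-S) p) := by
      rw [E.X_eq φ hp, flowIntegralDeriv]
      simp only [Complex.real_smul]
      ring
    rw [e]
    have h1 : ‖(l : ℂ) * (φ p - u p)‖ ≤ l * (L₁ * ε') := by
      rw [norm_mul, Complex.norm_real, Real.norm_of_nonneg hl.le]
      gcongr
      exact hφ1 p
    have h2 : ‖Real.exp (-l * S) • f (E.Φ (-S) p)‖ ≤ Real.exp (-l * S) * B := by
      rw [norm_smul, Real.norm_of_nonneg (Real.exp_pos _).le]
      gcongr
      exact hB' _
    calc _ ≤ (L₁ * E.K + L₂) * ε' + l * (L₁ * ε') + Real.exp (-l * S) * B :=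
          (norm_sub_le _ _).trans (add_le_add ((norm_add_le _ _).trans (add_le_add (hφ2 p) h1)) h2)
      _ = N * ε' + Real.exp (-l * S) * B := by rw [hN]; ring
      _ ≤ ε := by linarith
  · have hyq : dist q y < d * Real.exp (-(E.K * S)) := by
      have h1 : dist y p < r := hy.trans_le (min_le_left _ _)
      calc dist q y ≤ dist y p + dist p q := by rw [dist_comm q y]; exact dist_triangle _ _ _
        _ < r + r := add_lt_add h1 hpq
        _ = _ := by rw [hr]; ring
    refine (intervalIntegral.integral_congr (g := fun _ => 0) fun s hs' => ?_).trans (by simp)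
    rw [uIcc_of_le hS] at hs'
    simp only
    rw [hsupp, smul_zero]
    intro hmem
    have h2 : (E.Φ (-s) q).1 ∈ interior D.M := by
      refine hdK (Metric.mem_thickening_iff.2 ⟨_, hmem, ?_⟩)
      calc dist (E.Φ (-s) q).1 (E.Φ (-s) y).1 ≤ dist (E.Φ (-s) q) (E.Φ (-s) y) := le_max_left _ _
        _ ≤ dist q y * Real.exp (E.K * |(-s)|) := E.isFlow.dist_le E.lipschitz _ _ _
        _ ≤ dist q y * Real.exp (E.K * S) := by
          rw [abs_neg, abs_of_nonneg hs'.1]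
          gcongr
          exact hs'.2
        _ < d * Real.exp (-(E.K * S)) * Real.exp (E.K * S) := by gcongr
        _ = d := by rw [mul_assoc, ← Real.exp_add]; simp
    rw [interior_M] at h2
    exact absurd (E.ρ_nonneg_of_slope_nonpos hq.ge hs hs'.1) (not_le.2 h2)

/-- Approximate solutions of the adjoint equation `-X φ + l φ = f` whose boundary values are
supported in a compact subset of the incoming boundary. -/
theorem exists_approx_adjoint (hconv : D.StrictlyConvex) {f : Phase → ℂ} (hf : IsSmooth f)
    {K : Set Plane} (hK : IsCompact K) (hKint : K ⊆ interior D.M)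
    (hsupp : ∀ p : Phase, p.1 ∉ K → f p = 0) {l ε : ℝ} (hl : 0 < l) (hε : 0 < ε) :
    ∃ φ : Phase → ℂ, IsSmooth φ ∧ (∀ p : Phase, p.1 ∈ D.M → ‖-D.X φ p + l * φ p - f p‖ ≤ ε) ∧
      ∃ Z : Set Phase, IsCompact Z ∧ Z ⊆ D.inflow ∧
        ∀ p : Phase, p.1 ∈ D.bd → p.2 ∈ Ioc 0 (2 * Real.pi) → p ∉ Z → φ p = 0 := by
  obtain ⟨φ, hφ, h1, r, hr, h2⟩ := exists_approx_damped hconv hf.comp_add_pi hK hKint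
    (fun p hp => hsupp _ (by simpa using hp)) hl hε
  -- Reversing directions turns the damped equation into its adjoint. `Z` consists of the boundary
  -- points whose reversal keeps distance `r` from all `q` that are not outgoing. It is closed, and
  -- its points are incoming, as otherwise the reversal itself would be such a `q`.
  refine ⟨fun p => φ (p + (0, Real.pi)), hφ.comp_add_pi, fun p hp => ?_,
    {p | p.1 ∈ D.bd ∧ p.2 ∈ Icc 0 (2 * Real.pi)} ∩
      ⋂ q ∈ {q : Phase | q.1 ∈ D.bd ∧ D.slope q ≤ 0}, {p | r ≤ dist (p + (0, Real.pi)) q},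
    ?_, ?_, fun p hp hp2 hpZ => ?_⟩
  · rw [X_comp_add_pi, neg_neg]
    have := h1 (p + (0, Real.pi)) (by simpa using hp)
    rwa [add_assoc, show ((0, Real.pi) : Phase) + (0, Real.pi) = turn by
      ext1 <;> simp; ring, hf.periodic] at this
  · refine IsCompact.inter_right (D.isCompact_bd.prod isCompact_Icc) ?_
    refine isClosed_biInter fun q _ => isClosed_le continuous_const ?_
    exact (continuous_id.add continuous_const).dist continuous_const
  · rintro p ⟨⟨hp, -⟩, hp2⟩
    refine D.mem_inflow_iff.2 ⟨hp, ?_⟩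
    by_contra! hs
    have := mem_iInter₂.1 hp2 (p + (0, Real.pi)) ⟨by simpa using hp, by
      rw [D.slope_add_pi]; linarith⟩
    rw [mem_ofPred_eq, dist_self] at this
    linarith
  · by_contra hne
    refine hpZ ⟨⟨hp, Ioc_subset_Icc_self hp2⟩, mem_iInter₂.2 fun q hq => ?_⟩
    by_contra! hlt
    exact hne (h2 _ q hq.1 hq.2 (not_le.1 (by simpa using hlt)))

theorem ae_liouville_mem_interior :
    ∀ᵐ p ∂D.liouville, p ∈ interior D.M ×ˢ Ioo 0 (2 * Real.pi) := by
  have h1 : ∀ᵐ x ∂D.gArea, x ∉ D.bd :=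
    D.ae_gArea_iff.2 (ae_restrict_of_ae (measure_eq_zero_iff_ae_notMem.1 D.volume_bd))
  have h2 : ∀ᵐ θ ∂volume.restrict (Ioc 0 (2 * Real.pi)), θ ≠ 2 * Real.pi :=
    ae_restrict_of_ae (Measure.ae_ne volume _)
  filter_upwards [D.ae_liouville_mem, Measure.quasiMeasurePreserving_fst.ae h1,
    Measure.quasiMeasurePreserving_snd.ae h2] with p hp hp1 hp2
  refine ⟨?_, hp.2.1, lt_of_le_of_ne hp.2.2 hp2⟩
  rw [interior_M]
  exact lt_of_le_of_ne hp.1 hp1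

variable (D) in
/-- Smooth functions that vanish over the complement of a compact subset of the interior. -/
def IsTest (φ : Phase → ℂ) : Prop :=
  IsSmooth φ ∧ ∃ K : Set Plane, IsCompact K ∧ K ⊆ interior D.M ∧ ∀ p : Phase, p.1 ∉ K → φ p = 0

/-- Test functions must be periodic in the angle. A bump supported strictly inside one period is
made periodic by summing its translates, which have disjoint supports. -/
theorem exists_isTest_eqOn {g : Phase → ℝ} (hg : ContDiff ℝ ∞ g) (hc : HasCompactSupport g)
    (hsupp : tsupport g ⊆ interior D.M ×ˢ Ioo 0 (2 * Real.pi)) :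
    ∃ φ, D.IsTest φ ∧ ∀ p : Phase, p.2 ∈ Ioc 0 (2 * Real.pi) → φ p = g p := by
  have hpi := Real.two_pi_pos
  have hg0 : ∀ p, p ∉ interior D.M ×ˢ Ioo 0 (2 * Real.pi) → g p = 0 := fun p hp =>
    image_eq_zero_of_notMem_tsupport fun h => hp (hsupp h)
  set f : ℤ → Phase → ℂ := fun n p => (g (p + n • turn) : ℂ) with hf
  have hfs : ∀ n, ContDiff ℝ ∞ (f n) := fun n =>
    Complex.ofRealCLM.contDiff.comp (hg.comp (contDiff_id.add contDiff_const))
  have hfin : LocallyFinite fun n => Function.support (f n) := by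
    intro p
    refine ⟨{q | |q.2 - p.2| < 1}, (isOpen_lt (by fun_prop) continuous_const).mem_nhds (by simp), ?_⟩
    refine (finite_Icc ⌊(-1 - p.2) / (2 * Real.pi)⌋ ⌈(2 * Real.pi + 1 - p.2) / (2 * Real.pi)⌉).subset ?_
    rintro n ⟨q, hq, hq1⟩
    have h1 : q + n • turn ∈ interior D.M ×ˢ Ioo 0 (2 * Real.pi) := by
      by_contra h
      exact hq (by simp only [hf, hg0 _ h, Complex.ofReal_zero])
    have h2 := h1.2
    simp only [Prod.snd_add, Prod.smul_snd, zsmul_eq_mul, mem_Ioo] at h2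
    have h3 := abs_lt.1 (show |q.2 - p.2| < 1 from hq1)
    constructor
    · refine Int.floor_le_iff.2 ?_
      rw [div_lt_iff₀ hpi]
      linarith
    · refine Int.le_ceil_iff.2 ?_
      rw [lt_div_iff₀ hpi]
      linarith
  have hsm : ContDiff ℝ ∞ fun p => ∑ᶠ n, f n p :=
    (contMDiff_finsum (I := modelWithCornersSelf ℝ ℂ) (I' := modelWithCornersSelf ℝ Phase)
      (fun n => (hfs n).contMDiff) hfin).contDiff
  refine ⟨fun p => ∑ᶠ n, f n p, ⟨IsSmooth.of_periodic hsm fun p => ?_, Prod.fst '' tsupport g,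
    hc.isCompact.image continuous_fst, ?_, fun p hp => ?_⟩, fun p hp => ?_⟩
  · refine (finsum_congr fun n => ?_).trans
      (finsum_comp_equiv (Equiv.addRight (1 : ℤ)) (f := fun n => f n p))
    simp only [hf, Equiv.coe_addRight, add_smul, one_smul]
    rw [add_right_comm, add_assoc]
  · rintro - ⟨p, hp, rfl⟩
    exact (hsupp hp).1
  · refine finsum_eq_zero_of_forall_eq_zero fun n => ?_
    simp only [hf, Complex.ofReal_eq_zero]
    exact image_eq_zero_of_notMem_tsupport fun h => hp ⟨_, h, by simp⟩
  · simp only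
    rw [finsum_eq_single _ 0 fun n hn => ?_]
    · simp only [hf, zero_smul, add_zero]
    · simp only [hf, Complex.ofReal_eq_zero]
      refine hg0 _ fun h => ?_
      have h2 := h.2
      simp only [Prod.snd_add, Prod.smul_snd, zsmul_eq_mul, mem_Ioo] at h2
      rcases lt_or_gt_of_ne hn with hn | hn
      · have : (n : ℝ) ≤ -1 := by exact_mod_cast Int.le_sub_one_of_lt hn
        nlinarith [hp.2]
      · have : (1 : ℝ) ≤ n := by exact_mod_cast hn
        nlinarith [hp.1]

/-- Test functions separate the points of `L²(SM)`. -/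
theorem eq_zero_of_forall_isTest {u : Phase → ℂ} (hu : Integrable u D.liouville)
    (h : ∀ φ, D.IsTest φ → ∫ p, u p * φ p ∂D.liouville = 0) : u =ᵐ[D.liouville] 0 := by
  have hU : IsOpen (interior D.M ×ˢ Ioo 0 (2 * Real.pi)) := isOpen_interior.prod isOpen_Ioo
  have key := hU.ae_eq_zero_of_integral_contDiff_smul_eq_zero
    (hu.locallyIntegrable.locallyIntegrableOn _) fun g hg hc hs => by
      obtain ⟨φ, hφ, he⟩ := exists_isTest_eqOn hg hc hs
      rw [← h φ hφ]
      refine integral_congr_ae ?_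
      filter_upwards [D.ae_liouville_mem] with p hp
      rw [he p hp.2, Complex.real_smul, mul_comm]
  filter_upwards [key, ae_liouville_mem_interior] with p h1 h2 using h1 h2

end ConformalDomain

/-! ### The scattering operator -/

theorem sq_lintegral_mul_le {α : Type*} [MeasurableSpace α] {μ : Measure α} {w g : α → ℝ≥0∞}
    (hw : AEMeasurable w μ) (hg : AEMeasurable g μ) :
    (∫⁻ a, w a * g a ∂μ) ^ 2 ≤ (∫⁻ a, w a ∂μ) * ∫⁻ a, w a * g a ^ 2 ∂μ := by
  have hs : ∀ x : ℝ≥0∞, x ^ (1 / 2 : ℝ) * x ^ (1 / 2 : ℝ) = x := fun x => by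
    rw [← ENNReal.rpow_add_of_nonneg _ _ (by norm_num) (by norm_num)]; norm_num
  have h2 : ∀ x : ℝ≥0∞, (x ^ (1 / 2 : ℝ)) ^ 2 = x := fun x => by rw [sq, hs]
  -- Weighted Cauchy–Schwarz: the weight is split as `w = w^{1/2} w^{1/2}`.
  have h := ENNReal.lintegral_mul_le_Lp_mul_Lq μ Real.HolderConjugate.two_two
    (hw.pow_const (1 / 2 : ℝ)) ((hw.pow_const (1 / 2 : ℝ)).mul hg)
  simp only [Pi.mul_apply, ← mul_assoc, hs, ENNReal.rpow_two, h2, mul_pow] at h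
  calc _ ≤ _ := pow_le_pow_left' h 2
    _ = _ := by rw [mul_pow, h2, h2]

section Periodic

variable {T : ℝ}

theorem Function.Periodic.setLIntegral_Ioc_eq {f : ℝ → ℝ≥0∞} (hf : Function.Periodic f T)
    (hT : 0 < T) (a b : ℝ) : ∫⁻ x in Ioc a (a + T), f x = ∫⁻ x in Ioc b (b + T), f x := by
  have : VAddInvariantMeasure (AddSubgroup.zmultiples T) ℝ volume :=
    ⟨fun c s _ => measure_preimage_add _ _ _⟩
  exact (isAddFundamentalDomain_Ioc hT a).setLIntegral_eq (isAddFundamentalDomain_Ioc hT b) f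
    hf.map_vadd_zmultiples

theorem Function.Periodic.setLIntegral_Ioc_sub_right {f : ℝ → ℝ≥0∞} (hf : Function.Periodic f T)
    (hT : 0 < T) (t : ℝ) : ∫⁻ x in Ioc 0 T, f (x - t) = ∫⁻ x in Ioc 0 T, f x := by
  have h := (measurePreserving_sub_right volume t).setLIntegral_comp_preimage_emb
    (measurableEmbedding_subRight t) f (Ioc (0 - t) (0 - t + T))
  have h2 := hf.setLIntegral_Ioc_eq hT (0 - t) 0
  rw [zero_add] at h2
  rw [← h2, ← h]
  congr 2
  ext x; simp

theorem Function.Periodic.setLIntegral_Ioc_sub_left {f : ℝ → ℝ≥0∞} (hf : Function.Periodic f T)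
    (hT : 0 < T) (t : ℝ) : ∫⁻ x in Ioc 0 T, f (t - x) = ∫⁻ x in Ioc 0 T, f x := by
  have h := (Measure.measurePreserving_sub_left volume t).setLIntegral_comp_preimage_emb
    (measurableEmbedding_subLeft t) f (Ico (t - T) t)
  have h2 := hf.setLIntegral_Ioc_eq hT (t - T) 0
  rw [zero_add, sub_add_cancel] at h2
  rw [← h2, ← setLIntegral_congr (Ico_ae_eq_Ioc (a := t - T) (b := t)), ← h]
  congr 2
  ext x
  simp only [mem_Ico, mem_Ioc, mem_preimage]
  constructor <;> rintro ⟨h1, h2⟩ <;> constructor <;> linarith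

end Periodic

namespace ConformalDomain

variable {D : ConformalDomain}

/-- A measurable nonnegative scattering kernel that is periodic in the angle. -/
structure IsKernel (q : Plane → ℝ → ℝ) : Prop where
  measurable : Measurable fun p : Phase => q p.1 p.2
  nonneg : ∀ x θ, 0 ≤ q x θ
  periodic : ∀ x, Function.Periodic (q x) (2 * Real.pi)

namespace IsKernel

variable {q : Plane → ℝ → ℝ} {u v : Phase → ℂ}

/-- The mean of the kernel over the circle. -/
def mean (q : Plane → ℝ → ℝ) (x : Plane) : ℝ≥0∞ :=
  ENNReal.ofReal (2 * Real.pi)⁻¹ * ∫⁻ θ in Ioc 0 (2 * Real.pi), ENNReal.ofReal (q x θ)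

/-- The average of `|u|²` against the kernel. -/
def scatterSq (q : Plane → ℝ → ℝ) (u : Phase → ℂ) (p : Phase) : ℝ≥0∞ :=
  ENNReal.ofReal (2 * Real.pi)⁻¹ *
    ∫⁻ θ in Ioc 0 (2 * Real.pi), ENNReal.ofReal (q p.1 (p.2 - θ)) * ‖u (p.1, θ)‖ₑ ^ 2

theorem measurable_sub (hq : IsKernel q) :
    Measurable fun z : Phase × ℝ => q z.1.1 (z.1.2 - z.2) :=
  hq.measurable.comp ((measurable_fst.comp measurable_fst).prodMk
    ((measurable_snd.comp measurable_fst).sub measurable_snd))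

theorem measurable_fiber (hu : Measurable u) :
    Measurable fun z : Phase × ℝ => u (z.1.1, z.2) :=
  hu.comp ((measurable_fst.comp measurable_fst).prodMk measurable_snd)

theorem scatter_eq (p : Phase) : scatter q u p =
    (2 * Real.pi : ℂ)⁻¹ * ∫ θ in Ioc 0 (2 * Real.pi), (q p.1 (p.2 - θ) : ℂ) * u (p.1, θ) := by
  rw [scatter, intervalIntegral.integral_of_le Real.two_pi_pos.le]

theorem measurable_scatter (hq : IsKernel q) (hu : Measurable u) :
    Measurable (scatter q u) := by
  simp only [funext fun p => scatter_eq (q := q) (u := u) p]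
  have h : Measurable fun z : Phase × ℝ => (q z.1.1 (z.1.2 - z.2) : ℂ) * u (z.1.1, z.2) :=
    (Complex.measurable_ofReal.comp hq.measurable_sub).mul (measurable_fiber hu)
  exact (h.stronglyMeasurable.integral_prod_right
    (ν := volume.restrict (Ioc 0 (2 * Real.pi)))).measurable.const_mul _

theorem measurable_scatterSq (hq : IsKernel q) (hu : Measurable u) :
    Measurable (scatterSq q u) := by
  have h : Measurable fun z : Phase × ℝ =>
      ENNReal.ofReal (q z.1.1 (z.1.2 - z.2)) * ‖u (z.1.1, z.2)‖ₑ ^ 2 :=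
    hq.measurable_sub.ennreal_ofReal.mul ((measurable_fiber hu).enorm.pow_const 2)
  exact (h.lintegral_prod_right' (ν := volume.restrict (Ioc 0 (2 * Real.pi)))).const_mul _

theorem measurable_mean (hq : IsKernel q) : Measurable (mean q) :=
  (hq.measurable.ennreal_ofReal.lintegral_prod_right'
    (ν := volume.restrict (Ioc 0 (2 * Real.pi)))).const_mul _

theorem enorm_ofReal_mul (hq : IsKernel q) (x : Plane) (θ : ℝ) (z : ℂ) :
    ‖(q x θ : ℂ) * z‖ₑ = ENNReal.ofReal (q x θ) * ‖z‖ₑ := by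
  rw [enorm_mul, ← ofReal_norm, Complex.norm_real, Real.norm_of_nonneg (hq.nonneg x θ)]

theorem setLIntegral_sub_left (hq : IsKernel q) (x : Plane) (θ : ℝ) :
    ∫⁻ θ' in Ioc 0 (2 * Real.pi), ENNReal.ofReal (q x (θ - θ')) =
      ∫⁻ θ' in Ioc 0 (2 * Real.pi), ENNReal.ofReal (q x θ') :=
  Function.Periodic.setLIntegral_Ioc_sub_left (f := fun θ => ENNReal.ofReal (q x θ))
    (fun θ => by simp only [hq.periodic x θ]) Real.two_pi_pos θ

theorem setLIntegral_sub_right (hq : IsKernel q) (x : Plane) (θ' : ℝ) :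
    ∫⁻ θ in Ioc 0 (2 * Real.pi), ENNReal.ofReal (q x (θ - θ')) =
      ∫⁻ θ in Ioc 0 (2 * Real.pi), ENNReal.ofReal (q x θ) :=
  Function.Periodic.setLIntegral_Ioc_sub_right (f := fun θ => ENNReal.ofReal (q x θ))
    (fun θ => by simp only [hq.periodic x θ]) Real.two_pi_pos θ'

/-- First half of Schur's test: Cauchy–Schwarz with the kernel as weight, whose total mass does not
depend on the direction `p.2` by periodicity. -/
theorem sq_lintegral_le (hq : IsKernel q) (hu : Measurable u) (p : Phase) :
    (ENNReal.ofReal (2 * Real.pi)⁻¹ * ∫⁻ θ in Ioc 0 (2 * Real.pi),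
      ENNReal.ofReal (q p.1 (p.2 - θ)) * ‖u (p.1, θ)‖ₑ) ^ 2 ≤ mean q p.1 * scatterSq q u p := by
  have h := sq_lintegral_mul_le (μ := volume.restrict (Ioc 0 (2 * Real.pi)))
    (hq.measurable_sub.comp (measurable_prodMk_left (x := p))).ennreal_ofReal.aemeasurable
    ((measurable_fiber hu).comp (measurable_prodMk_left (x := p))).enorm.aemeasurable
  simp only [Function.comp_def] at h
  rw [hq.setLIntegral_sub_left p.1 p.2] at h
  rw [mul_pow, mean, scatterSq, mul_mul_mul_comm, ← sq]
  gcongr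

theorem enorm_scatter_sq_le (hq : IsKernel q) (hu : Measurable u) (p : Phase) :
    ‖scatter q u p‖ₑ ^ 2 ≤ mean q p.1 * scatterSq q u p := by
  refine le_trans (pow_le_pow_left' ?_ 2) (hq.sq_lintegral_le hu p)
  rw [scatter_eq, enorm_mul]
  gcongr
  · rw [← ofReal_norm, norm_inv]
    simp [abs_of_pos Real.pi_pos]
  · refine (enorm_integral_le_lintegral_enorm _).trans_eq ?_
    simp only [hq.enorm_ofReal_mul]

/-- Second half of Schur's test: after Tonelli the kernel is integrated in its other angle, which by
translation invariance gives the same mass. The mean depends on `x` only, so the identity is exact.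
-/
theorem lintegral_scatterSq (hq : IsKernel q) (hu : Measurable u) :
    ∫⁻ p, scatterSq q u p ∂D.liouville = ∫⁻ p, mean q p.1 * ‖u p‖ₑ ^ 2 ∂D.liouville := by
  have hm : Measurable fun p : Phase => mean q p.1 * ‖u p‖ₑ ^ 2 :=
    (hq.measurable_mean.comp measurable_fst).mul (hu.enorm.pow_const 2)
  rw [liouville, lintegral_prod _ (hq.measurable_scatterSq hu).aemeasurable,
    lintegral_prod _ hm.aemeasurable]
  refine lintegral_congr fun x => ?_
  have hux : Measurable fun θ : ℝ => ‖u (x, θ)‖ₑ ^ 2 :=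
    (hu.comp measurable_prodMk_left).enorm.pow_const 2
  have hqx : Measurable fun z : ℝ × ℝ => ENNReal.ofReal (q x (z.1 - z.2)) :=
    (hq.measurable.comp (measurable_const.prodMk (measurable_fst.sub measurable_snd))).ennreal_ofReal
  have hpr : Measurable fun z : ℝ × ℝ => ENNReal.ofReal (q x (z.1 - z.2)) * ‖u (x, z.2)‖ₑ ^ 2 :=
    hqx.mul (hux.comp measurable_snd)
  simp only [scatterSq, mean]
  rw [lintegral_const_mul _ hux, lintegral_const_mul _
    (Measurable.lintegral_prod_right' hpr), mul_assoc]
  congr 1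
  rw [lintegral_lintegral_swap hpr.aemeasurable,
    ← lintegral_const_mul _ hux]
  refine lintegral_congr fun θ' => ?_
  simp only
  rw [lintegral_mul_const, hq.setLIntegral_sub_right]
  exact hqx.comp (measurable_id.prodMk measurable_const)

end IsKernel

theorem ae_of_ae_Ioc {T : ℝ} (hT : 0 < T) {P : ℝ → Prop} (hP : Function.Periodic P T)
    (h : ∀ᵐ x ∂volume.restrict (Ioc 0 T), P x) : ∀ᵐ x, P x := by
  have : VAddInvariantMeasure (AddSubgroup.zmultiples T) ℝ volume :=
    ⟨fun c s _ => measure_preimage_add _ _ _⟩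
  refine (isAddFundamentalDomain_Ioc hT 0).measure_zero_of_invariant {x | ¬ P x} (fun g => ?_) ?_
  · ext x
    rw [mem_vadd_set_iff_neg_vadd_mem]
    simp only [mem_ofPred_eq, hP.map_vadd_zmultiples]
  · rw [ae_restrict_iff' measurableSet_Ioc] at h
    rw [zero_add]
    refine measure_mono_null (fun x hx => ?_) h
    exact fun h' => hx.1 (h' hx.2)

/-- Admissible scattering coefficients agree almost everywhere with a measurable kernel. -/
theorem Admissible.exists_isKernel {a : Plane → ℝ} {k : Plane → ℝ → ℝ} (hak : D.Admissible a k) :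
    ∃ q, IsKernel q ∧ ∀ᵐ x ∂D.gArea, (∀ θ, ∀ᵐ θ' ∂volume.restrict (Ioc 0 (2 * Real.pi)),
      k x (θ - θ') = q x (θ - θ')) ∧ 0 ≤ meanScatter k x ∧
      IsKernel.mean q x = ENNReal.ofReal (meanScatter k x) := by
  have hpi := Real.two_pi_pos
  set k₀ := hak.k_measurable.mk with hk₀
  have hk₀m : Measurable k₀ := hak.k_measurable.stronglyMeasurable_mk.measurable
  -- A measurable representative on one period is extended periodically through `Int.fract` and
  -- truncated at zero. It agrees with `k` for almost every angle over almost every `x`, hence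
  -- defines the same scattering integrals for every direction.
  refine ⟨fun x θ => max (k₀ (x, Int.fract (θ / (2 * Real.pi)) * (2 * Real.pi))) 0,
    ⟨(hk₀m.comp (measurable_fst.prodMk (((measurable_snd.div_const _).fract).mul_const _))).max
      measurable_const, fun x θ => le_max_right _ _, fun x θ => ?_⟩, ?_⟩
  · rw [add_div, div_self hpi.ne', Int.fract_add_one]
  have h1 : ∀ᵐ x ∂D.gArea, ∀ᵐ θ ∂volume.restrict (Ioc 0 (2 * Real.pi)), k x θ = k₀ (x, θ) :=
    Measure.ae_ae_of_ae_prod hak.k_measurable.ae_eq_mk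
  filter_upwards [h1, D.ae_gArea_iff.2 hak.k_nonneg, D.ae_gArea_iff.2 hak.k_integrable,
    D.ae_gArea_iff.2 (ae_restrict_mem D.isClosed_M.measurableSet)] with x hx hx0 hxi hxM
  have h2 : ∀ᵐ θ ∂volume.restrict (Ioc 0 (2 * Real.pi)), θ ≠ 2 * Real.pi :=
    ae_restrict_of_ae (Measure.ae_ne volume _)
  have h3 : ∀ᵐ θ ∂volume.restrict (Ioc 0 (2 * Real.pi)), θ ∈ Ioc 0 (2 * Real.pi) :=
    ae_restrict_mem measurableSet_Ioc
  have h4 : ∀ᵐ θ ∂volume.restrict (Ioc 0 (2 * Real.pi)),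
      k x θ = max (k₀ (x, Int.fract (θ / (2 * Real.pi)) * (2 * Real.pi))) 0 := by
    filter_upwards [hx, hx0, h2, h3] with θ e1 e2 e3 e4
    have e5 : θ / (2 * Real.pi) < 1 := (div_lt_one hpi).2 (lt_of_le_of_ne e4.2 e3)
    rw [Int.fract_eq_self.2 ⟨(div_pos e4.1 hpi).le, e5⟩, div_mul_cancel₀ _ hpi.ne', ← e1,
      max_eq_left e2]
  have h5 : 0 ≤ meanScatter k x := by
    rw [meanScatter, intervalIntegral.integral_of_le hpi.le]
    exact mul_nonneg (by positivity) (integral_nonneg_of_ae hx0)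
  refine ⟨fun θ => ?_, h5, ?_⟩
  · have h6 := ae_of_ae_Ioc hpi (fun θ => by
      simp only [hak.k_periodic x hxM θ]
      rw [add_div, div_self hpi.ne', Int.fract_add_one]) h4
    exact ae_restrict_of_ae
      ((Measure.measurePreserving_sub_left volume θ).quasiMeasurePreserving.ae h6)
  · rw [IsKernel.mean, meanScatter, intervalIntegral.integral_of_le hpi.le,
      ENNReal.ofReal_mul (by positivity), ofReal_integral_eq_lintegral_ofReal hxi hx0]
    congr 1
    refine lintegral_congr_ae ?_
    filter_upwards [h4] with θ hθ
    rw [hθ]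

end ConformalDomain

section L2

variable {α : Type*} [MeasurableSpace α] {μ : Measure α}

theorem sq_eLpNorm_two (f : α → ℂ) : eLpNorm f 2 μ ^ 2 = ∫⁻ a, ‖f a‖ₑ ^ 2 ∂μ := by
  have h := eLpNorm_nnreal_pow_eq_lintegral (f := f) (p := 2) (μ := μ) (by norm_num)
  simpa using h

theorem eLpNorm_two_le_of_sq_le {f g : α → ℂ} {C : ℝ≥0∞}
    (h : ∫⁻ a, ‖f a‖ₑ ^ 2 ∂μ ≤ C ^ 2 * ∫⁻ a, ‖g a‖ₑ ^ 2 ∂μ) :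
    eLpNorm f 2 μ ≤ C * eLpNorm g 2 μ := by
  rw [← sq_eLpNorm_two, ← sq_eLpNorm_two, ← mul_pow] at h
  exact (ENNReal.pow_right_strictMono two_ne_zero).le_iff_le.1 h

theorem Lp.sq_norm_eq_integral (f : Lp ℂ 2 μ) : ‖f‖ ^ 2 = ∫ a, ‖f a‖ ^ 2 ∂μ := by
  have h : (inner ℂ f f : ℂ) = ((∫ a, ‖f a‖ ^ 2 ∂μ : ℝ) : ℂ) := by
    rw [L2.inner_def, ← integral_complex_ofReal]
    refine integral_congr_ae (ae_of_all _ fun a => ?_)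
    simp [inner_self_eq_norm_sq_to_K]
  rw [inner_self_eq_norm_sq_to_K] at h
  have h' : ((‖f‖ : ℝ) : ℂ) ^ 2 = ((∫ a, ‖f a‖ ^ 2 ∂μ : ℝ) : ℂ) := h
  exact_mod_cast h'

end L2

namespace ConformalDomain

variable {D : ConformalDomain}

/-- If `ρ` were nonnegative everywhere, the boundary would consist of minima of `ρ`, against
regularity. So `M` has positive area, and almost-everywhere bounds can be evaluated at a point. -/
theorem interior_M_nonempty (D : ConformalDomain) : (interior D.M).Nonempty := by
  rw [interior_M]
  by_contra! hemp
  have h : ∀ x, 0 ≤ D.ρ x := fun x => not_lt.1 fun hx => notMem_empty x (hemp ▸ hx)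
  have hx := D.bdry_mem 0
  refine D.ρ_regular _ hx ?_
  have hmin : IsLocalMin D.ρ (D.bdry 0) := Eventually.of_forall fun y => by
    rw [show D.ρ (D.bdry 0) = 0 from hx]; exact h y
  rw [gradient, hmin.fderiv_eq_zero, map_zero]

instance : (ae D.areaM).NeBot := by
  rw [ae_neBot, areaM, Ne, Measure.restrict_eq_zero]
  intro h
  exact (isOpen_interior.measure_pos volume D.interior_M_nonempty).ne'
    (measure_mono_null interior_subset h)

theorem ae_liouville_fst {P : Plane → Prop} (h : ∀ᵐ x ∂D.areaM, P x) :
    ∀ᵐ p ∂D.liouville, P p.1 :=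
  Measure.quasiMeasurePreserving_fst.ae (D.ae_gArea_iff.2 h)

/-- Bounds for the optical parameters in terms of the essential suprema in `Qinf`. -/
theorem exists_bounds {a : Plane → ℝ} {k : Plane → ℝ → ℝ} {δ : ℝ} (hδ : 0 < δ)
    (hak : D.Admissible a k) (hsub : D.Subcritical a k δ) :
    ∃ A σ : ℝ, 0 ≤ A ∧ 0 ≤ σ ∧ D.Qinf a k = A + σ ∧ (∀ᵐ x ∂D.areaM, a x ≤ A) ∧
      ∀ᵐ x ∂D.areaM, meanScatter k x ≤ σ := by
  have hpi := Real.two_pi_pos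
  obtain ⟨q, -, hq⟩ := hak.exists_isKernel
  have hm : ∀ᵐ x ∂D.areaM, 0 ≤ meanScatter k x := D.ae_gArea_iff.1 (hq.mono fun x hx => hx.2.1)
  have hI : ∀ x, ∫ α in (0 : ℝ)..(2 * Real.pi), k x α = 2 * Real.pi * meanScatter k x := fun x => by
    rw [meanScatter]; field_simp
  obtain ⟨N, hN⟩ : ∃ N : ℝ, ∀ᵐ x ∂D.areaM, ‖a x‖ ≤ N := by
    refine ⟨(eLpNorm a ⊤ D.areaM).toReal, ?_⟩
    filter_upwards [ae_le_eLpNormEssSup (f := a) (μ := D.areaM)] with x hx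
    rw [← toReal_enorm]
    exact ENNReal.toReal_mono hak.a_memLp.2.ne (by rwa [eLpNorm_exponent_top])
  -- A real `essSup` is an upper bound only for essentially bounded functions. For the mass of the
  -- kernel, boundedness follows from subcriticality, which puts its mean below `a`.
  have b1 : IsBoundedUnder (· ≤ ·) (ae D.areaM) a :=
    ⟨N, eventually_map.2 (hN.mono fun x hx => (le_abs_self _).trans hx)⟩
  have b2 : IsBoundedUnder (· ≤ ·) (ae D.areaM)
      fun x => ∫ α in (0 : ℝ)..(2 * Real.pi), k x α := by
    refine ⟨2 * Real.pi * N, eventually_map.2 ?_⟩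
    filter_upwards [hN, hsub] with x h1 h2
    rw [hI]
    gcongr
    linarith [(le_abs_self (a x)).trans h1]
  have e1 := ae_le_essSup b1
  have e2 := ae_le_essSup b2
  refine ⟨_, _, ?_, ?_, rfl, e1, ?_⟩
  · obtain ⟨x, h1, h2⟩ := (e1.and hak.a_nonneg).exists
    exact h2.trans h1
  · obtain ⟨x, h1, h2⟩ := (e2.and hm).exists
    refine le_trans ?_ h1
    rw [hI]; positivity
  · filter_upwards [e2, hm] with x h1 h2
    rw [hI] at h1
    -- `Q_∞` contains the full mass `2 π * meanScatter`, which dominates the mean.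
    nlinarith [Real.pi_gt_three]

/-- The operator of multiplication by `a` minus scattering. -/
theorem exists_collision {a : Plane → ℝ} {k : Plane → ℝ → ℝ} {δ : ℝ} (hδ : 0 < δ)
    (hak : D.Admissible a k) (hsub : D.Subcritical a k δ) :
    ∃ B : D.L2SM →L[ℂ] D.L2SM,
      (∀ u : D.L2SM, B u =ᵐ[D.liouville] fun p => (a p.1 : ℂ) * u p - scatter k u p) ∧
      (∀ u, δ * ‖u‖ ^ 2 ≤ (inner ℂ u (B u) : ℂ).re) ∧ ∀ u, ‖B u‖ ≤ D.Qinf a k * ‖u‖ := by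
  obtain ⟨A, σ, hA, hσ, hQ, haA, hkσ⟩ := exists_bounds hδ hak hsub
  obtain ⟨q, hq, hkq⟩ := hak.exists_isKernel
  have hkq' : ∀ᵐ p ∂D.liouville, ∀ u : Phase → ℂ, scatter k u p = scatter q u p := by
    filter_upwards [Measure.quasiMeasurePreserving_fst.ae hkq] with p hp u
    rw [IsKernel.scatter_eq, IsKernel.scatter_eq]
    congr 1
    refine integral_congr_ae ?_
    filter_upwards [hp.1 p.2] with θ hθ
    rw [hθ]
  have hmean : ∀ᵐ p ∂D.liouville, IsKernel.mean q p.1 = ENNReal.ofReal (meanScatter k p.1) ∧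
      0 ≤ meanScatter k p.1 := by
    filter_upwards [Measure.quasiMeasurePreserving_fst.ae hkq] with p hp using ⟨hp.2.2, hp.2.1⟩
  have hmσ : ∀ᵐ p ∂D.liouville, IsKernel.mean q p.1 ≤ ENNReal.ofReal σ := by
    filter_upwards [hmean, ae_liouville_fst hkσ] with p h1 h2
    rw [h1.1]; exact ENNReal.ofReal_le_ofReal h2
  have hm (u : D.L2SM) : Measurable u := (Lp.stronglyMeasurable u).measurable
  have hfin (u : D.L2SM) : ∫⁻ p, ‖u p‖ₑ ^ 2 ∂D.liouville ≠ ⊤ := by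
    rw [← sq_eLpNorm_two]
    exact ENNReal.pow_ne_top (Lp.memLp u).2.ne
  have hSqle (u : D.L2SM) : ∫⁻ p, IsKernel.scatterSq q u p ∂D.liouville ≤
      ENNReal.ofReal σ * ∫⁻ p, ‖u p‖ₑ ^ 2 ∂D.liouville := by
    rw [hq.lintegral_scatterSq (hm u), ← lintegral_const_mul _ ((hm u).enorm.pow_const 2)]
    refine lintegral_mono_ae ?_
    filter_upwards [hmσ] with p hp
    gcongr
  have hSqfin (u : D.L2SM) : ∫⁻ p, IsKernel.scatterSq q u p ∂D.liouville ≠ ⊤ :=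
    ((hSqle u).trans_lt (ENNReal.mul_lt_top ENNReal.ofReal_lt_top (hfin u).lt_top)).ne
  have hSq (u : D.L2SM) : ∀ᵐ p ∂D.liouville, IsKernel.scatterSq q u p < ⊤ :=
    ae_lt_top (hq.measurable_scatterSq (hm u)) (hSqfin u)
  -- Schur's test: the supremum of the mean bounds both marginals of the kernel.
  have hS (u : D.L2SM) : eLpNorm (scatter q u) 2 D.liouville ≤
      ENNReal.ofReal σ * eLpNorm u 2 D.liouville := by
    refine eLpNorm_two_le_of_sq_le ?_
    calc ∫⁻ p, ‖scatter q u p‖ₑ ^ 2 ∂D.liouville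
        ≤ ∫⁻ p, ENNReal.ofReal σ * IsKernel.scatterSq q u p ∂D.liouville := by
          refine lintegral_mono_ae ?_
          filter_upwards [hmσ] with p hp
          exact (hq.enorm_scatter_sq_le (hm u) p).trans (by gcongr)
      _ = ENNReal.ofReal σ * ∫⁻ p, IsKernel.scatterSq q u p ∂D.liouville :=
          lintegral_const_mul _ (hq.measurable_scatterSq (hm u))
      _ ≤ _ := by
          rw [sq, mul_assoc]
          gcongr
          exact hSqle u
  -- Additivity of `scatter` needs integrability on almost every fibre, as the integral is zero by
  -- default otherwise.
  have hint (u : D.L2SM) : ∀ᵐ p ∂D.liouville, Integrable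
      (fun θ => (q p.1 (p.2 - θ) : ℂ) * u (p.1, θ)) (volume.restrict (Ioc 0 (2 * Real.pi))) := by
    filter_upwards [hSq u, hmσ] with p h1 h2
    have hmeas : Measurable fun θ => (q p.1 (p.2 - θ) : ℂ) * u (p.1, θ) :=
      (Complex.measurable_ofReal.comp (hq.measurable_sub.comp (measurable_prodMk_left (x := p)))).mul
        ((IsKernel.measurable_fiber (hm u)).comp (measurable_prodMk_left (x := p)))
    refine ⟨hmeas.aestronglyMeasurable, ?_⟩
    have h3 := (hq.sq_lintegral_le (hm u) p).trans_lt
      (ENNReal.mul_lt_top (h2.trans_lt ENNReal.ofReal_lt_top) h1)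
    rw [HasFiniteIntegral]
    simp only [hq.enorm_ofReal_mul]
    have h4 := (ENNReal.pow_lt_top_iff.1 h3).resolve_right (by norm_num)
    refine (ENNReal.mul_lt_top_iff.1 h4).elim And.right fun h => ?_
    rcases h with h | h
    · rw [ENNReal.ofReal_eq_zero] at h
      exact absurd h (not_le.2 (by positivity))
    · rw [h]; exact ENNReal.zero_lt_top
  have hcongr {u v : Phase → ℂ} (huv : u =ᵐ[D.liouville] v) :
      ∀ᵐ p ∂D.liouville, scatter q u p = scatter q v p := by
    have h1 : ∀ᵐ x ∂D.gArea, ∀ᵐ θ ∂volume.restrict (Ioc 0 (2 * Real.pi)), u (x, θ) = v (x, θ) :=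
      Measure.ae_ae_of_ae_prod huv
    filter_upwards [Measure.quasiMeasurePreserving_fst.ae h1] with p hp
    rw [IsKernel.scatter_eq, IsKernel.scatter_eq]
    congr 1
    refine integral_congr_ae ?_
    filter_upwards [hp] with θ hθ
    rw [hθ]
  have hamem : AEStronglyMeasurable (fun p : Phase => (a p.1 : ℂ)) D.liouville := by
    have h1 : AEStronglyMeasurable a D.gArea :=
      hak.a_memLp.1.mono_ac (withDensity_absolutelyContinuous _ _)
    exact Complex.continuous_ofReal.comp_aestronglyMeasurable h1.comp_fst
  have hau (u : D.L2SM) : ∀ᵐ p ∂D.liouville, ‖(a p.1 : ℂ) * u p‖ ≤ A * ‖u p‖ := by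
    filter_upwards [ae_liouville_fst haA, ae_liouville_fst hak.a_nonneg] with p h1 h2
    rw [norm_mul, Complex.norm_real, Real.norm_of_nonneg h2]
    gcongr
  have ham (u : D.L2SM) : MemLp (fun p => (a p.1 : ℂ) * u p) 2 D.liouville :=
    (Lp.memLp u).of_le_mul (hamem.mul (Lp.aestronglyMeasurable u)) (hau u)
  have hsm (u : D.L2SM) : MemLp (scatter q u) 2 D.liouville :=
    ⟨(hq.measurable_scatter (hm u)).aestronglyMeasurable,
      (hS u).trans_lt (ENNReal.mul_lt_top ENNReal.ofReal_lt_top (Lp.memLp u).2)⟩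
  have hmem (u : D.L2SM) : MemLp (fun p => (a p.1 : ℂ) * u p - scatter q u p) 2 D.liouville :=
    (ham u).sub (hsm u)
  have hnorm (u : D.L2SM) : ‖(hmem u).toLp‖ ≤ (A + σ) * ‖u‖ := by
    have h1 : ‖(ham u).toLp‖ ≤ A * ‖u‖ := by
      refine Lp.norm_le_mul_norm_of_ae_le_mul ?_
      filter_upwards [(ham u).coeFn_toLp, hau u] with p h1 h2
      rw [h1]; exact h2
    have h2 : ‖(hsm u).toLp‖ ≤ σ * ‖u‖ := by
      rw [Lp.norm_toLp, Lp.norm_def, ← ENNReal.toReal_ofReal hσ, ← ENNReal.toReal_mul]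
      exact ENNReal.toReal_mono (ENNReal.mul_ne_top ENNReal.ofReal_ne_top (Lp.memLp u).2.ne) (hS u)
    have h3 : (hmem u).toLp = (ham u).toLp - (hsm u).toLp := MemLp.toLp_sub (ham u) (hsm u)
    rw [h3, add_mul]
    exact (norm_sub_le _ _).trans (add_le_add h1 h2)
  let T : D.L2SM →ₗ[ℂ] D.L2SM :=
    { toFun := fun u => (hmem u).toLp
      map_add' := fun u v => by
        refine Lp.ext ?_
        filter_upwards [(hmem (u + v)).coeFn_toLp, Lp.coeFn_add (hmem u).toLp (hmem v).toLp,
          (hmem u).coeFn_toLp, (hmem v).coeFn_toLp, Lp.coeFn_add u v, hcongr (Lp.coeFn_add u v),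
          hint u, hint v] with p h1 h2 h3 h4 h5 h6 h7 h8
        have h9 : scatter q (u + v : Phase → ℂ) p = scatter q u p + scatter q v p := by
          simp only [IsKernel.scatter_eq, Pi.add_apply, mul_add]
          rw [integral_add h7 h8, mul_add]
        rw [h1, h2, Pi.add_apply, h3, h4, h5, h6, h9, Pi.add_apply]
        ring
      map_smul' := fun c u => by
        refine Lp.ext ?_
        filter_upwards [(hmem (c • u)).coeFn_toLp, Lp.coeFn_smul c (hmem u).toLp,
          (hmem u).coeFn_toLp, Lp.coeFn_smul c u, hcongr (Lp.coeFn_smul c u)] with p h1 h2 h3 h4 h5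
        have h9 : scatter q (c • u : Phase → ℂ) p = c * scatter q u p := by
          simp only [IsKernel.scatter_eq, Pi.smul_apply, smul_eq_mul, mul_left_comm _ c]
          rw [integral_const_mul]
          ring
        rw [h1, RingHom.id_apply, h2, Pi.smul_apply, h3, h4, h5, h9, Pi.smul_apply, smul_eq_mul,
          smul_eq_mul]
        ring }
  have hBae (u : D.L2SM) : T.mkContinuous (A + σ) hnorm u =ᵐ[D.liouville]
      fun p => (a p.1 : ℂ) * u p - scatter q u p := (hmem u).coeFn_toLp
  refine ⟨T.mkContinuous (A + σ) hnorm, fun u => ?_, fun u => ?_, fun u => ?_⟩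
  · filter_upwards [hBae u, hkq'] with p h1 h2
    rw [h1, h2]
  · rw [L2.inner_def]
    have hre := integral_re (𝕜 := ℂ) (L2.integrable_inner (𝕜 := ℂ) u (T.mkContinuous (A + σ) hnorm u))
    simp only [RCLike.re_eq_complex_re] at hre
    rw [← hre, Lp.sq_norm_eq_integral, ← integral_const_mul]
    set g₁ : Phase → ℝ := fun p => (IsKernel.mean q p.1 * ‖u p‖ₑ ^ 2).toReal with hg₁
    set g₂ : Phase → ℝ := fun p => (IsKernel.scatterSq q u p).toReal with hg₂
    have hmm : Measurable fun p : Phase => IsKernel.mean q p.1 * ‖u p‖ₑ ^ 2 :=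
      (hq.measurable_mean.comp measurable_fst).mul ((hm u).enorm.pow_const 2)
    have hl := hq.lintegral_scatterSq (D := D) (hm u)
    have i1 : Integrable g₁ D.liouville :=
      integrable_toReal_of_lintegral_ne_top hmm.aemeasurable (hl ▸ hSqfin u)
    have i2 : Integrable g₂ D.liouville :=
      integrable_toReal_of_lintegral_ne_top (hq.measurable_scatterSq (hm u)).aemeasurable (hSqfin u)
    have hg : ∫ p, g₁ p ∂D.liouville = ∫ p, g₂ p ∂D.liouville := by
      rw [integral_toReal hmm.aemeasurable (ae_lt_top hmm (hl ▸ hSqfin u)),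
        integral_toReal (hq.measurable_scatterSq (hm u)).aemeasurable (hSq u), hl]
    have i0 : Integrable (fun p => δ * ‖u p‖ ^ 2) D.liouville :=
      ((Lp.memLp u).integrable_norm_pow (by norm_num)).const_mul _
    -- `g₁` and `g₂` have the same integral, so half of their difference can be added freely. This
    -- turns coercivity, which holds only after integration, into a pointwise inequality.
    have hsum : ∫ p, δ * ‖u p‖ ^ 2 ∂D.liouville =
        ∫ p, (δ * ‖u p‖ ^ 2 + (1 / 2) * (g₁ p - g₂ p)) ∂D.liouville := by
      rw [integral_add i0 (by exact (i1.sub i2).const_mul _), integral_const_mul (1 / 2), integral_sub i1 i2,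
        hg]
      simp
    rw [hsum]
    refine integral_mono_ae (i0.add ((i1.sub i2).const_mul _))
      (L2.integrable_inner (𝕜 := ℂ) u _).re ?_
    filter_upwards [hBae u, hmean, hSq u, ae_liouville_fst hsub] with p h1 h2 h3 h4
    have h5 : ‖scatter q u p‖ ^ 2 ≤ meanScatter k p.1 * g₂ p := by
      have h6 := hq.enorm_scatter_sq_le (hm u) p
      rw [h2.1] at h6
      have h7 := ENNReal.toReal_mono (ENNReal.mul_ne_top ENNReal.ofReal_ne_top h3.ne) h6
      rwa [ENNReal.toReal_pow, toReal_enorm, ENNReal.toReal_mul, ENNReal.toReal_ofReal h2.2] at h7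
    have h8 : g₁ p = meanScatter k p.1 * ‖u p‖ ^ 2 := by
      simp only [hg₁]
      rw [h2.1, ENNReal.toReal_mul, ENNReal.toReal_ofReal h2.2, ENNReal.toReal_pow, toReal_enorm]
    have h9 : (inner ℂ (u p) ((a p.1 : ℂ) * u p - scatter q u p) : ℂ).re =
        a p.1 * ‖u p‖ ^ 2 - (inner ℂ (u p) (scatter q u p) : ℂ).re := by
      rw [inner_sub_right, Complex.sub_re, ← smul_eq_mul, inner_smul_right,
        inner_self_eq_norm_sq_to_K]
      simp [← Complex.ofReal_pow]
    have h10 : (inner ℂ (u p) (scatter q u p) : ℂ).re ≤ ‖u p‖ * ‖scatter q u p‖ :=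
      re_inner_le_norm (𝕜 := ℂ) (u p) (scatter q u p)
    -- The inequality of arithmetic and geometric means for `g₁ = meanScatter * |u|²` and `g₂`.
    have h11 : ‖u p‖ * ‖scatter q u p‖ ≤ (1 / 2) * (g₁ p + g₂ p) := by
      have hg0 : 0 ≤ g₂ p := ENNReal.toReal_nonneg
      refine abs_le_of_sq_le_sq' ?_ ?_ |>.2
      · rw [mul_pow, h8]
        calc ‖u p‖ ^ 2 * ‖scatter q u p‖ ^ 2 ≤ ‖u p‖ ^ 2 * (meanScatter k p.1 * g₂ p) := by gcongr
          _ ≤ _ := by nlinarith [sq_nonneg (meanScatter k p.1 * ‖u p‖ ^ 2 - g₂ p)]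
      · have : 0 ≤ g₁ p := ENNReal.toReal_nonneg
        positivity
    have h12 : (δ + meanScatter k p.1) * ‖u p‖ ^ 2 ≤ a p.1 * ‖u p‖ ^ 2 := by
      gcongr; linarith
    simp only [h1]
    show _ ≤ (inner ℂ (u p) ((a p.1 : ℂ) * u p - scatter q u p) : ℂ).re
    rw [h9]
    rw [add_mul, ← h8] at h12
    linarith
  · rw [hQ]; exact hnorm u

end ConformalDomain

/-! ### Coercive perturbations of accretive operators -/

section Accretive

variable {H E : Type*} [NormedAddCommGroup H] [InnerProductSpace ℂ H]
  [NormedAddCommGroup E] [NormedSpace ℂ E] {U W : E →L[ℂ] H}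

/-- The a priori estimate: in the pairing of `U e` with the right-hand side, accretivity allows the
transport term to be dropped. It gives injectivity, closed range and the final norm bound. -/
theorem coercive_mul_norm_le (hmono : ∀ e, 0 ≤ (inner ℂ (U e) (W e) : ℂ).re) {B : H →L[ℂ] H}
    {δ : ℝ} (hB : ∀ u, δ * ‖u‖ ^ 2 ≤ (inner ℂ u (B u) : ℂ).re) (e : E) :
    δ * ‖U e‖ ≤ ‖W e + B (U e)‖ := by
  rcases (norm_nonneg (U e)).eq_or_lt with h | h
  · rw [← h, mul_zero]; exact norm_nonneg _
  · refine le_of_mul_le_mul_right ?_ h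
    have h1 : (inner ℂ (U e) (W e + B (U e)) : ℂ).re ≤ ‖U e‖ * ‖W e + B (U e)‖ :=
      re_inner_le_norm (𝕜 := ℂ) _ _
    rw [inner_add_right, Complex.add_re] at h1
    nlinarith [hmono e, hB (U e)]

/-- A coercive bounded perturbation of a maximal accretive operator is boundedly invertible. The
operator is given by its graph `{(U e, W e)}`. -/
theorem bijective_of_accretive [CompleteSpace H] [CompleteSpace E]
    (hmono : ∀ e, 0 ≤ (inner ℂ (U e) (W e) : ℂ).re) {C : ℝ}
    (hC : ∀ e, ‖e‖ ≤ C * (‖U e‖ + ‖W e‖))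
    (hdense : ∀ l : ℝ, 0 < l → ∀ v : H, (∀ e, inner ℂ v (W e + (l : ℂ) • U e) = (0 : ℂ)) → v = 0)
    {B : H →L[ℂ] H} {δ : ℝ} (hδ : 0 < δ)
    (hB : ∀ u, δ * ‖u‖ ^ 2 ≤ (inner ℂ u (B u) : ℂ).re) :
    Function.Bijective (W + B ∘L U) := by
  have hclosed : ∀ (B : H →L[ℂ] H) (δ : ℝ), 0 < δ →
      (∀ u, δ * ‖u‖ ^ 2 ≤ (inner ℂ u (B u) : ℂ).re) →
      ∃ K, AntilipschitzWith K (W + B ∘L U) := by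
    intro B δ hδ hB
    refine ⟨(|C| * (1 / δ + (1 + ‖B‖ / δ))).toNNReal,
      AddMonoidHomClass.antilipschitz_of_bound _ fun e => ?_⟩
    rw [Real.coe_toNNReal _ (by positivity)]
    have h1 := coercive_mul_norm_le hmono hB e
    set t := ‖(W + B ∘L U) e‖ with ht
    change δ * ‖U e‖ ≤ t at h1
    have h2 : ‖U e‖ ≤ t / δ := by rw [le_div_iff₀ hδ]; linarith
    have h3 : ‖W e‖ ≤ t + ‖B‖ * (t / δ) := by
      calc ‖W e‖ = ‖(W + B ∘L U) e - B (U e)‖ := by simp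
        _ ≤ t + ‖B (U e)‖ := norm_sub_le _ _
        _ ≤ t + ‖B‖ * (t / δ) := by
          gcongr
          exact (B.le_opNorm _).trans (by gcongr)
    calc ‖e‖ ≤ C * (‖U e‖ + ‖W e‖) := hC e
      _ ≤ |C| * (t / δ + (t + ‖B‖ * (t / δ))) := by
        gcongr
        exact le_abs_self C
      _ = _ := by ring
  -- The range is closed by the a priori estimate, so it is everything once its orthogonal
  -- complement is trivial.
  have hsurj : ∀ (B : H →L[ℂ] H) (δ : ℝ), 0 < δ →
      (∀ u, δ * ‖u‖ ^ 2 ≤ (inner ℂ u (B u) : ℂ).re) →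
      (∀ v : H, (∀ e, inner ℂ v ((W + B ∘L U) e) = (0 : ℂ)) → v = 0) →
      Function.Surjective (W + B ∘L U) := by
    intro B δ hδ hB hv
    obtain ⟨K, hK⟩ := hclosed B δ hδ hB
    have hcl : IsClosed ((W + B ∘L U).range : Set H) :=
      hK.isClosed_range (W + B ∘L U).uniformContinuous
    have htop : (W + B ∘L U).range = ⊤ := by
      rw [← hcl.submodule_topologicalClosure_eq, Submodule.topologicalClosure_eq_top_iff,
        Submodule.eq_bot_iff]
      intro v hv'
      refine hv v fun e => ?_
      rw [← inner_conj_symm]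
      exact (congrArg _ ((Submodule.mem_orthogonal _ _).1 hv' _ ⟨e, rfl⟩)).trans (map_zero _)
    exact LinearMap.range_eq_top.1 htop
  refine ⟨(hclosed B δ hδ hB).choose_spec.injective, hsurj B δ hδ hB fun v hv => ?_⟩
  -- With this `l`, coercivity gives `‖(B - l) u‖² ≤ (l² - 1) ‖u‖²`, while the equation with damping
  -- `l` is solvable with `l ‖U e‖ ≤ ‖v‖`. If `v` is orthogonal to the range and `W e + l U e = v`,
  -- then `d = (B - l) U e` satisfies `‖v‖ ≤ ‖d‖`; the three inequalities force `U e = 0`, so `d =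
  -- 0` and `v = 0`.
  set l : ℝ := (‖B‖ ^ 2 + 1) / (2 * δ) with hl
  have hl0 : 0 < l := by positivity
  have hlδ : 2 * l * δ = ‖B‖ ^ 2 + 1 := by rw [hl]; field_simp
  have hlB : ∀ u, l * ‖u‖ ^ 2 ≤ (inner ℂ u (((l : ℂ) • ContinuousLinearMap.id ℂ H) u) : ℂ).re := by
    intro u
    simp [inner_self_eq_norm_sq_to_K, ← Complex.ofReal_pow]
  obtain ⟨e, he⟩ := hsurj _ l hl0 hlB (fun v hv => hdense l hl0 v fun e => by simpa using hv e) v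
  have hlU := coercive_mul_norm_le hmono hlB e
  have he' : W e + (l : ℂ) • U e = v := by simpa using he
  simp only [smul_apply, ContinuousLinearMap.id_apply, he'] at hlU
  set d := B (U e) - (l : ℂ) • U e with hd
  have h1 : (W + B ∘L U) e = v + d := by
    rw [← he', hd]; simp
  have h2 : ‖v‖ ^ 2 ≤ ‖v‖ * ‖d‖ := by
    have h3 := hv e
    rw [h1, inner_add_right, inner_self_eq_norm_sq_to_K] at h3
    have h4 := congrArg Complex.re h3
    have h5 : -(inner ℂ v d : ℂ).re ≤ ‖v‖ * ‖d‖ :=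
      (neg_le_abs _).trans ((Complex.abs_re_le_norm _).trans (norm_inner_le_norm v d))
    simp [← Complex.ofReal_pow] at h4
    linarith
  have h6 : ‖d‖ ^ 2 ≤ (l ^ 2 - 1) * ‖U e‖ ^ 2 := by
    have h7 : ‖d‖ ^ 2 = ‖B (U e)‖ ^ 2 - 2 * (l * (inner ℂ (U e) (B (U e)) : ℂ).re) +
        l ^ 2 * ‖U e‖ ^ 2 := by
      rw [hd, norm_sub_sq (𝕜 := ℂ), inner_smul_right, norm_smul, ← inner_conj_symm]
      simp only [mul_pow]
      simp
      exact Or.inl (inner_re_symm (𝕜 := ℂ) _ _)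
    have h8 : ‖B (U e)‖ ^ 2 ≤ ‖B‖ ^ 2 * ‖U e‖ ^ 2 := by
      rw [← mul_pow]; gcongr; exact B.le_opNorm _
    nlinarith [mul_le_mul_of_nonneg_left (hB (U e)) hl0.le]
  have h9 : l ^ 2 * ‖U e‖ ^ 2 ≤ ‖v‖ ^ 2 := by
    rw [← mul_pow]; gcongr
  have h10 : ‖v‖ ≤ ‖d‖ := by
    rcases (norm_nonneg v).eq_or_lt with h | h
    · rw [← h]; exact norm_nonneg _
    · nlinarith
  have h11 : ‖U e‖ = 0 := by
    have : ‖v‖ ^ 2 ≤ ‖d‖ ^ 2 := by gcongr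
    nlinarith [sq_nonneg ‖U e‖, norm_nonneg (U e)]
  have h12 : U e = 0 := norm_eq_zero.1 h11
  rw [hd, h12] at h10
  simpa using h10

end Accretive

/-! ### Traces on compact sets and their uniqueness -/

section L2

variable {α : Type*} [MeasurableSpace α] {μ : Measure α}

theorem L2.inner_eq_integral_mul (u v : Lp ℂ 2 μ) :
    (inner ℂ u v : ℂ) = ∫ a, v a * starRingEnd ℂ (u a) ∂μ := by
  rw [L2.inner_def]
  simp [RCLike.inner_apply]

theorem tendsto_integral_mul {f : ℕ → α → ℂ} {f₀ g : α → ℂ} (hf : ∀ n, MemLp (f n) 2 μ)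
    (hf₀ : MemLp f₀ 2 μ) (hg : MemLp g 2 μ)
    (h : Tendsto (fun n => eLpNorm (fun a => f n a - f₀ a) 2 μ) atTop (𝓝 0)) :
    Tendsto (fun n => ∫ a, f n a * g a ∂μ) atTop (𝓝 (∫ a, f₀ a * g a ∂μ)) := by
  have h1 := (Lp.tendsto_Lp_iff_tendsto_eLpNorm'' f hf f₀ hf₀).2 h
  have hg' : MemLp (fun a => starRingEnd ℂ (g a)) 2 μ := hg.star
  have key : ∀ {f : α → ℂ} (hf : MemLp f 2 μ), (inner ℂ hg'.toLp hf.toLp : ℂ) =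
      ∫ a, f a * g a ∂μ := fun hf => by
    rw [L2.inner_eq_integral_mul]
    refine integral_congr_ae ?_
    filter_upwards [hg'.coeFn_toLp, hf.coeFn_toLp] with a e1 e2
    rw [e1, e2]; simp
  have h2 := (tendsto_const_nhds (x := hg'.toLp)).inner (𝕜 := ℂ) h1
  simpa only [key] using h2

theorem lintegral_enorm_sq_eq {f : α → ℂ} (hf : MemLp f 2 μ) :
    ∫⁻ a, ‖f a‖ₑ ^ 2 ∂μ = ENNReal.ofReal (∫ a, ‖f a‖ ^ 2 ∂μ) := by
  rw [ofReal_integral_eq_lintegral_ofReal (hf.integrable_norm_pow (by norm_num))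
    (ae_of_all _ fun _ => sq_nonneg _)]
  simp only [ENNReal.ofReal_pow (norm_nonneg _), ofReal_norm]

end L2

namespace ConformalDomain

variable {D : ConformalDomain}

section Trace

theorem memLp_mu_mul {ψ : Phase → ℂ} (hψ : Continuous ψ) (Z : Set Phase) :
    MemLp (fun p => (D.mu p : ℂ) * ψ p) 2 (D.bdMeasure.restrict Z) := by
  refine MemLp.restrict Z ((memLp_bdMeasure hψ 2).of_le ?_ ?_)
  · exact (Complex.measurable_ofReal.comp D.measurable_mu).aestronglyMeasurable.mul
      hψ.aestronglyMeasurable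
  · filter_upwards [D.ae_bdMeasure_mem] with p hp
    rw [norm_mul, Complex.norm_real, Real.norm_eq_abs]
    exact mul_le_of_le_one_left (norm_nonneg _) (abs_mu_le_one hp.1)

/-- Green's formula for a function whose trace vanishes where the boundary values of the other
function are supported. -/
theorem IsTraceOn.integral_eq {u w : D.L2SM} {Z : Set Phase} (h : D.IsTraceOn u w Z 0)
    {ψ : Phase → ℂ} (hψ : IsSmooth ψ)
    (h0 : ∀ p : Phase, p.1 ∈ D.bd → p.2 ∈ Ioc 0 (2 * Real.pi) → p ∉ Z → ψ p = 0) :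
    ∫ p, u p * D.X ψ p ∂D.liouville = -∫ p, w p * ψ p ∂D.liouville := by
  obtain ⟨φ, hφ, h1, h2, h3⟩ := h
  have hψm : MemLp ψ 2 D.liouville := memLp_liouville hψ.continuous 2
  have hXψm : MemLp (D.X ψ) 2 D.liouville := memLp_liouville hψ.continuous_X 2
  have t1 := tendsto_integral_mul (fun n => memLp_liouville (hφ n).continuous 2) (Lp.memLp u) hXψm h1
  have t2 := tendsto_integral_mul (fun n => memLp_liouville (hφ n).continuous_X 2) (Lp.memLp w)
    hψm h2
  have t3 := tendsto_integral_mul (f₀ := 0)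
    (fun n => (memLp_bdMeasure (D := D) (hφ n).continuous 2).restrict Z) MemLp.zero
    (memLp_mu_mul hψ.continuous Z) h3
  have key : ∀ n, (∫ p, φ n p * D.X ψ p ∂D.liouville) + ∫ p, D.X (φ n) p * ψ p ∂D.liouville =
      ∫ p in Z, φ n p * (D.mu p * ψ p) ∂D.bdMeasure := fun n => by
    have e := integral_X_mul (D := D) (hφ n) hψ
    rw [integral_add (by exact integrable_liouville ((hφ n).continuous_X.mul hψ.continuous))
      (by exact integrable_liouville ((hφ n).continuous.mul hψ.continuous_X)), add_comm] at e
    rw [e, setIntegral_eq_integral_of_ae_compl_eq_zero]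
    · refine integral_congr_ae (ae_of_all _ fun p => ?_)
      simp only [Complex.real_smul]
      ring
    · filter_upwards [D.ae_bdMeasure_mem] with p hp hpZ
      rw [h0 p hp.1 hp.2 hpZ, mul_zero, mul_zero]
  have t4 := t1.add t2
  simp only [key] at t4
  have t5 := tendsto_nhds_unique t4 t3
  simp only [Pi.zero_apply, zero_mul, integral_zero] at t5
  exact eq_neg_of_add_eq_zero_left t5

theorem exists_sq_eLpNorm_le {K : Set Phase} (hK : IsCompact K) (hKout : K ⊆ D.outflow) :
    ∃ C : ℝ≥0∞, C ≠ ⊤ ∧ ∀ φ : Phase → ℂ, IsSmooth φ →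
      eLpNorm φ 2 (D.bdMeasure.restrict K) ^ 2 ≤
        C * (eLpNorm φ 2 D.liouville ^ 2 + eLpNorm (D.X φ) 2 D.liouville ^ 2) := by
  obtain ⟨C, hC⟩ := exists_integral_norm_sq_le hK hKout
  refine ⟨ENNReal.ofReal C, ENNReal.ofReal_ne_top, fun φ hφ => ?_⟩
  have m1 : MemLp φ 2 D.liouville := memLp_liouville hφ.continuous 2
  have m2 : MemLp (D.X φ) 2 D.liouville := memLp_liouville hφ.continuous_X 2
  have m3 : MemLp φ 2 (D.bdMeasure.restrict K) := (memLp_bdMeasure hφ.continuous 2).restrict K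
  rw [sq_eLpNorm_two, sq_eLpNorm_two, sq_eLpNorm_two, lintegral_enorm_sq_eq m1,
    lintegral_enorm_sq_eq m2, lintegral_enorm_sq_eq m3,
    ← ENNReal.ofReal_add (integral_nonneg fun _ => sq_nonneg _)
      (integral_nonneg fun _ => sq_nonneg _),
    ← integral_add (m1.integrable_norm_pow (by norm_num)) (m2.integrable_norm_pow (by norm_num)),
    ← ENNReal.ofReal_mul' (integral_nonneg fun _ => by positivity)]
  exact ENNReal.ofReal_le_ofReal (hC φ hφ)

/-- Traces on compact subsets of the outgoing boundary are unique. -/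
theorem IsTraceOn.unique {u w : D.L2SM} {K : Set Phase} (hK : IsCompact K) (hKout : K ⊆ D.outflow)
    {h h' : Phase → ℂ} (hm : AEStronglyMeasurable h (D.bdMeasure.restrict K))
    (hm' : AEStronglyMeasurable h' (D.bdMeasure.restrict K))
    (H : D.IsTraceOn u w K h) (H' : D.IsTraceOn u w K h') : h =ᵐ[D.bdMeasure.restrict K] h' := by
  obtain ⟨φ, hφ, h1, h2, h3⟩ := H
  obtain ⟨φ', hφ', h1', h2', h3'⟩ := H'
  obtain ⟨C, hC, hle⟩ := exists_sq_eLpNorm_le hK hKout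
  have diff : ∀ {μ : Measure Phase} {f f' : ℕ → Phase → ℂ} {g : Phase → ℂ},
      (∀ n, Continuous (f n)) → (∀ n, Continuous (f' n)) → AEStronglyMeasurable g μ →
      Tendsto (fun n => eLpNorm (fun p => f n p - g p) 2 μ) atTop (𝓝 0) →
      Tendsto (fun n => eLpNorm (fun p => f' n p - g p) 2 μ) atTop (𝓝 0) →
      Tendsto (fun n => eLpNorm (fun p => f n p - f' n p) 2 μ) atTop (𝓝 0) := by
    intro μ f f' g hf hf' hg t t'
    have t0 := t.add t'
    rw [add_zero] at t0
    refine tendsto_of_tendsto_of_tendsto_of_le_of_le tendsto_const_nhds t0 (fun _ => zero_le)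
      fun n => ?_
    have e : (fun p => f n p - f' n p) = (fun p => f n p - g p) - fun p => f' n p - g p := by
      ext p; simp
    rw [e]
    exact eLpNorm_sub_le ((hf n).aestronglyMeasurable.sub hg)
      ((hf' n).aestronglyMeasurable.sub hg) (by norm_num)
  have d1 := diff (fun n => (hφ n).continuous) (fun n => (hφ' n).continuous)
    (Lp.aestronglyMeasurable u) h1 h1'
  have d2 := diff (fun n => (hφ n).continuous_X) (fun n => (hφ' n).continuous_X)
    (Lp.aestronglyMeasurable w) h2 h2'
  -- Two sequences approximating the same `u` and `w` differ by a null sequence in the graph norm,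
  -- and the local trace inequality carries this over to `K`.
  have d3 : Tendsto (fun n => eLpNorm (fun p => φ n p - φ' n p) 2 (D.bdMeasure.restrict K)) atTop
      (𝓝 0) := by
    have t : Tendsto (fun n => C * (eLpNorm (fun p => φ n p - φ' n p) 2 D.liouville ^ 2 +
        eLpNorm (fun p => D.X (φ n) p - D.X (φ' n) p) 2 D.liouville ^ 2)) atTop (𝓝 0) := by
      have := ENNReal.Tendsto.const_mul (a := C)
        ((ENNReal.Tendsto.pow (n := 2) d1).add (ENNReal.Tendsto.pow (n := 2) d2)) (Or.inr hC)
      simpa using this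
    have t2 : Tendsto (fun n => eLpNorm (fun p => φ n p - φ' n p) 2
        (D.bdMeasure.restrict K) ^ 2) atTop (𝓝 0) := by
      refine tendsto_of_tendsto_of_tendsto_of_le_of_le tendsto_const_nhds t (fun _ => zero_le)
        fun n => ?_
      have e : D.X (fun p => φ n p - φ' n p) = fun p => D.X (φ n) p - D.X (φ' n) p :=
        funext fun p => X_sub ((hφ n).differentiableAt p) ((hφ' n).differentiableAt p)
      simpa only [e] using hle _ ((hφ n).sub (hφ' n))
    have t3 := t2.ennrpow_const (1 / 2 : ℝ)
    have e : ∀ x : ℝ≥0∞, (x ^ 2) ^ (1 / 2 : ℝ) = x := fun x => by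
      rw [← ENNReal.rpow_two, ← ENNReal.rpow_mul]; norm_num
    simp only [e] at t3
    rwa [ENNReal.zero_rpow_of_pos (by norm_num)] at t3
  have hsum := (h3.add d3).add h3'
  rw [add_zero, add_zero] at hsum
  have hzero : eLpNorm (fun p => h p - h' p) 2 (D.bdMeasure.restrict K) = 0 := by
    refine le_antisymm (ge_of_tendsto' hsum fun n => ?_) zero_le
    have e : (fun p => h p - h' p) = ((fun p => φ n p - φ' n p) - fun p => φ n p - h p) +
        fun p => φ' n p - h' p := by
      ext p; simp
    have c1 := (hφ n).continuous.aestronglyMeasurable (μ := D.bdMeasure.restrict K)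
    have c2 := (hφ' n).continuous.aestronglyMeasurable (μ := D.bdMeasure.restrict K)
    rw [e]
    refine (eLpNorm_add_le ((c1.sub c2).sub (c1.sub hm)) (c2.sub hm') (by norm_num)).trans ?_
    refine add_le_add ((eLpNorm_sub_le (c1.sub c2) (c1.sub hm) (by norm_num)).trans_eq ?_) le_rfl
    rw [add_comm]
    rfl
  have := (eLpNorm_eq_zero_iff (hm.sub hm') (by norm_num)).1 hzero
  filter_upwards [this] with p hp
  exact sub_eq_zero.1 hp

/-- The outgoing boundary is exhausted by compact sets. -/
theorem exists_compact_exhaustion (D : ConformalDomain) : ∃ K : ℕ → Set Phase,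
    (∀ n, IsCompact (K n)) ∧ (∀ n, K n ⊆ D.outflow) ∧
      ∀ p ∈ D.outflow, p.2 ∈ Ioc 0 (2 * Real.pi) → ∃ n, p ∈ K n := by
  refine ⟨fun n => D.bd ×ˢ Icc 0 (2 * Real.pi) ∩ {p | 1 / ((n : ℝ) + 1) ≤ D.slope p},
    fun n => (D.isCompact_bd.prod isCompact_Icc).inter_right
      (isClosed_le continuous_const D.contDiff_slope.continuous), ?_, ?_⟩
  · rintro n p ⟨⟨hp, -⟩, hs⟩
    exact D.mem_outflow_iff.2 ⟨hp, lt_of_lt_of_le (by positivity) hs⟩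
  · intro p hp hp2
    obtain ⟨n, hn⟩ := exists_nat_one_div_lt (D.mem_outflow_iff.1 hp).2
    exact ⟨n, ⟨hp.1, Ioc_subset_Icc_self hp2⟩, hn.le⟩

end Trace

/-- Approximate solvability is enough for duality: since `u` is integrable, `f` may be replaced by
any uniformly close function that is orthogonal to `u`. -/
theorem eq_zero_of_approx {u : Phase → ℂ} (hu : MemLp u 2 D.liouville)
    (h : ∀ f, D.IsTest f → ∀ ε > 0, ∃ g : Phase → ℂ, Continuous g ∧
      (∀ p : Phase, p.1 ∈ D.M → ‖g p - f p‖ ≤ ε) ∧ ∫ p, u p * g p ∂D.liouville = 0) :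
    u =ᵐ[D.liouville] 0 := by
  have hui : Integrable u D.liouville := hu.integrable (by norm_num)
  refine eq_zero_of_forall_isTest hui fun f hf => ?_
  refine norm_le_zero_iff.1 (le_of_forall_pos_le_add fun ε hε => ?_)
  set N := ∫ p, ‖u p‖ ∂D.liouville with hN
  have hN0 : 0 ≤ N := integral_nonneg fun _ => norm_nonneg _
  obtain ⟨g, hg, hgf, hg0⟩ := h f hf (ε / (N + 1)) (by positivity)
  have i1 : Integrable (fun p => u p * f p) D.liouville :=
    hu.integrable_mul (memLp_liouville hf.1.continuous 2)
  have i2 : Integrable (fun p => u p * g p) D.liouville :=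
    hu.integrable_mul (memLp_liouville hg 2)
  rw [zero_add, ← sub_zero (∫ p, u p * f p ∂D.liouville), ← hg0, ← integral_sub i1 i2]
  calc ‖∫ p, (u p * f p - u p * g p) ∂D.liouville‖
      ≤ ∫ p, ‖u p‖ * (ε / (N + 1)) ∂D.liouville := by
        refine norm_integral_le_of_norm_le (hui.norm.mul_const _) ?_
        filter_upwards [D.ae_liouville_mem] with p hp
        rw [← mul_sub, norm_mul, norm_sub_rev]
        exact mul_le_mul_of_nonneg_left (hgf p hp.1) (norm_nonneg _)
    _ = N * (ε / (N + 1)) := by rw [integral_mul_const]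
    _ ≤ (N + 1) * (ε / (N + 1)) := by gcongr; linarith
    _ = ε := by field_simp

/-! ### The transport operator as a closed graph -/

section Graph

variable (D) in
/-- The smooth functions that vanish on the incoming boundary, together with their derivatives
along the flow and their outgoing traces. -/
def smoothGraph : Submodule ℂ (D.L2SM × D.L2SM × D.L2Out) where
  carrier := {z | ∃ φ, D.VanishesOnInflow φ ∧ z.1 =ᵐ[D.liouville] φ ∧
    z.2.1 =ᵐ[D.liouville] D.X φ ∧ z.2.2 =ᵐ[D.bdMeasure.restrict D.outflow] φ}
  zero_mem' := ⟨fun _ => 0, .zero, Lp.coeFn_zero _ _ _,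
    (Lp.coeFn_zero _ _ _).trans (ae_of_all _ fun p => X_zero.symm), Lp.coeFn_zero _ _ _⟩
  add_mem' := by
    rintro z z' ⟨φ, hφ, h1, h2, h3⟩ ⟨φ', hφ', h1', h2', h3'⟩
    refine ⟨_, hφ.add hφ', ?_, ?_, ?_⟩
    · filter_upwards [Lp.coeFn_add z.1 z'.1, h1, h1'] with p e e1 e2
      rw [Prod.fst_add, e, Pi.add_apply, e1, e2]
    · filter_upwards [Lp.coeFn_add z.2.1 z'.2.1, h2, h2'] with p e e1 e2
      rw [Prod.snd_add, Prod.fst_add, e, Pi.add_apply, e1, e2,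
        X_add (hφ.smooth.differentiableAt p) (hφ'.smooth.differentiableAt p)]
    · filter_upwards [Lp.coeFn_add z.2.2 z'.2.2, h3, h3'] with p e e1 e2
      rw [Prod.snd_add, Prod.snd_add, e, Pi.add_apply, e1, e2]
  smul_mem' := by
    rintro c z ⟨φ, hφ, h1, h2, h3⟩
    refine ⟨_, hφ.const_mul c, ?_, ?_, ?_⟩
    · filter_upwards [Lp.coeFn_smul c z.1, h1] with p e e1
      rw [Prod.smul_fst, e, Pi.smul_apply, e1, smul_eq_mul]
    · filter_upwards [Lp.coeFn_smul c z.2.1, h2] with p e e1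
      rw [Prod.smul_snd, Prod.smul_fst, e, Pi.smul_apply, e1, smul_eq_mul,
        X_const_mul c (hφ.smooth.differentiableAt p)]
    · filter_upwards [Lp.coeFn_smul c z.2.2, h3] with p e e1
      rw [Prod.smul_snd, Prod.smul_snd, e, Pi.smul_apply, e1, smul_eq_mul]

variable (D) in
/-- The graph of the transport operator with vanishing incoming boundary values, together with the
outgoing trace. -/
def graph : Submodule ℂ (D.L2SM × D.L2SM × D.L2Out) := D.smoothGraph.topologicalClosure

instance : CompleteSpace D.graph :=
  (Submodule.isClosed_topologicalClosure _).completeSpace_coe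

theorem graph_induction {P : D.L2SM × D.L2SM × D.L2Out → Prop} (hP : IsClosed {z | P z})
    (h : ∀ z ∈ D.smoothGraph, P z) {z : D.L2SM × D.L2SM × D.L2Out} (hz : z ∈ D.graph) : P z := by
  have hz' : z ∈ closure (D.smoothGraph : Set (D.L2SM × D.L2SM × D.L2Out)) := hz
  exact closure_minimal (fun z hz => h z hz) hP hz'

theorem re_inner_nonneg_of_mem_graph {z : D.L2SM × D.L2SM × D.L2Out} (hz : z ∈ D.graph) :
    0 ≤ (inner ℂ z.1 z.2.1 : ℂ).re := by
  refine graph_induction (P := fun z => 0 ≤ (inner ℂ z.1 z.2.1 : ℂ).re) ?_ ?_ hz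
  · exact isClosed_le continuous_const (Complex.continuous_re.comp
      (continuous_fst.inner (continuous_fst.comp continuous_snd)))
  · rintro z ⟨φ, hφ, h1, h2, -⟩
    rw [L2.inner_eq_integral_mul]
    have e : ∫ p, z.2.1 p * starRingEnd ℂ (z.1 p) ∂D.liouville =
        ∫ p, D.X φ p * starRingEnd ℂ (φ p) ∂D.liouville := by
      refine integral_congr_ae ?_
      filter_upwards [h1, h2] with p e1 e2
      rw [e1, e2]
    rw [e]
    have hre := integral_re (𝕜 := ℂ) (integrable_liouville (D := D)
      ((hφ.smooth.continuous_X (D := D)).mul hφ.smooth.conj.continuous))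
    simp only [RCLike.re_eq_complex_re] at hre
    exact hφ.re_integral_nonneg.trans_eq hre

theorem sq_norm_trace_le_of_mem_graph (hconv : D.StrictlyConvex) {C₀ : ℝ}
    (hC : D.IsConvexityConstant C₀) {z : D.L2SM × D.L2SM × D.L2Out} (hz : z ∈ D.graph) :
    ‖z.2.2‖ ^ 2 ≤ C₀ * ‖z.2.1‖ ^ 2 := by
  refine graph_induction (P := fun z => ‖z.2.2‖ ^ 2 ≤ C₀ * ‖z.2.1‖ ^ 2) ?_ ?_ hz
  · exact isClosed_le (by fun_prop) (by fun_prop)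
  · rintro z ⟨φ, hφ, -, h2, h3⟩
    have e1 : ∫ p in D.outflow, ‖z.2.2 p‖ ^ 2 ∂D.bdMeasure =
        ∫ p in D.outflow, ‖φ p‖ ^ 2 ∂D.bdMeasure := by
      refine integral_congr_ae ?_
      filter_upwards [h3] with p e
      rw [e]
    have e2 : ∫ p, ‖z.2.1 p‖ ^ 2 ∂D.liouville = ∫ p, ‖D.X φ p‖ ^ 2 ∂D.liouville := by
      refine integral_congr_ae ?_
      filter_upwards [h2] with p e
      rw [e]
    rw [Lp.sq_norm_eq_integral, Lp.sq_norm_eq_integral, e1, e2]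
    exact hφ.integral_outflow_le hconv hC

theorem norm_trace_le_of_mem_graph (hconv : D.StrictlyConvex) {C₀ : ℝ}
    (hC : D.IsConvexityConstant C₀) {z : D.L2SM × D.L2SM × D.L2Out} (hz : z ∈ D.graph) :
    ‖z.2.2‖ ≤ √C₀ * ‖z.2.1‖ := by
  have h := Real.sqrt_le_sqrt (sq_norm_trace_le_of_mem_graph hconv hC hz)
  rwa [Real.sqrt_sq (norm_nonneg _), Real.sqrt_mul' _ (sq_nonneg _),
    Real.sqrt_sq (norm_nonneg _)] at h

theorem exists_seq_of_mem_graph {z : D.L2SM × D.L2SM × D.L2Out} (hz : z ∈ D.graph) :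
    ∃ φ : ℕ → Phase → ℂ, (∀ n, D.VanishesOnInflow (φ n)) ∧
      Tendsto (fun n => eLpNorm (fun p => φ n p - z.1 p) 2 D.liouville) atTop (𝓝 0) ∧
      Tendsto (fun n => eLpNorm (fun p => D.X (φ n) p - z.2.1 p) 2 D.liouville) atTop (𝓝 0) ∧
      Tendsto (fun n => eLpNorm (fun p => φ n p - z.2.2 p) 2 (D.bdMeasure.restrict D.outflow))
        atTop (𝓝 0) := by
  obtain ⟨y, hy, hlim⟩ := mem_closure_iff_seq_limit.1 hz
  choose φ hφ h1 h2 h3 using hy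
  have l1 := (continuous_fst.tendsto z).comp hlim
  have l2 := ((continuous_fst.comp continuous_snd).tendsto z).comp hlim
  have l3 := ((continuous_snd.comp continuous_snd).tendsto z).comp hlim
  refine ⟨φ, hφ, ?_, ?_, ?_⟩
  · refine ((Lp.tendsto_Lp_iff_tendsto_eLpNorm' _ _).1 l1).congr fun n => eLpNorm_congr_ae ?_
    filter_upwards [h1 n] with p e
    simp [e]
  · refine ((Lp.tendsto_Lp_iff_tendsto_eLpNorm' _ _).1 l2).congr fun n => eLpNorm_congr_ae ?_
    filter_upwards [h2 n] with p e
    simp [e]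
  · refine ((Lp.tendsto_Lp_iff_tendsto_eLpNorm' _ _).1 l3).congr fun n => eLpNorm_congr_ae ?_
    filter_upwards [h3 n] with p e
    simp [e]

theorem isTraceOn_inflow_of_mem_graph {z : D.L2SM × D.L2SM × D.L2Out} (hz : z ∈ D.graph)
    {K : Set Phase} (hK : MeasurableSet K) (hKin : K ⊆ D.inflow) :
    D.IsTraceOn z.1 z.2.1 K 0 := by
  obtain ⟨φ, hφ, h1, h2, -⟩ := exists_seq_of_mem_graph hz
  refine ⟨φ, fun n => (hφ n).smooth, h1, h2, tendsto_const_nhds.congr fun n => ?_⟩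
  refine ((eLpNorm_congr_ae ?_).trans eLpNorm_zero).symm
  filter_upwards [ae_restrict_mem hK] with p hp
  have := D.mem_inflow_iff.1 (hKin hp)
  simp [(hφ n).eq_zero p this.1 this.2.le]

theorem isTraceOn_outflow_of_mem_graph {z : D.L2SM × D.L2SM × D.L2Out} (hz : z ∈ D.graph)
    {K : Set Phase} (hKout : K ⊆ D.outflow) : D.IsTraceOn z.1 z.2.1 K z.2.2 := by
  obtain ⟨φ, hφ, h1, h2, h3⟩ := exists_seq_of_mem_graph hz
  exact ⟨φ, fun n => (hφ n).smooth, h1, h2,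
    tendsto_of_tendsto_of_tendsto_of_le_of_le tendsto_const_nhds h3 (fun _ => zero_le)
      fun n => eLpNorm_mono_measure _ (Measure.restrict_mono hKout le_rfl)⟩

/-- Test functions vanish on the whole boundary, so Green's formula needs no information on traces:
it is used with the empty set. -/
theorem isWeakX_of_mem_graph {z : D.L2SM × D.L2SM × D.L2Out} (hz : z ∈ D.graph) :
    D.IsWeakX z.1 z.2.1 := by
  rintro φ hφ ⟨K, hK, hKint, hsupp⟩
  refine (isTraceOn_inflow_of_mem_graph hz MeasurableSet.empty (empty_subset _)).integral_eq
    hφ fun p hp _ _ => hsupp p fun hpK => ?_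
  have := hKint hpK
  rw [interior_M] at this
  exact absurd hp (ne_of_lt this)

theorem IsWeakX.unique {u w w' : D.L2SM} (h : D.IsWeakX u w) (h' : D.IsWeakX u w') : w = w' := by
  have hm : MemLp (fun p => w p - w' p) 2 D.liouville := (Lp.memLp w).sub (Lp.memLp w')
  have h0 := eq_zero_of_forall_isTest (hm.integrable (by norm_num)) fun φ hφ => by
    have e := h φ hφ.1 hφ.2
    rw [h' φ hφ.1 hφ.2, neg_inj] at e
    have hφm : MemLp φ 2 D.liouville := memLp_liouville hφ.1.continuous 2
    simp only [sub_mul]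
    rw [integral_sub (by exact (Lp.memLp w).integrable_mul hφm)
      (by exact (Lp.memLp w').integrable_mul hφm), e,
      sub_self]
  refine Lp.ext ?_
  filter_upwards [h0] with p hp using sub_eq_zero.1 hp

/-- The damped transport operator has dense range. -/
theorem eq_zero_of_forall_inner_graph (hconv : D.StrictlyConvex) {l : ℝ} (hl : 0 < l) {v : D.L2SM}
    (hv : ∀ z ∈ D.graph, inner ℂ v (z.2.1 + (l : ℂ) • z.1) = (0 : ℂ)) : v = 0 := by
  have hvm : MemLp (fun p => starRingEnd ℂ (v p)) 2 D.liouville := (Lp.memLp v).star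
  have h0 := eq_zero_of_approx hvm fun f hf ε hε => by
    obtain ⟨K, hK, hKint, hsupp⟩ := hf.2
    obtain ⟨φ, hφ, h1, r, hr, h2⟩ := exists_approx_damped hconv hf.1 hK hKint hsupp hl hε
    have hφv : D.VanishesOnInflow φ := ⟨hφ, fun p hp hs => h2 p p hp hs (by simpa using hr)⟩
    have hXφ : Continuous (D.X φ) := hφ.continuous_X
    have m1 : MemLp φ 2 D.liouville := memLp_liouville hφ.continuous 2
    have m2 : MemLp (D.X φ) 2 D.liouville := memLp_liouville hXφ 2
    have m3 : MemLp φ 2 (D.bdMeasure.restrict D.outflow) :=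
      (memLp_bdMeasure hφ.continuous 2).restrict _
    refine ⟨fun p => D.X φ p + l * φ p, hXφ.add (continuous_const.mul hφ.continuous), h1, ?_⟩
    have hz : (m1.toLp, m2.toLp, m3.toLp) ∈ D.graph :=
      Submodule.le_topologicalClosure _ ⟨φ, hφv, m1.coeFn_toLp, m2.coeFn_toLp, m3.coeFn_toLp⟩
    rw [← hv _ hz, L2.inner_eq_integral_mul]
    refine integral_congr_ae ?_
    filter_upwards [Lp.coeFn_add m2.toLp ((l : ℂ) • m1.toLp), Lp.coeFn_smul (l : ℂ) m1.toLp,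
      m1.coeFn_toLp, m2.coeFn_toLp] with p e1 e2 e3 e4
    rw [e1, Pi.add_apply, e2, Pi.smul_apply, e3, e4, smul_eq_mul, mul_comm]
  refine Lp.ext ?_
  filter_upwards [h0, Lp.coeFn_zero ℂ 2 D.liouville] with p hp hp0
  rw [hp0]
  simpa using hp

/-- Functions whose incoming traces vanish belong to the domain of the transport operator. -/
theorem exists_mem_graph (hconv : D.StrictlyConvex) {u w : D.L2SM}
    (hin : ∀ K, IsCompact K → K ⊆ D.inflow → D.IsTraceOn u w K 0)
    (hsurj : ∀ f, ∃ z ∈ D.graph, z.2.1 + z.1 = f) : ∃ z ∈ D.graph, z.1 = u ∧ z.2.1 = w := by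
  obtain ⟨z, hz, hzf⟩ := hsurj (w + u)
  -- `U` solves `X U + U = 0` with vanishing incoming traces. Pairing it with an approximate
  -- solution `ψ` of `-X ψ + ψ = f`, whose boundary values are supported in the compact set `Z ⊆
  -- Γ₋`, leaves no boundary term and shows that `U` is orthogonal to every test function.
  set U := u - z.1 with hU
  have hUW : w - z.2.1 = -U := by
    rw [hU, neg_sub, sub_eq_sub_iff_add_eq_add, add_comm z.1 z.2.1, hzf]
  have h0 := eq_zero_of_approx (Lp.memLp U) fun f hf ε hε => by
    obtain ⟨K, hK, hKint, hsupp⟩ := hf.2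
    obtain ⟨ψ, hψ, h1, Z, hZ, hZin, hZ0⟩ := exists_approx_adjoint hconv hf.1 hK hKint hsupp
      one_pos hε
    have hXψ : Continuous (D.X ψ) := hψ.continuous_X
    have m1 : MemLp ψ 2 D.liouville := memLp_liouville hψ.continuous 2
    have m2 : MemLp (D.X ψ) 2 D.liouville := memLp_liouville hXψ 2
    refine ⟨fun p => -D.X ψ p + (1 : ℝ) * ψ p,
      hXψ.neg.add (continuous_const.mul hψ.continuous), h1, ?_⟩
    have g1 := (hin Z hZ hZin).integral_eq hψ hZ0
    have g2 := (isTraceOn_inflow_of_mem_graph hz hZ.isClosed.measurableSet hZin).integral_eq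
      hψ hZ0
    have hi {v : D.L2SM} {χ : Phase → ℂ} (hχ : MemLp χ 2 D.liouville) :
        Integrable (fun p => v p * χ p) D.liouville := (Lp.memLp v).integrable_mul hχ
    have s1 : ∫ p, U p * D.X ψ p ∂D.liouville =
        (∫ p, u p * D.X ψ p ∂D.liouville) - ∫ p, z.1 p * D.X ψ p ∂D.liouville := by
      rw [← integral_sub (hi m2) (hi m2)]
      refine integral_congr_ae ?_
      filter_upwards [Lp.coeFn_sub u z.1] with p e
      rw [hU, e, Pi.sub_apply, sub_mul]
    have s2 : ∫ p, U p * ψ p ∂D.liouville =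
        (∫ p, z.2.1 p * ψ p ∂D.liouville) - ∫ p, w p * ψ p ∂D.liouville := by
      rw [← integral_sub (hi m1) (hi m1)]
      refine integral_congr_ae ?_
      have hU' : U = z.2.1 - w := by rw [← neg_sub, hUW, neg_neg]
      filter_upwards [Lp.coeFn_sub z.2.1 w] with p e
      rw [hU', e, Pi.sub_apply, sub_mul]
    have s3 : ∫ p, U p * (-D.X ψ p + (1 : ℝ) * ψ p) ∂D.liouville =
        (∫ p, U p * ψ p ∂D.liouville) - ∫ p, U p * D.X ψ p ∂D.liouville := by
      rw [← integral_sub (hi m1) (hi m2)]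
      refine integral_congr_ae (ae_of_all _ fun p => ?_)
      simp only [Complex.ofReal_one]
      ring
    rw [s3, s1, s2, g1, g2]
    ring
  have hU0 : U = 0 := by
    refine Lp.ext ?_
    filter_upwards [h0, Lp.coeFn_zero ℂ 2 D.liouville] with p hp hp0
    rw [hp0, hp]
  refine ⟨z, hz, (sub_eq_zero.1 hU0).symm, ?_⟩
  rw [hU0, neg_zero] at hUW
  exact (sub_eq_zero.1 hUW).symm

end Graph

end ConformalDomain

/-! ### Solvability and the outgoing trace -/

namespace ConformalDomain

variable {D : ConformalDomain}

section Solve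

variable (D) in
/-- The first component of an element of the graph. -/
def graphFun : D.graph →L[ℂ] D.L2SM := (ContinuousLinearMap.fst ℂ _ _).comp D.graph.subtypeL

variable (D) in
/-- The derivative along the flow of an element of the graph. -/
def graphDeriv : D.graph →L[ℂ] D.L2SM :=
  ((ContinuousLinearMap.fst ℂ _ _).comp (ContinuousLinearMap.snd ℂ _ _)).comp D.graph.subtypeL

variable (D) in
/-- The outgoing trace of an element of the graph. -/
def graphTrace : D.graph →L[ℂ] D.L2Out :=
  ((ContinuousLinearMap.snd ℂ _ _).comp (ContinuousLinearMap.snd ℂ _ _)).comp D.graph.subtypeL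

theorem graphFun_apply (e : D.graph) : D.graphFun e = e.1.1 := rfl

theorem graphDeriv_apply (e : D.graph) : D.graphDeriv e = e.1.2.1 := rfl

theorem graphTrace_apply (e : D.graph) : D.graphTrace e = e.1.2.2 := rfl

theorem re_inner_graphFun_nonneg (e : D.graph) :
    0 ≤ (inner ℂ (D.graphFun e) (D.graphDeriv e) : ℂ).re := by
  rw [graphFun_apply, graphDeriv_apply]
  exact re_inner_nonneg_of_mem_graph e.2

theorem norm_graphTrace_le (hconv : D.StrictlyConvex) {C₀ : ℝ} (hC : D.IsConvexityConstant C₀)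
    (e : D.graph) : ‖D.graphTrace e‖ ≤ √C₀ * ‖D.graphDeriv e‖ := by
  rw [graphTrace_apply, graphDeriv_apply]
  exact norm_trace_le_of_mem_graph hconv hC e.2

theorem bijective_graph (hconv : D.StrictlyConvex) {C₀ : ℝ} (hC : D.IsConvexityConstant C₀)
    {B : D.L2SM →L[ℂ] D.L2SM} {δ : ℝ} (hδ : 0 < δ)
    (hB : ∀ u, δ * ‖u‖ ^ 2 ≤ (inner ℂ u (B u) : ℂ).re) :
    Function.Bijective (D.graphDeriv + B ∘L D.graphFun) := by
  -- The norm on the graph is the maximum over three components; the trace estimate bounds the third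
  -- one by the second.
  refine bijective_of_accretive (C := 1 + √C₀) re_inner_graphFun_nonneg
    (fun e => ?_) (fun l hl v hv => eq_zero_of_forall_inner_graph hconv hl fun z hz => ?_) hδ hB
  swap
  · have h := hv ⟨z, hz⟩
    rwa [graphFun_apply, graphDeriv_apply] at h
  have h := norm_graphTrace_le hconv hC e
  have h1 : 0 ≤ √C₀ * ‖D.graphFun e‖ := by positivity
  have h2 : 0 ≤ √C₀ * ‖D.graphDeriv e‖ := by positivity
  have h3 : ‖e‖ = max ‖D.graphFun e‖ (max ‖D.graphDeriv e‖ ‖D.graphTrace e‖) := rfl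
  rw [h3, max_le_iff, max_le_iff]
  have h4 := norm_nonneg (D.graphFun e)
  have h5 := norm_nonneg (D.graphDeriv e)
  refine ⟨?_, ?_, ?_⟩ <;> nlinarith

/-- The weak boundary value problem becomes an equation for a bounded bijection on the graph. The
point is that a weak solution belongs to the closure of the smooth functions. -/
theorem isSolution_iff (hconv : D.StrictlyConvex) {C₀ : ℝ} (hC : D.IsConvexityConstant C₀)
    {a : Plane → ℝ} {k : Plane → ℝ → ℝ} {B : D.L2SM →L[ℂ] D.L2SM}
    (hB : ∀ u : D.L2SM, B u =ᵐ[D.liouville] fun p => (a p.1 : ℂ) * u p - scatter k u p)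
    {f u : D.L2SM} : D.IsSolution a k f u ↔
      ∃ e : D.graph, D.graphFun e = u ∧ D.graphDeriv e + B (D.graphFun e) = f := by
  have heq : ∀ w : D.L2SM, (∀ᵐ p ∂D.liouville, w p + (a p.1 : ℂ) * u p = scatter k u p + f p) ↔
      w + B u = f := by
    intro w
    constructor
    · intro h
      refine Lp.ext ?_
      filter_upwards [Lp.coeFn_add w (B u), hB u, h] with p e1 e2 e3
      rw [e1, Pi.add_apply, e2, add_sub, e3, add_sub_cancel_left]
    · rintro rfl
      filter_upwards [Lp.coeFn_add w (B u), hB u] with p e1 e2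
      rw [e1, Pi.add_apply, e2]
      ring
  constructor
  · rintro ⟨w, -, h1, h2⟩
    obtain ⟨z, hz, rfl, rfl⟩ := exists_mem_graph hconv h2 fun f => by
      -- Solvability of `X z + z = f` in the graph is the case in which the collision operator is
      -- the identity.
      obtain ⟨e, he⟩ := (bijective_graph hconv hC (B := ContinuousLinearMap.id ℂ _) one_pos
        fun u => by simp [inner_self_eq_norm_sq_to_K, ← Complex.ofReal_pow]).2 f
      exact ⟨e, e.2, he⟩
    exact ⟨⟨z, hz⟩, rfl, (heq _).1 h1⟩
  · rintro ⟨e, rfl, he⟩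
    exact ⟨D.graphDeriv e, isWeakX_of_mem_graph e.2, (heq _).2 he, fun K hK hKin =>
      isTraceOn_inflow_of_mem_graph e.2 hK.isClosed.measurableSet hKin⟩

/-- The weak derivative is unique, traces on compact subsets of `Γ₊` are unique, and countably many
such subsets exhaust `Γ₊` up to a null set. -/
theorem isOutTrace_iff (e : D.graph) (h : D.L2Out) :
    D.IsOutTrace (D.graphFun e) h ↔ h = D.graphTrace e := by
  constructor
  · rintro ⟨w, hw, hK⟩
    obtain rfl := hw.unique (isWeakX_of_mem_graph e.2)
    obtain ⟨K, hKc, hKout, hKex⟩ := D.exists_compact_exhaustion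
    have hm (h : D.L2Out) (n : ℕ) : AEStronglyMeasurable h (D.bdMeasure.restrict (K n)) :=
      (Lp.aestronglyMeasurable h).mono_measure (Measure.restrict_mono (hKout n) le_rfl)
    have hae : ∀ᵐ p ∂D.bdMeasure, ∀ n, p ∈ K n → h p = D.graphTrace e p := by
      rw [ae_all_iff]
      intro n
      rw [← ae_restrict_iff' (hKc n).isClosed.measurableSet]
      exact (hK _ (hKc n) (hKout n)).unique (hKc n) (hKout n) (hm _ n) (hm _ n)
        (isTraceOn_outflow_of_mem_graph e.2 (hKout n))
    refine Lp.ext ?_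
    filter_upwards [ae_restrict_of_ae hae, ae_restrict_of_ae D.ae_bdMeasure_mem,
      ae_restrict_mem measurableSet_outflow] with p h1 h2 h3
    obtain ⟨n, hn⟩ := hKex p h3 h2.2
    exact h1 n hn
  · rintro rfl
    exact ⟨D.graphDeriv e, isWeakX_of_mem_graph e.2, fun K _ hKout =>
      isTraceOn_outflow_of_mem_graph e.2 hKout⟩

end Solve

end ConformalDomain

end

theorem theorem1 (D : ConformalDomain) (hconv : D.StrictlyConvex) (hnt : D.NonTrapping)
    (a : Plane → ℝ) (k : Plane → ℝ → ℝ) (hak : D.Admissible a k)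
    (δ : ℝ) (hδ : 0 < δ) (hsub : D.Subcritical a k δ) :
    (∃ C₀ : ℝ, 0 < C₀ ∧ D.IsConvexityConstant C₀) ∧
    (∀ f : D.L2SM, ∃! u : D.L2SM, D.IsSolution a k f u) ∧
    ∃ 𝓜 : D.L2SM →L[ℂ] D.L2Out,
      (∀ (f u : D.L2SM) (h : D.L2Out), D.IsSolution a k f u → (D.IsOutTrace u h ↔ h = 𝓜 f)) ∧
      ∀ C₀ : ℝ, D.IsConvexityConstant C₀ → ‖𝓜‖ ≤ √C₀ * (D.Qinf a k / δ + 1) := by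
  obtain ⟨C, hC0, hC⟩ := ConformalDomain.exists_convexityConstant hconv hnt
  obtain ⟨B, hB, hcoer, hnorm⟩ := ConformalDomain.exists_collision hδ hak hsub
  obtain ⟨A, σ, hA, hσ, hQ, -, -⟩ := ConformalDomain.exists_bounds hδ hak hsub
  have hQ0 : 0 ≤ D.Qinf a k := by rw [hQ]; positivity
  have hbij := ConformalDomain.bijective_graph hconv hC hδ hcoer
  set T : D.graph →L[ℂ] D.L2SM := D.graphDeriv + B ∘L D.graphFun with hT
  let R : D.graph ≃L[ℂ] D.L2SM := ContinuousLinearEquiv.ofBijective T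
    (LinearMap.ker_eq_bot.2 hbij.1) (LinearMap.range_eq_top.2 hbij.2)
  have hR : ∀ f, T (R.symm f) = f := fun f => R.apply_symm_apply f
  have hsol := fun f u => ConformalDomain.isSolution_iff hconv hC hB (f := f) (u := u)
  refine ⟨⟨C, hC0, hC⟩, fun f => ⟨D.graphFun (R.symm f), (hsol _ _).2 ⟨R.symm f, rfl, hR f⟩,
    fun u hu => ?_⟩, D.graphTrace ∘L R.symm.toContinuousLinearMap, fun f u h hu => ?_,
    fun C₀ hC₀ => ?_⟩
  · obtain ⟨e, rfl, he⟩ := (hsol _ _).1 hu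
    rw [hbij.1 ((hR f).trans he.symm)]
  · obtain ⟨e, rfl, he⟩ := (hsol _ _).1 hu
    rw [ConformalDomain.isOutTrace_iff e h]
    change _ ↔ h = D.graphTrace (R.symm f)
    rw [hbij.1 ((hR f).trans he.symm)]
  -- The solution operator was built with one constant `C`, but the trace estimate on the graph
  -- holds with any convexity constant `C₀`.
  · refine ContinuousLinearMap.opNorm_le_bound _ (by positivity) fun f => ?_
    change ‖D.graphTrace (R.symm f)‖ ≤ _
    set e := R.symm f with he
    have h1 : D.graphDeriv e + B (D.graphFun e) = f := hR f
    have h2 := coercive_mul_norm_le (U := D.graphFun) (W := D.graphDeriv)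
      ConformalDomain.re_inner_graphFun_nonneg hcoer e
    rw [h1] at h2
    have h3 : ‖D.graphTrace e‖ ≤ √C₀ * ‖D.graphDeriv e‖ :=
      ConformalDomain.norm_graphTrace_le hconv hC₀ e
    have h4 : ‖D.graphFun e‖ ≤ ‖f‖ / δ := by rw [le_div_iff₀ hδ]; linarith
    calc ‖D.graphTrace e‖ ≤ √C₀ * ‖D.graphDeriv e‖ := h3
      _ ≤ √C₀ * (‖f‖ + D.Qinf a k * (‖f‖ / δ)) := by
        gcongr
        rw [eq_sub_of_add_eq h1]
        refine (norm_sub_le _ _).trans ?_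
        gcongr
        exact (hnorm _).trans (by gcongr)
      _ = √C₀ * (D.Qinf a k / δ + 1) * ‖f‖ := by ring
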